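/- Let $k$ be a field and let $\hat{\mathcal C}$ be the category of complete local commutative Noetherian $k$-algebras with residue field $k$, with continuous (equivalently, local) $k$-algebra homomorphisms. Let $\Lambda$ be a finite-dimensional $k$-algebra and $V$ a finitely generated left $\Lambda$-module. A lift of $V$ over $R\in\hat{\mathcal C}$ is a pair $(M,\phi)$, where $M$ is a finitely generated $R\otimes_k\Lambda$-module that is free over $R$ and $\phi:k\otimes_R M\to V$ is an isomorphism of $\Lambda$-modules; lifts $(M,\phi)$, $(M',\phi')$ are isomorphic if there is an $R\otimes_k\Lambda$-isomorphism $f:M\to M'$ with $\phi'\circ(k\otimes_R f)=\phi$. A morphism $\psi:R\to S$ of $\hat{\mathcal C}$ sends $(M,\phi)$ to the lift $S\otimes_{R,\psi}M$ with the induced isomorphism $k\otimes_S(S\otimes_{R,\psi} M)\cong k\otimes_R M\xrightarrow{\phi}V$. A versal deformation of $V$ is a lift $U$ over some $R(\Lambda,V)\in\hat{\mathcal C}$ such that for every $S\in\hat{\mathcal C}$ and every lift $L$ of $V$ over $S$ there is a morphism $\psi:R(\Lambda,V)\to S$ sending $U$ to a lift isomorphic to $L$, with $\psi$ unique when $S=k[\epsilon]$,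 $\epsilon^2=0$; then $R(\Lambda,V)$ is called the versal deformation ring of $V$. It is universal if $\psi$ is unique for all $S$ and $L$. A $\Lambda$-module $M$ is Gorenstein-projective if there is an acyclic complex $(P^\bullet,f^\bullet)$ of projective left $\Lambda$-modules with $\mathrm{Hom}_\Lambda(P^\bullet,\Lambda)$ acyclic and $M\cong\mathrm{coker} f^0$. The stable endomorphism ring $\underline{\mathrm{End}}_\Lambda(V)$ is $\mathrm{End}_\Lambda(V)$ modulo the endomorphisms that factor through a projective module, and $\Omega V$ is the kernel of a projective cover of $V$. $\Lambda$ is Gorenstein if it has finite injective dimension as a left and as a right module over itself. For finite-dimensional $k$-algebras $\Lambda,\Gamma$, a $\Gamma$-$\Lambda$-bimodule $X$ and a $\Lambda$-$\Gamma$-bimodule $Y$ (with $k$ acting centrally) induce a singular equivalence of Morita type if $X$ and $Y$ are each finitely generated projective as left and as right modules, and there are a finitely generated $\Gamma$-$\Gamma$-bimodule $Q$ and a finitely generated $\Lambda$-$\Lambda$-bimodule $P$, both of finite projective dimension as bimodules, with $X\otimes_\Lambda Y\cong\Gamma\oplus Q$ and $Y\otimes_\Gamma X\cong\Lambda\oplus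 P$ as bimodules. **Theorem.** Let $V$ be a finitely generated Gorenstein-projective left module over a finite-dimensional $k$-algebra $\Lambda$. (i) For every finitely generated projective left $\Lambda$-module $P$, versal deformation rings of $V$ and of $V\oplus P$ exist, and any such rings $R(\Lambda,V)$ and $R(\Lambda,V\oplus P)$ are isomorphic in $\hat{\mathcal C}$. (ii) If $\underline{\mathrm{End}}_\Lambda(V)\cong k$ as $k$-algebras, then $V$ has a versal deformation, and every versal deformation of $V$ is universal. Moreover $V$ has a first syzygy $\Omega V$, and likewise $\Omega V$ has a versal deformation, and every versal deformation of $\Omega V$ is universal. (iii) Assume that $\Lambda$ is Gorenstein, that $\Gamma$ is another finite-dimensional Gorenstein $k$-algebra, and that a $\Gamma$-$\Lambda$-bimodule $X$ and a $\Lambda$-$\Gamma$-bimodule $Y$ induce a singular equivalence of Morita type between $\Lambda$ and $\Gamma$. Then $X\otimes_\Lambda V$ is a finitely generated Gorenstein-projective left $\Gamma$-module, versal deformation rings of $V$ and of $X\otimes_\Lambda V$ exist, and any such rings $R(\Lambda,V)$ and $R(\Gamma,X\otimes_\Lambda V)$ are isomorphic in $\hat{\mathcal C}$. -/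

import Mathlib

open scoped TensorProduct
open CategoryTheory

universe u

namespace DeformationRings

/-! ### The category `Ĉ` of complete local Noetherian `k`-algebras with residue field `k` -/

/-- Complete local commutative Noetherian `k`-algebras with residue field `k`. -/
structure CHat (k : Type u) [Field k] where
  carrier : Type u
  [commRing : CommRing carrier]
  [algebra : Algebra k carrier]
  [isLocalRing : IsLocalRing carrier]
  [isNoetherianRing : IsNoetherianRing carrier]
  [isAdicComplete : IsAdicComplete (IsLocalRing.maximalIdeal carrier) carrier]
  /-- the structure map identifies `k` with the residue field -/
  residue_bijective : Function.Bijective (algebraMap k (IsLocalRing.ResidueField carrier))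

namespace CHat

variable {k : Type u} [Field k]

instance : CoeSort (CHat k) (Type u) := ⟨CHat.carrier⟩

attribute [instance] commRing algebra isLocalRing isNoetherianRing isAdicComplete

/-- Morphisms of `Ĉ`: local `k`-algebra homomorphisms. Locality is the same as continuity for the
topologies given by the powers of the maximal ideals, and a local `k`-algebra homomorphism induces
the identity on the common residue field `k`. -/
@[ext]
structure Hom (R S : CHat k) where
  toAlgHom : R →ₐ[k] S
  isLocalHom : IsLocalHom toAlgHom.toRingHom

instance : Category (CHat k) where
  Hom := Hom
  id R := ⟨AlgHom.id k R, ⟨fun _ h => h⟩⟩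
  comp f g := ⟨g.toAlgHom.comp f.toAlgHom,
    ⟨fun a h => f.isLocalHom.map_nonunit a (g.isLocalHom.map_nonunit _ h)⟩⟩

variable (k) in
/-- The ring of dual numbers `k[ε]`, `ε² = 0`, as an object of `Ĉ`. -/
noncomputable def dual : CHat k where
  carrier := DualNumber k
  isAdicComplete := by
    have h2 : (IsLocalRing.maximalIdeal (DualNumber k)) ^ 2 = ⊥ := by
      rw [DualNumber.maximalIdeal_eq_span_singleton_eps, Ideal.span_singleton_pow, pow_two,
        DualNumber.eps_mul_eps, Ideal.span_singleton_eq_bot]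
    have hH : IsHausdorff (IsLocalRing.maximalIdeal (DualNumber k)) (DualNumber k) := by
      refine ⟨fun x hx => ?_⟩
      have := hx 2
      rw [h2] at this
      simpa [SModEq.zero] using this
    have hP : IsPrecomplete (IsLocalRing.maximalIdeal (DualNumber k)) (DualNumber k) := by
      refine ⟨fun {f} hf => ⟨f 2, fun n => ?_⟩⟩
      rcases le_total n 2 with h | h
      · exact hf h
      · have h' := hf h
        rw [h2, Submodule.bot_smul, SModEq.bot] at h'
        exact h' ▸ SModEq.rfl
    exact { hH, hP with }
  residue_bijective := by
    refine ⟨(algebraMap k (IsLocalRing.ResidueField (DualNumber k))).injective, fun y => ?_⟩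
    obtain ⟨x, rfl⟩ := IsLocalRing.residue_surjective y
    refine ⟨x.fst, ?_⟩
    rw [IsScalarTower.algebraMap_apply k (DualNumber k)
      (IsLocalRing.ResidueField (DualNumber k)), IsLocalRing.ResidueField.algebraMap_eq,
      ← sub_eq_zero, ← map_sub, IsLocalRing.residue_eq_zero_iff,
      DualNumber.maximalIdeal_eq_span_singleton_eps, Ideal.mem_span_singleton,
      ← DualNumber.fst_eq_zero_iff_eps_dvd]
    simp [TrivSqZeroExt.algebraMap_eq_inl]

end CHat

/-! ### Lifts, deformations, versal and universal deformation rings -/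

section BaseChange

variable (Λ R S M : Type u) [Ring Λ] [CommRing R] [CommRing S] [Algebra R S] [AddCommGroup M]
  [Module R M] [Module Λ M] [SMulCommClass R Λ M]

/-- The action `a • (s ⊗ m) = s ⊗ (a • m)` of `Λ` on `S ⊗[R] M`. -/
noncomputable abbrev baseChangeModule : Module Λ (S ⊗[R] M) :=
  haveI : SMulCommClass Λ R M := SMulCommClass.symm R Λ M
  Module.compHom _ ((Module.End.lTensorAlgHom R M S).toRingHom.comp
    (Module.toModuleEnd R (S := Λ) M))

end BaseChange

/-- A lift of the `Λ`-module `V` over `R`: a module `M` over `R ⊗[k] Λ` (that is, `M` carries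
commuting actions of `R` and `Λ` which agree on `k`), finitely generated and free over `R`, with
an isomorphism of `Λ`-modules `φ : M ⊗[R] k → V`, where `k` is the residue field of `R`. As `Λ` is
finite-dimensional, `M` is finitely generated over `R ⊗[k] Λ` if and only if it is so over `R`. -/
structure Lift (k : Type u) [Field k] (Λ : Type u) [Ring Λ] [Algebra k Λ]
    (V : Type u) [AddCommGroup V] [Module Λ V] (R : CHat k) where
  carrier : Type u
  [addCommGroup : AddCommGroup carrier]
  [module : Module R carrier]
  [moduleAlg : Module Λ carrier]
  [smulCommClass : SMulCommClass R Λ carrier]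
  smul_compat : ∀ (c : k) (m : carrier), algebraMap k R c • m = algebraMap k Λ c • m
  [free : Module.Free R carrier]
  [finite : Module.Finite R carrier]
  φ : carrier ⊗[R] IsLocalRing.ResidueField R ≃ₗ[Λ] V

namespace Lift

variable {k : Type u} [Field k] {Λ : Type u} [Ring Λ] [Algebra k Λ]
  {V : Type u} [AddCommGroup V] [Module Λ V] {R S : CHat k}

attribute [instance] addCommGroup module moduleAlg smulCommClass free finite

/-- Two lifts define the same deformation: there is an isomorphism `f : M → M'`
of `R ⊗[k] Λ`-modules with `φ' ∘ (f ⊗ k) = φ`. -/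
def Equivalent (L L' : Lift k Λ V R) : Prop :=
  ∃ f : L.carrier ≃ₗ[R] L'.carrier, (∀ (a : Λ) (m : L.carrier), f (a • m) = a • f m) ∧
    ∀ t : L.carrier ⊗[R] IsLocalRing.ResidueField R,
      L'.φ (f.toLinearMap.rTensor (IsLocalRing.ResidueField R) t) = L.φ t

end Lift

namespace CHat
variable {k : Type u} [Field k] {R S : CHat k}

/-- A morphism of `Ĉ` makes its target an algebra over its source. -/
abbrev Hom.algebra (ψ : R ⟶ S) : Algebra R S := ψ.toAlgHom.toRingHom.toAlgebra

/-- The residue fields of `R` and `S` (both equal to `k`) are identified by any `ψ : R ⟶ S`. -/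
noncomputable def residueEquiv (ψ : R ⟶ S) :
    letI := Hom.algebra ψ
    IsLocalRing.ResidueField R ≃ₗ[R] IsLocalRing.ResidueField S :=
  letI := Hom.algebra ψ
  haveI : IsLocalHom (algebraMap R S) := ψ.isLocalHom
  haveI : IsScalarTower k R S := IsScalarTower.of_algebraMap_eq fun c => (ψ.toAlgHom.commutes c).symm
  LinearEquiv.ofBijective
    ((IsScalarTower.toAlgHom R (IsLocalRing.ResidueField R) (IsLocalRing.ResidueField S)).toLinearMap)
    (by
      refine ⟨(algebraMap (IsLocalRing.ResidueField R) (IsLocalRing.ResidueField S)).injective, ?_⟩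
      intro y
      obtain ⟨c, rfl⟩ := S.residue_bijective.2 y
      refine ⟨algebraMap k _ c, ?_⟩
      simp only [AlgHom.toLinearMap_apply, IsScalarTower.coe_toAlgHom']
      rw [IsScalarTower.algebraMap_apply k R (IsLocalRing.ResidueField R),
        ← IsScalarTower.algebraMap_apply R (IsLocalRing.ResidueField R) (IsLocalRing.ResidueField S),
        IsScalarTower.algebraMap_apply R S (IsLocalRing.ResidueField S),
        ← IsScalarTower.algebraMap_apply k R S,
        ← IsScalarTower.algebraMap_apply k S])

end CHat

namespace Lift

variable {k : Type u} [Field k] {Λ : Type u} [Ring Λ] [Algebra k Λ]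
  {V : Type u} [AddCommGroup V] [Module Λ V] {R S : CHat k}

/-- The canonical isomorphism `(S ⊗[R] M) ⊗[S] k ≅ M ⊗[R] k`. -/
noncomputable def reductionEquiv (ψ : R ⟶ S) (L : Lift k Λ V R) :
    letI := CHat.Hom.algebra ψ
    letI := baseChangeModule Λ R S L.carrier
    (S ⊗[R] L.carrier) ⊗[S] IsLocalRing.ResidueField S ≃+
      L.carrier ⊗[R] IsLocalRing.ResidueField R :=
  letI := CHat.Hom.algebra ψ
  (TensorProduct.comm S (S ⊗[R] L.carrier) (IsLocalRing.ResidueField S)).toAddEquiv.trans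
    ((TensorProduct.AlgebraTensorModule.cancelBaseChange R S S
      (IsLocalRing.ResidueField S) L.carrier).toAddEquiv.trans
      ((TensorProduct.comm R (IsLocalRing.ResidueField S) L.carrier).toAddEquiv.trans
        (TensorProduct.congr (LinearEquiv.refl R L.carrier)
          (CHat.residueEquiv ψ).symm).toAddEquiv))

/-- The lift `S ⊗[R] M` of `V` over `S` obtained from a lift `M` over `R` along `ψ : R ⟶ S`, with
`φ_ψ : (S ⊗[R] M) ⊗[S] k ≅ M ⊗[R] k → V`. -/
noncomputable def map (ψ : R ⟶ S) (L : Lift k Λ V R) : Lift k Λ V S :=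
  letI := CHat.Hom.algebra ψ
  letI := baseChangeModule Λ R S L.carrier
  haveI : SMulCommClass S Λ (S ⊗[R] L.carrier) := ⟨fun s a t => by
    induction t with
    | zero => simp
    | add x y hx hy => simp only [smul_add, hx, hy]
    | tmul x m => rfl⟩
  { carrier := S ⊗[R] L.carrier
    smul_compat := fun c t => by
      induction t with
      | zero => simp
      | add x y hx hy => simp only [smul_add, hx, hy]
      | tmul x m =>
        have h1 : algebraMap k Λ c • (x ⊗ₜ[R] m) = x ⊗ₜ[R] (algebraMap k Λ c • m) := rfl
        have h2 : algebraMap k S c = algebraMap R S (algebraMap k R c) :=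
          (ψ.toAlgHom.commutes c).symm
        rw [h1, ← L.smul_compat, TensorProduct.tmul_smul, h2, algebraMap_smul]
    φ :=
      { (L.reductionEquiv ψ).trans L.φ.toAddEquiv with
        map_smul' := fun a t => by
          have key : ∀ t, L.reductionEquiv ψ (a • t) = a • L.reductionEquiv ψ t := by
            intro t
            induction t with
            | zero => simp
            | add x y hx hy => simp only [smul_add, map_add, hx, hy]
            | tmul x c =>
              induction x with
              | zero => simp
              | add x y hx hy => simp only [TensorProduct.add_tmul, smul_add, map_add, hx, hy]
              | tmul s m => rfl
          change L.φ (L.reductionEquiv ψ (a • t)) = a • L.φ (L.reductionEquiv ψ t)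
          rw [key, map_smul] } }

/-- `(R, U)` is versal: every lift over every `S` is obtained from `U`, up to isomorphism of lifts,
along some morphism `ψ : R ⟶ S`, which is unique if `S = k[ε]`. -/
def IsVersal (U : Lift k Λ V R) : Prop :=
  (∀ (S : CHat k) (L : Lift k Λ V S), ∃ ψ : R ⟶ S, (U.map ψ).Equivalent L) ∧
    ∀ L : Lift k Λ V (CHat.dual k), ∃! ψ : R ⟶ CHat.dual k, (U.map ψ).Equivalent L

/-- `(R, U)` is universal: every lift over every `S` is obtained from `U`, up to isomorphism of
lifts, along a unique morphism `ψ : R ⟶ S`. -/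
def IsUniversal (U : Lift k Λ V R) : Prop :=
  ∀ (S : CHat k) (L : Lift k Λ V S), ∃! ψ : R ⟶ S, (U.map ψ).Equivalent L

end Lift

section Rings

variable (k : Type u) [Field k] (Λ : Type u) [Ring Λ] [Algebra k Λ]
  (V : Type u) [AddCommGroup V] [Module Λ V]

/-- `R` is a versal deformation ring of `V`. -/
def IsVersalDeformationRing (R : CHat k) : Prop :=
  ∃ U : Lift k Λ V R, U.IsVersal

/-- The versal deformation ring `R(Λ, V)` is universal: a versal deformation exists, and every
versal deformation is universal. -/
def VersalDeformationRingIsUniversal : Prop :=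
  (∃ R : CHat k, IsVersalDeformationRing k Λ V R) ∧
    ∀ (R : CHat k) (U : Lift k Λ V R), U.IsVersal → U.IsUniversal

/-- The versal deformation rings `R(Λ, V)` and `R(Γ, W)` exist and are isomorphic in `Ĉ`. -/
def HaveIsomorphicVersalDeformationRings (Γ : Type u) [Ring Γ] [Algebra k Γ]
    (W : Type u) [AddCommGroup W] [Module Γ W] : Prop :=
  (∃ R : CHat k, IsVersalDeformationRing k Λ V R) ∧
  (∃ S : CHat k, IsVersalDeformationRing k Γ W S) ∧
    ∀ R S : CHat k, IsVersalDeformationRing k Λ V R → IsVersalDeformationRing k Γ W S →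
      Nonempty (R ≅ S)

end Rings

/-! ### Gorenstein-projective modules, stable endomorphisms, syzygies, Gorenstein algebras -/

section Modules

variable (Λ : Type u) [Ring Λ]

/-- `M` is Gorenstein-projective: there is an acyclic complex `(P, f)` of projective modules such
that `Hom(P, Λ)` is acyclic and `M ≅ coker f⁰`. -/
def IsGorensteinProjective (M : Type u) [AddCommGroup M] [Module Λ M] : Prop :=
  ∃ (P : ℤ → ModuleCat.{u} Λ) (f : ∀ i, P i →ₗ[Λ] P (i + 1)),
    (∀ i, Module.Projective Λ (P i)) ∧
    (∀ i, Function.Exact (f i) (f (i + 1))) ∧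
    (∀ i, Function.Exact (fun h : P (i + 1 + 1) →ₗ[Λ] Λ => h ∘ₗ f (i + 1))
      (fun h : P (i + 1) →ₗ[Λ] Λ => h ∘ₗ f i)) ∧
    Nonempty ((P (0 + 1) ⧸ LinearMap.range (f 0)) ≃ₗ[Λ] M)

/-- The ideal of `End_Λ(V)` of endomorphisms which factor through a projective module. -/
def projectiveEnds (V : Type u) [AddCommGroup V] [Module Λ V] : Ideal (Module.End Λ V) where
  carrier := {f | ∃ (P : ModuleCat.{u} Λ) (_ : Module.Projective Λ P) (g : V →ₗ[Λ] P)
    (h : P →ₗ[Λ] V), f = h ∘ₗ g}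
  add_mem' := by
    rintro _ _ ⟨P, _, g, h, rfl⟩ ⟨P', _, g', h', rfl⟩
    refine ⟨ModuleCat.of Λ (P × P'), inferInstanceAs (Module.Projective Λ (P × P')),
      g.prod g', h.coprod h', ?_⟩
    ext x
    simp
  zero_mem' := ⟨ModuleCat.of Λ PUnit.{u + 1},
    inferInstanceAs (Module.Projective Λ PUnit.{u + 1}), 0, 0, by simp⟩
  smul_mem' := by
    rintro a _ ⟨P, hP, g, h, rfl⟩
    exact ⟨P, hP, g, a ∘ₗ h, rfl⟩

instance (V : Type u) [AddCommGroup V] [Module Λ V] : (projectiveEnds Λ V).IsTwoSided :=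
  ⟨by
    rintro _ b ⟨P, hP, g, h, rfl⟩
    exact ⟨P, hP, g ∘ₗ b, h, rfl⟩⟩

/-- The stable endomorphism ring of `V`. -/
abbrev StableEnd (V : Type u) [AddCommGroup V] [Module Λ V] : Type u :=
  Module.End Λ V ⧸ projectiveEnds Λ V

/-- `p : P → V` is a projective cover: `P` is projective, `p` is surjective and its kernel is
superfluous. -/
def IsProjectiveCover {P V : Type u} [AddCommGroup P] [Module Λ P] [AddCommGroup V] [Module Λ V]
    (p : P →ₗ[Λ] V) : Prop :=
  Module.Projective Λ P ∧ Function.Surjective p ∧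
    ∀ N : Submodule Λ P, N ⊔ LinearMap.ker p = ⊤ → N = ⊤

/-- `W` is the first syzygy `ΩV`: the kernel of a projective cover of `V`. -/
def IsFirstSyzygy (V W : Type u) [AddCommGroup V] [Module Λ V] [AddCommGroup W]
    [Module Λ W] : Prop :=
  ∃ (P : ModuleCat.{u} Λ) (p : P →ₗ[Λ] V), IsProjectiveCover Λ p ∧
    Nonempty (W ≃ₗ[Λ] LinearMap.ker p)

/-- `Λ` is Gorenstein: it has finite injective dimension as a left and as a right module. -/
def IsGorensteinAlgebra : Prop :=
  (∃ n : ℕ, HasInjectiveDimensionLE (ModuleCat.of Λ Λ) n) ∧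
    ∃ n : ℕ, HasInjectiveDimensionLE (ModuleCat.of Λᵐᵒᵖ Λ) n

end Modules

/-! ### Bimodules and singular equivalences of Morita type

An `A`-`B`-bimodule over `k` is an `A`-module and `Bᵐᵒᵖ`-module `X` with commuting actions which
agree on `k`. -/

section Bimodules

variable (k : Type u) [Field k] (A Λ : Type u) [Ring A] [Algebra k A] [Ring Λ] [Algebra k Λ]
  (X : Type u) [AddCommGroup X] [Module k X] [Module A X] [Module Λᵐᵒᵖ X]
  [IsScalarTower k A X]
  (Y : Type u) [AddCommGroup Y] [Module k Y] [Module Λ Y]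

/-- The relations `(x a) ⊗ y = x ⊗ (a y)`, `a ∈ Λ`, in `X ⊗[k] Y`. -/
def balancedRel : Submodule A (X ⊗[k] Y) :=
  Submodule.span A {t | ∃ (x : X) (a : Λ) (y : Y),
    t = (MulOpposite.op a • x) ⊗ₜ[k] y - x ⊗ₜ[k] (a • y)}

/-- The tensor product `X ⊗_Λ Y` of an `A`-`Λ`-bimodule and a left `Λ`-module, as an `A`-module:
the quotient of `X ⊗[k] Y` by the relations `(x a) ⊗ y = x ⊗ (a y)`. -/
abbrev BalancedTensor : Type u := (X ⊗[k] Y) ⧸ balancedRel k A Λ X Y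

variable [IsScalarTower k Λ Y] (B : Type u) [Ring B] [Algebra k B] [Module Bᵐᵒᵖ Y]
  [IsScalarTower k Bᵐᵒᵖ Y] [SMulCommClass Λ Bᵐᵒᵖ Y]

/-- If `Y` is a `Λ`-`B`-bimodule, the right action `(x ⊗ y) b = x ⊗ (y b)` on `X ⊗_Λ Y`. -/
def BalancedTensor.rightMul (b : B) :
    BalancedTensor k A Λ X Y →ₗ[A] BalancedTensor k A Λ X Y :=
  Submodule.mapQ _ _ (TensorProduct.AlgebraTensorModule.lTensor A X
      (DistribSMul.toLinearMap k Y (MulOpposite.op b) : Y →ₗ[k] Y)) (by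
    rw [balancedRel, Submodule.span_le]
    rintro _ ⟨x, a, y, rfl⟩
    refine Submodule.subset_span ⟨x, a, MulOpposite.op b • y, ?_⟩
    simp [smul_comm a (MulOpposite.op b) y])

variable [Module Aᵐᵒᵖ Y] [IsScalarTower k Aᵐᵒᵖ Y] [SMulCommClass Λ Aᵐᵒᵖ Y]

/-- For an `A`-`Λ`-bimodule `X` and a `Λ`-`A`-bimodule `Y`: there is a finitely generated
`A`-`A`-bimodule `Q`, of finite projective dimension as a bimodule, such that
`X ⊗_Λ Y ≅ A ⊕ Q` as `A`-`A`-bimodules. -/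
def TensorIsRegularPlusFinitePd : Prop :=
  ∃ (Q : Type u) (_ : AddCommGroup Q) (_ : Module k Q) (_ : Module A Q) (_ : Module Aᵐᵒᵖ Q)
    (_ : IsScalarTower k A Q) (_ : IsScalarTower k Aᵐᵒᵖ Q) (_ : SMulCommClass A Aᵐᵒᵖ Q),
    letI : Module (A ⊗[k] Aᵐᵒᵖ) Q := TensorProduct.Algebra.module
    Module.Finite (A ⊗[k] Aᵐᵒᵖ) Q ∧
    (∃ n : ℕ, HasProjectiveDimensionLE (ModuleCat.of (A ⊗[k] Aᵐᵒᵖ) Q) n) ∧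
    ∃ e : BalancedTensor k A Λ X Y ≃ₗ[A] A × Q,
      ∀ (b : A) (t : BalancedTensor k A Λ X Y),
        e (BalancedTensor.rightMul k A Λ X Y A b t) = MulOpposite.op b • e t

end Bimodules

/-- The `Γ`-`Λ`-bimodule `X` and the `Λ`-`Γ`-bimodule `Y` induce a singular equivalence of Morita
type between `Λ` and `Γ`. -/
structure InduceSingularEquivalenceOfMoritaType (k : Type u) [Field k]
    (Λ Γ : Type u) [Ring Λ] [Algebra k Λ] [Ring Γ] [Algebra k Γ]
    (X : Type u) [AddCommGroup X] [Module k X] [Module Γ X] [Module Λᵐᵒᵖ X]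
    [IsScalarTower k Γ X] [IsScalarTower k Λᵐᵒᵖ X] [SMulCommClass Γ Λᵐᵒᵖ X]
    (Y : Type u) [AddCommGroup Y] [Module k Y] [Module Λ Y] [Module Γᵐᵒᵖ Y]
    [IsScalarTower k Λ Y] [IsScalarTower k Γᵐᵒᵖ Y] [SMulCommClass Λ Γᵐᵒᵖ Y] : Prop where
  finite_left_X : Module.Finite Γ X
  projective_left_X : Module.Projective Γ X
  finite_right_X : Module.Finite Λᵐᵒᵖ X
  projective_right_X : Module.Projective Λᵐᵒᵖ X
  finite_left_Y : Module.Finite Λ Y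
  projective_left_Y : Module.Projective Λ Y
  finite_right_Y : Module.Finite Γᵐᵒᵖ Y
  projective_right_Y : Module.Projective Γᵐᵒᵖ Y
  tensor_XY : TensorIsRegularPlusFinitePd k Γ Λ X Y
  tensor_YX : TensorIsRegularPlusFinitePd k Λ Γ Y X

end DeformationRings

open DeformationRings

/-!
# Versal deformation rings of Gorenstein-projective modules

*Existence.* Choose linear maps `c i : Λ → End_k V` spanning a complement of the inner derivations
in `Hom_k(Λ, End_k V)`. By successive approximation along the powers of the maximal ideal, every
lift of `V` over `S` is isomorphic to `S ⊗ V` with `a ∈ Λ` acting by `a + ∑ xᵢ cᵢ(a)` for suitable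
`xᵢ ∈ 𝔪` (`Lift.exists_slice`), and the `xᵢ` are unique modulo `𝔪 ^ 2` (`Lift.slice_unique`). The
quotient of `k[[X₁, …, Xᵣ]]` by the polynomial relations saying that `a ↦ a + ∑ Xᵢ cᵢ(a)` is a
representation is therefore versal (`Lift.exists_isVersal`). An endomorphism of a versal ring
preserving its lift is the identity on the cotangent space, hence bijective, so versal rings are
unique (`Lift.nonempty_iso_of_isVersal`). To compare the versal rings of two modules it thus
suffices to find one ring which is versal for both, and this is what a functorial construction on
lifts gives that is faithful and essentially surjective on deformations (`Lift.IsVersal.transfer`).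

*Projective summands.* A Gorenstein-projective `V` satisfies `Ext¹(V, P) = 0` for every finitely
generated projective `P`, because it has a projective presentation that continues to the right and
stays exact under `Hom(-, Λ)`. The vanishing is expressed by derivations
(`IsGorensteinProjective.derivationsInner`), and it allows homomorphisms to be extended to lifts,
again by successive approximation (`Lift.exists_hom_lift`). So a lift of `V × P` has the lift of `P`
as a direct summand, and `L ↦ L ⊕ K`, with `K` a lift of `P` (all are isomorphic), is a construction
as above.

*Universality.* If the stable endomorphism ring is `k`, an endomorphism of `V` is a scalar up to a
map through a projective, so it extends to every lift. Two morphisms `ψ₁`, `ψ₂` from a versal ring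
inducing the same deformation then agree: if they agree modulo `𝔪 ^ n`, the two maps on the versal
lift can be made to agree modulo `𝔪 ^ n` by an endomorphism of the target, and uniqueness over the
dual numbers makes `ψ₁` and `ψ₂` agree modulo `𝔪 ^ (n + 1)` (`Lift.IsVersal.isUniversal`). For the
syzygy the same argument applies: its `Ext¹` into projectives is an `Ext²` of `V`, and its
endomorphisms extend to the projective cover since `Ext¹(V, P) = 0`.

*Singular equivalences.* The construction is `L ↦ X ⊗_Λ L`. It is faithful since `L` is a natural
summand of `Y ⊗_Γ (X ⊗_Λ L) ≅ L ⊕ (P ⊗_Λ L)`. The module `P ⊗_Λ V` is projective: `V` is an `n`-th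
syzygy for every `n`, and `P` has finite projective dimension
(`BalancedTensor.projective_of_isGorensteinProjective`). Given a lift `N` of `X ⊗_Λ V`, a lift of
`V` inducing it therefore splits off from `Y ⊗_Γ N`. Finally `X ⊗_Λ V` is Gorenstein-projective,
since an acyclic complex of projective modules stays acyclic under `Hom(-, Γ)` if `Γ` has finite
injective dimension (`BalancedTensor.isGorensteinProjective`).
-/

set_option linter.unusedSectionVars false

namespace DeformationRings

/-! ### Objects and morphisms of the category of complete local algebras -/

namespace CHat

variable {k : Type u} [Field k]

/-- The maximal ideal of an object of `Ĉ`. -/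
abbrev 𝔪 (R : CHat k) : Ideal R := IsLocalRing.maximalIdeal R

/-- The augmentation `R → k`: the residue map followed by the inverse of `k ≅ R / 𝔪`. -/
noncomputable def aug (R : CHat k) : R →ₐ[k] k :=
  (AlgEquiv.ofBijective (Algebra.ofId k (IsLocalRing.ResidueField R))
    R.residue_bijective).symm.toAlgHom.comp (IsScalarTower.toAlgHom k R _)

lemma aug_algebraMap (R : CHat k) (c : k) : R.aug (algebraMap k R c) = c := by
  simp

lemma aug_eq_zero_iff (R : CHat k) {r : R} : R.aug r = 0 ↔ r ∈ R.𝔪 := by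
  rw [← IsLocalRing.residue_eq_zero_iff]
  simp [aug]

lemma sub_aug_mem (R : CHat k) (r : R) : r - algebraMap k R (R.aug r) ∈ R.𝔪 := by
  rw [← aug_eq_zero_iff]; simp

/-- Every `k`-algebra homomorphism between objects of `Ĉ` is local. -/
def ofAlgHom {R S : CHat k} (f : R →ₐ[k] S) : R ⟶ S where
  toAlgHom := f
  isLocalHom := by
    refine ⟨fun r hr => ?_⟩
    by_contra hnu
    have hr0 : r ∈ R.𝔪 := hnu
    have hne : S.aug (f r) ≠ 0 := fun h0 => ((S.aug_eq_zero_iff).1 h0) hr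
    have hu : IsUnit (r - algebraMap k R (S.aug (f r))) := by
      by_contra h
      have h1 : r - algebraMap k R (S.aug (f r)) ∈ R.𝔪 := h
      have h2 := R.aug_eq_zero_iff.2 h1
      rw [map_sub, R.aug_eq_zero_iff.2 hr0, aug_algebraMap] at h2
      exact hne (by simpa using h2)
    have h3 := hu.map f
    rw [map_sub, AlgHom.commutes] at h3
    exact (S.sub_aug_mem (f r)) h3

lemma map_mem {R S : CHat k} (ψ : R ⟶ S) {r : R} (hr : r ∈ R.𝔪) : ψ.toAlgHom r ∈ S.𝔪 :=
  fun hu => hr (ψ.isLocalHom.map_nonunit r hu)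

lemma map_mem_pow {R S : CHat k} (ψ : R ⟶ S) {n : ℕ} {r : R} (hr : r ∈ R.𝔪 ^ n) :
    ψ.toAlgHom r ∈ S.𝔪 ^ n := by
  have h1 : (R.𝔪).map ψ.toAlgHom.toRingHom ≤ S.𝔪 :=
    Ideal.map_le_iff_le_comap.2 fun x hx => map_mem ψ hx
  have h2 := Ideal.pow_right_mono h1 n
  rw [← Ideal.map_pow] at h2
  exact h2 (Ideal.mem_map_of_mem _ hr)

lemma aug_map {R S : CHat k} (ψ : R ⟶ S) (r : R) : S.aug (ψ.toAlgHom r) = R.aug r := by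
  have h := S.aug_eq_zero_iff.2 (map_mem ψ (R.sub_aug_mem r))
  rw [map_sub, AlgHom.commutes, map_sub, aug_algebraMap, sub_eq_zero] at h
  exact h

lemma hom_ext {R S : CHat k} {f g : R ⟶ S} (h : ∀ r, f.toAlgHom r = g.toAlgHom r) : f = g :=
  Hom.ext (AlgHom.ext h)

lemma eq_zero_of_mem_pow (R : CHat k) {r : R} (h : ∀ n, r ∈ R.𝔪 ^ n) : r = 0 :=
  IsHausdorff.haus (I := R.𝔪) inferInstance r fun n => by
    rw [SModEq.zero]; simpa using h n

/-- Morphisms are determined by their values on generators of the maximal ideal. -/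
lemma hom_ext_of_span {R S : CHat k} {ι : Type*} [Finite ι] (x : ι → R)
    (hx : R.𝔪 ≤ Ideal.span (Set.range x)) {f g : R ⟶ S}
    (h : ∀ i, f.toAlgHom (x i) = g.toAlgHom (x i)) (hm : ∀ i, x i ∈ R.𝔪) : f = g := by
  have := Fintype.ofFinite ι
  have key : ∀ n (r : R), f.toAlgHom r - g.toAlgHom r ∈ S.𝔪 ^ n := by
    intro n
    induction n with
    | zero => simp
    | succ n ih =>
      intro r
      obtain ⟨c, hc⟩ := (Ideal.mem_span_range_iff_exists_fun).1 (hx (R.sub_aug_mem r))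
      have hr : r = algebraMap k R (R.aug r) + ∑ i, c i * x i := by rw [hc]; ring
      rw [hr]
      simp only [map_add, AlgHom.commutes, map_sum, map_mul, h]
      rw [add_sub_add_left_eq_sub, ← Finset.sum_sub_distrib]
      refine Ideal.sum_mem _ fun i _ => ?_
      rw [← sub_mul, pow_succ]
      exact Ideal.mul_mem_mul (ih _) (map_mem g (hm i))
  exact hom_ext fun r => sub_eq_zero.1 (S.eq_zero_of_mem_pow fun n => key n _)

/-- A linear form which kills `𝔪 ^ (t + 1)` is linear over `S`, acting on `k` through the
augmentation, when restricted to `𝔪 ^ t`. -/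
lemma smul_functional (S : CHat k) {t : ℕ} {l : S →ₗ[k] k}
    (hl : ∀ a ∈ S.𝔪 ^ (t + 1), l a = 0) (s : S) {a : S} (ha : a ∈ S.𝔪 ^ t) :
    l (s * a) = S.aug s * l a := by
  have h1 : s * a = S.aug s • a + (s - algebraMap k S (S.aug s)) * a := by
    rw [Algebra.smul_def]; ring
  have h2 : l ((s - algebraMap k S (S.aug s)) * a) = 0 := hl _ (by
    rw [pow_succ']
    exact Ideal.mul_mem_mul (S.sub_aug_mem s) ha)
  rw [h1, map_add, map_smul, h2, add_zero, smul_eq_mul]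

/-- Coordinates on `𝔪 ^ t / 𝔪 ^ (t + 1)`: finitely many elements `a j` of `𝔪 ^ t` and linear forms
`l j` on `S`, zero on `𝔪 ^ (t + 1)`, which induce a basis and its dual basis. -/
lemma exists_graded_coordinates (S : CHat k) (t : ℕ) :
    ∃ (q : ℕ) (a : Fin q → S) (l : Fin q → S →ₗ[k] k), (∀ j, a j ∈ S.𝔪 ^ t) ∧
      (∀ j, ∀ b ∈ S.𝔪 ^ (t + 1), l j b = 0) ∧
      ∀ b ∈ S.𝔪 ^ t, b - ∑ j, l j b • a j ∈ S.𝔪 ^ (t + 1) := by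
  let I : Submodule k S := (S.𝔪 ^ (t + 1)).restrictScalars k
  let J : Submodule k S := (S.𝔪 ^ t).restrictScalars k
  let W : Submodule k (S ⧸ I) := J.map I.mkQ
  have hfin : Module.Finite k W := by
    obtain ⟨q, g, hg⟩ := Submodule.fg_iff_exists_fin_generating_family.1
      (IsNoetherian.noetherian (S.𝔪 ^ t))
    rw [Module.Finite.iff_fg]
    rw [Submodule.fg_def]
    refine ⟨Set.range fun i => I.mkQ (g i), Set.finite_range _, le_antisymm ?_ ?_⟩
    · rw [Submodule.span_le]
      rintro _ ⟨i, rfl⟩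
      exact ⟨g i, by
        change g i ∈ S.𝔪 ^ t
        rw [← hg]; exact Submodule.subset_span ⟨i, rfl⟩, rfl⟩
    · rintro _ ⟨b, hb, rfl⟩
      have hb' : b ∈ Ideal.span (Set.range g) := by
        rw [Ideal.span, hg]; exact hb
      obtain ⟨c, rfl⟩ := (Ideal.mem_span_range_iff_exists_fun).1 hb'
      have : I.mkQ (∑ i, c i * g i) = ∑ i, S.aug (c i) • I.mkQ (g i) := by
        rw [← sub_eq_zero]
        simp only [← map_smul, ← map_sum, ← map_sub]
        rw [Submodule.mkQ_apply, Submodule.Quotient.mk_eq_zero, ← Finset.sum_sub_distrib]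
        refine Ideal.sum_mem (S.𝔪 ^ (t + 1)) fun i _ => ?_
        rw [Algebra.smul_def, ← sub_mul, pow_succ']
        refine Ideal.mul_mem_mul (S.sub_aug_mem _) ?_
        rw [← hg]; exact Submodule.subset_span ⟨i, rfl⟩
      rw [this]
      exact Submodule.sum_mem _ fun i _ => Submodule.smul_mem _ _ (Submodule.subset_span ⟨i, rfl⟩)
  let bs := Module.finBasis k W
  obtain ⟨p, hp⟩ := W.subtype.exists_leftInverse_of_injective (by simp)
  have ha : ∀ j, ∃ a ∈ S.𝔪 ^ t, I.mkQ a = bs j := fun j => by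
    obtain ⟨a, ha, h⟩ := (bs j).2
    exact ⟨a, ha, h⟩
  choose a ha ha' using ha
  refine ⟨_, a, fun j => bs.coord j ∘ₗ p ∘ₗ I.mkQ, ha, ?_, ?_⟩
  · intro j b hb
    have : I.mkQ b = 0 := by simpa [I] using hb
    simp only [LinearMap.comp_apply, this, map_zero]
  · intro b hb
    have h1 : p (I.mkQ b) = ⟨I.mkQ b, ⟨b, hb, rfl⟩⟩ := by
      have := LinearMap.congr_fun hp ⟨I.mkQ b, ⟨b, hb, rfl⟩⟩
      simpa using this
    have h2 : I.mkQ (b - ∑ j, (bs.coord j ∘ₗ p ∘ₗ I.mkQ) b • a j) = 0 := by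
      rw [map_sub, map_sum, sub_eq_zero]
      simp only [map_smul, ha', LinearMap.comp_apply, h1, Module.Basis.coord_apply]
      have := congrArg (W.subtype) (bs.sum_repr ⟨I.mkQ b, ⟨b, hb, rfl⟩⟩)
      rw [map_sum] at this
      simp only [map_smul] at this
      exact this.symm
    rw [Submodule.mkQ_apply, Submodule.Quotient.mk_eq_zero] at h2
    exact h2

end CHat

/-! ### Complete modules and lifts -/

/-- Finitely generated modules over a complete ring are complete. -/
lemma exists_limit_of_isPrecomplete {A : Type*} [CommRing A] (I : Ideal A) [IsPrecomplete I A]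
    (C : Type*) [AddCommGroup C] [Module A C] [Module.Finite A C] (z : ℕ → C)
    (hz : ∀ t, z (t + 1) - z t ∈ I ^ t • (⊤ : Submodule A C)) :
    ∃ y, ∀ t, y - z t ∈ I ^ t • (⊤ : Submodule A C) := by
  obtain ⟨q, g, hg⟩ := Module.Finite.exists_fin (R := A) (M := C)
  have key : ∀ t, ∃ c : Fin q → A, (∀ i, c i ∈ I ^ t) ∧ ∑ i, c i • g i = z (t + 1) - z t := by
    intro t
    have h := hz t
    rw [← hg, Submodule.mem_ideal_smul_span_iff_exists_sum] at h
    obtain ⟨a, ha, h⟩ := h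
    exact ⟨a, ha, by rw [← h, Finsupp.sum_fintype]; simp⟩
  choose c hc hcz using key
  have hlim : ∀ i, ∃ y, ∀ t, y - ∑ j ∈ Finset.range t, c j i ∈ I ^ t := by
    intro i
    have hcauchy : ∀ {m n}, m ≤ n → (∑ j ∈ Finset.range m, c j i) ≡
        (∑ j ∈ Finset.range n, c j i) [SMOD (I ^ m • ⊤ : Submodule A A)] := by
      intro m n hmn
      rw [SModEq.sub_mem, smul_eq_mul, Ideal.mul_top, ← neg_mem_iff, neg_sub,
        ← Finset.sum_range_add_sum_Ico _ hmn, add_sub_cancel_left]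
      exact Ideal.sum_mem _ fun j hj => Ideal.pow_le_pow_right (Finset.mem_Ico.1 hj).1 (hc j i)
    obtain ⟨y, hy⟩ := IsPrecomplete.prec (I := I) (M := A) inferInstance hcauchy
    refine ⟨y, fun t => ?_⟩
    have := hy t
    rw [SModEq.sub_mem, smul_eq_mul, Ideal.mul_top, ← neg_mem_iff, neg_sub] at this
    exact this
  choose y hy using hlim
  refine ⟨z 0 + ∑ i, y i • g i, fun t => ?_⟩
  have hzt : ∀ t, z t = z 0 + ∑ i, (∑ j ∈ Finset.range t, c j i) • g i := by
    intro t
    induction t with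
    | zero => simp
    | succ t ih =>
      simp only [Finset.sum_range_succ, add_smul, Finset.sum_add_distrib, hcz]
      rw [← add_assoc, ← ih]; abel
  rw [hzt t, add_sub_add_left_eq_sub, ← Finset.sum_sub_distrib]
  refine Submodule.sum_mem _ fun i _ => ?_
  rw [← sub_smul]
  exact Submodule.smul_mem_smul (hy i t) trivial

lemma isPrecomplete_of_finite {A : Type*} [CommRing A] (I : Ideal A) [IsPrecomplete I A]
    (C : Type*) [AddCommGroup C] [Module A C] [Module.Finite A C] : IsPrecomplete I C where
  prec' f hf := by
    obtain ⟨y, hy⟩ := exists_limit_of_isPrecomplete I C f fun t =>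
      SModEq.sub_mem.1 (hf (Nat.le_succ t)).symm
    exact ⟨y, fun t => (SModEq.sub_mem.2 (hy t)).symm⟩

namespace CHat

variable {k : Type u} [Field k]

section Finite

variable (R : CHat k) (C : Type u) [AddCommGroup C] [Module R C] [Module.Finite R C]

lemma exists_limit (z : ℕ → C) (hz : ∀ t, z (t + 1) - z t ∈ R.𝔪 ^ t • (⊤ : Submodule R C)) :
    ∃ y, ∀ t, y - z t ∈ R.𝔪 ^ t • (⊤ : Submodule R C) :=
  exists_limit_of_isPrecomplete R.𝔪 C z hz

variable {C}

lemma eq_zero_of_mem_pow_smul {x : C}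
    (h : ∀ n, x ∈ R.𝔪 ^ n • (⊤ : Submodule R C)) : x = 0 :=
  IsHausdorff.haus (I := R.𝔪) inferInstance x fun n => SModEq.zero.2 (h n)

lemma pow_smul_antitone {m n : ℕ} (h : m ≤ n) :
    R.𝔪 ^ n • (⊤ : Submodule R C) ≤ R.𝔪 ^ m • ⊤ :=
  Submodule.smul_mono_left (Ideal.pow_le_pow_right h)

/-- Successive approximation: a solution modulo `𝔪` which can be improved step by step, the step
from `𝔪 ^ t` to `𝔪 ^ (t + 1)` being a correction in `𝔪 ^ t`, deforms to an exact solution. -/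
lemma exists_of_successive (Q : ℕ → C → Prop)
    (hQ : ∀ t, 1 ≤ t → ∀ z z', Q t z → z' - z ∈ R.𝔪 ^ t • (⊤ : Submodule R C) → Q t z')
    (z₀ : C) (h₀ : Q 1 z₀)
    (step : ∀ t, 1 ≤ t → ∀ z, Q t z → ∃ z', z' - z ∈ R.𝔪 ^ t • (⊤ : Submodule R C) ∧ Q (t + 1) z') :
    ∃ z, z - z₀ ∈ R.𝔪 • (⊤ : Submodule R C) ∧ ∀ t, 1 ≤ t → Q t z := by
  choose f hf hf' using step
  let y : (n : ℕ) → {z : C // Q (n + 1) z} := fun n =>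
    Nat.rec ⟨z₀, h₀⟩ (fun n z => ⟨f (n + 1) (by omega) z.1 z.2, hf' _ _ _ _⟩) n
  have hy : ∀ n, (y (n + 1)).1 - (y n).1 ∈ R.𝔪 ^ (n + 1) • (⊤ : Submodule R C) :=
    fun n => hf _ _ _ _
  obtain ⟨z, hz⟩ := R.exists_limit C (fun n => (y n).1) fun n =>
    R.pow_smul_antitone (Nat.le_succ n) (hy n)
  have hz' : ∀ n, z - (y n).1 ∈ R.𝔪 ^ (n + 1) • (⊤ : Submodule R C) := fun n => by
    have := add_mem (hz (n + 1)) (hy n)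
    rwa [sub_add_sub_cancel] at this
  refine ⟨z, by
    have : z - z₀ ∈ R.𝔪 ^ (0 + 1) • (⊤ : Submodule R C) := hz' 0
    rwa [zero_add, pow_one] at this, fun t ht => ?_⟩
  obtain ⟨n, rfl⟩ := Nat.exists_eq_succ_of_ne_zero (by omega : t ≠ 0)
  exact hQ _ ht _ _ (y n).2 (hz' n)

end Finite

end CHat

namespace Lift

variable {k : Type u} [Field k] {Λ : Type u} [Ring Λ] [Algebra k Λ]
  {V : Type u} [AddCommGroup V] [Module Λ V] {R S : CHat k}

instance : CoeSort (Lift k Λ V R) (Type u) := ⟨Lift.carrier⟩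

/-- The action of `k` on a lift, through either of `R` and `Λ`. -/
noncomputable instance (L : Lift k Λ V R) : Module k L := Module.compHom _ (algebraMap k R)

instance (L : Lift k Λ V R) : IsScalarTower k R L :=
  ⟨fun c r x => by
    rw [Algebra.smul_def, mul_smul]; rfl⟩

lemma algebraMap_smul (L : Lift k Λ V R) (c : k) (x : L) : algebraMap k R c • x = c • x := rfl

lemma algebraMap_smul' (L : Lift k Λ V R) (c : k) (x : L) : algebraMap k Λ c • x = c • x :=
  (L.smul_compat c x).symm

instance (L : Lift k Λ V R) : IsScalarTower k Λ L :=
  ⟨fun c a x => by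
    rw [Algebra.smul_def, mul_smul, algebraMap_smul']⟩

/-- The reduction `L → L ⊗[R] k ≅ V` of a lift. -/
noncomputable def π (L : Lift k Λ V R) : L →ₗ[Λ] V where
  toFun x := L.φ (x ⊗ₜ 1)
  map_add' x y := by rw [TensorProduct.add_tmul, map_add]
  map_smul' a x := by
    rw [RingHom.id_apply, ← map_smul]; rfl

lemma π_apply (L : Lift k Λ V R) (x : L) : L.π x = L.φ (x ⊗ₜ 1) := rfl

lemma exists_tmul (L : Lift k Λ V R) (t : L ⊗[R] IsLocalRing.ResidueField R) :
    ∃ x : L, t = x ⊗ₜ 1 := by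
  induction t with
  | zero => exact ⟨0, by simp⟩
  | add x y hx hy =>
    obtain ⟨x, rfl⟩ := hx
    obtain ⟨y, rfl⟩ := hy
    exact ⟨x + y, by rw [TensorProduct.add_tmul]⟩
  | tmul x c =>
    obtain ⟨r, rfl⟩ := IsLocalRing.residue_surjective c
    refine ⟨r • x, ?_⟩
    rw [TensorProduct.smul_tmul, Algebra.smul_def, mul_one]; rfl

lemma π_surjective (L : Lift k Λ V R) : Function.Surjective L.π := fun v => by
  obtain ⟨x, hx⟩ := L.exists_tmul (L.φ.symm v)
  exact ⟨x, by rw [π_apply, ← hx, LinearEquiv.apply_symm_apply]⟩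

lemma π_eq_zero_iff (L : Lift k Λ V R) {x : L} :
    L.π x = 0 ↔ x ∈ R.𝔪 • (⊤ : Submodule R L) := by
  rw [π_apply, LinearEquiv.map_eq_zero_iff]
  have h := TensorProduct.tensorQuotEquivQuotSMul_tmul_mk (M := L) R.𝔪 x 1
  rw [← Submodule.Quotient.mk_eq_zero, ← one_smul R x, ← h, LinearEquiv.map_eq_zero_iff,
    one_smul]
  rfl

/-- A homomorphism of lifts `L → L'` along `ψ : R ⟶ S` exists: a map which is semilinear along `ψ`,
linear over `Λ`, and compatible with the reductions to `V`. -/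
def MapsTo (ψ : R ⟶ S) (L : Lift k Λ V R) (L' : Lift k Λ V S) : Prop :=
  ∃ u : L →+ L', (∀ (r : R) (x : L), u (r • x) = ψ.toAlgHom r • u x) ∧
    (∀ (a : Λ) (x : L), u (a • x) = a • u x) ∧ ∀ x, L'.π (u x) = L.π x

lemma MapsTo.comp {T : CHat k} {ψ : R ⟶ S} {χ : S ⟶ T} {L : Lift k Λ V R} {L' : Lift k Λ V S}
    {L'' : Lift k Λ V T} (h : MapsTo ψ L L') (h' : MapsTo χ L' L'') : MapsTo (ψ ≫ χ) L L'' := by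
  obtain ⟨u, h1, h2, h3⟩ := h
  obtain ⟨v, h1', h2', h3'⟩ := h'
  exact ⟨v.comp u, fun r x => by simp only [AddMonoidHom.comp_apply, h1, h1']; rfl,
    fun a x => by simp only [AddMonoidHom.comp_apply, h2, h2'],
    fun x => by simp only [AddMonoidHom.comp_apply, h3, h3']⟩

variable [Module k V] [IsScalarTower k Λ V]

lemma π_smul (L : Lift k Λ V R) (r : R) (x : L) : L.π (r • x) = R.aug r • L.π x := by
  have h : L.π ((r - algebraMap k R (R.aug r)) • x) = 0 :=
    L.π_eq_zero_iff.2 (Submodule.smul_mem_smul (R.sub_aug_mem r) trivial)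
  rw [sub_smul, map_sub, sub_eq_zero, algebraMap_smul, ← algebraMap_smul', L.π.map_smul,
    _root_.algebraMap_smul] at h
  exact h

lemma π_smul' (L : Lift k Λ V R) (c : k) (x : L) : L.π (c • x) = c • L.π x := by
  rw [← algebraMap_smul, π_smul, CHat.aug_algebraMap]

/-- The lift given by a free module with a surjection onto `V` whose kernel is `𝔪 M`. -/
noncomputable def ofπ (M : Type u) [AddCommGroup M] [Module R M] [Module Λ M] [SMulCommClass R Λ M]
    (hc : ∀ (c : k) (m : M), algebraMap k R c • m = algebraMap k Λ c • m)
    [Module.Free R M] [Module.Finite R M] (p : M →ₗ[Λ] V) (hp : Function.Surjective p)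
    (hker : ∀ x, p x = 0 ↔ x ∈ R.𝔪 • (⊤ : Submodule R M)) : Lift k Λ V R where
  carrier := M
  smul_compat := hc
  φ := by
    let N : Submodule R M := R.𝔪 • ⊤
    let e₁ : M ⊗[R] IsLocalRing.ResidueField R ≃ₗ[R] M ⧸ N :=
      TensorProduct.tensorQuotEquivQuotSMul M R.𝔪
    let q : (M ⧸ N) →+ V := QuotientAddGroup.lift N.toAddSubgroup p.toAddMonoidHom
      fun x hx => (hker x).2 hx
    have hq : Function.Bijective q := by
      constructor
      · rw [injective_iff_map_eq_zero]
        intro y hy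
        obtain ⟨x, rfl⟩ := Submodule.Quotient.mk_surjective _ y
        exact (Submodule.Quotient.mk_eq_zero _).2 ((hker x).1 hy)
      · intro v
        obtain ⟨x, rfl⟩ := hp v
        exact ⟨Submodule.Quotient.mk x, rfl⟩
    let e : M ⊗[R] IsLocalRing.ResidueField R ≃+ V :=
      e₁.toAddEquiv.trans (AddEquiv.ofBijective q hq)
    have he : ∀ (x : M) (r : R), e (x ⊗ₜ IsLocalRing.residue R r) = p (r • x) := fun x r =>
      congrArg q (TensorProduct.tensorQuotEquivQuotSMul_tmul_mk R.𝔪 x r)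
    exact
      { e with
        map_smul' := fun a t => by
          change e (a • t) = a • e t
          induction t with
          | zero => simp
          | add x y hx hy => simp only [smul_add, map_add, hx, hy]
          | tmul x c =>
            obtain ⟨r, rfl⟩ := IsLocalRing.residue_surjective c
            have h1 : a • (x ⊗ₜ[R] IsLocalRing.residue R r) =
              (a • x) ⊗ₜ[R] IsLocalRing.residue R r := rfl
            rw [h1, he, he, smul_comm r a x, map_smul] }

lemma ofπ_π (M : Type u) [AddCommGroup M] [Module R M] [Module Λ M] [SMulCommClass R Λ M]
    (hc : ∀ (c : k) (m : M), algebraMap k R c • m = algebraMap k Λ c • m)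
    [Module.Free R M] [Module.Finite R M] (p : M →ₗ[Λ] V) (hp : Function.Surjective p)
    (hker : ∀ x, p x = 0 ↔ x ∈ R.𝔪 • (⊤ : Submodule R M)) (x : M) :
    (ofπ M hc p hp hker).π x = p x := by
  have h := TensorProduct.tensorQuotEquivQuotSMul_tmul_mk R.𝔪 x 1
  rw [one_smul] at h
  exact congrArg (QuotientAddGroup.lift _ p.toAddMonoidHom
      fun x hx => (hker x).2 hx) h

lemma exists_section (L : Lift k Λ V R) : ∃ σ : V →ₗ[k] L, ∀ v, L.π (σ v) = v := by
  obtain ⟨σ, hσ⟩ := LinearMap.exists_rightInverse_of_surjective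
    ({ L.π with map_smul' := L.π_smul' } : L →ₗ[k] V) (LinearMap.range_eq_top.2 L.π_surjective)
  exact ⟨σ, fun v => LinearMap.congr_fun hσ v⟩

lemma sub_section_mem (L : Lift k Λ V R) {σ : V →ₗ[k] L} (hσ : ∀ v, L.π (σ v) = v) (x : L) :
    x - σ (L.π x) ∈ R.𝔪 • (⊤ : Submodule R L) := by
  rw [← L.π_eq_zero_iff, map_sub, hσ, sub_self]

end Lift

/-! ### Base change of lifts -/

namespace Lift

variable {k : Type u} [Field k] {Λ : Type u} [Ring Λ] [Algebra k Λ]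
  {V : Type u} [AddCommGroup V] [Module Λ V] {R S : CHat k}

/-- A map from a finitely generated module to a finitely generated projective module over a local
ring is bijective as soon as it is so modulo the maximal ideal. -/
lemma bijective_of_mod_maximalIdeal {A M N : Type*} [CommRing A] [IsLocalRing A] [AddCommGroup M]
    [AddCommGroup N] [Module A M] [Module A N] [Module.Finite A M] [Module.Finite A N]
    [Module.Projective A N] (u : M →ₗ[A] N)
    (hs : ∀ y, ∃ x, y - u x ∈ IsLocalRing.maximalIdeal A • (⊤ : Submodule A N))
    (hi : ∀ x, u x = 0 → x ∈ IsLocalRing.maximalIdeal A • (⊤ : Submodule A M)) :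
    Function.Bijective u := by
  have hsurj : Function.Surjective u := by
    rw [← LinearMap.range_eq_top, ← top_le_iff]
    refine Submodule.le_of_le_smul_of_le_jacobson_bot (I := IsLocalRing.maximalIdeal A)
      Module.Finite.fg_top (IsLocalRing.maximalIdeal_le_jacobson _) fun y _ => ?_
    obtain ⟨x, hx⟩ := hs y
    rw [← add_sub_cancel (u x) y]
    exact Submodule.add_mem_sup ⟨x, rfl⟩ hx
  refine ⟨?_, hsurj⟩
  obtain ⟨s, hs⟩ := Module.projective_lifting_property u LinearMap.id hsurj
  have hs' : ∀ y, u (s y) = y := fun y => LinearMap.congr_fun hs y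
  let p : M →ₗ[A] M := LinearMap.id - s ∘ₗ u
  have hrange : LinearMap.ker u = LinearMap.range p := by
    ext x
    constructor
    · intro hx
      rw [LinearMap.mem_ker] at hx
      exact ⟨x, by simp [p, hx]⟩
    · rintro ⟨y, rfl⟩
      simp [p, hs']
  have hfg : (LinearMap.ker u).FG := by
    rw [hrange]; exact Module.Finite.fg_top.map p |> fun h => by rwa [Submodule.map_top] at h
  rw [← LinearMap.ker_eq_bot, ← le_bot_iff]
  refine Submodule.le_of_le_smul_of_le_jacobson_bot (I := IsLocalRing.maximalIdeal A) hfg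
    (IsLocalRing.maximalIdeal_le_jacobson _) fun x hx => ?_
  have h2 : p x ∈ (IsLocalRing.maximalIdeal A • (⊤ : Submodule A M)).map p :=
    ⟨x, hi x (LinearMap.mem_ker.1 hx), rfl⟩
  have h3 : p x = x := by simp [p, LinearMap.mem_ker.1 hx]
  rw [h3, Submodule.map_smul'', Submodule.map_top, ← hrange] at h2
  exact Submodule.mem_sup_right h2

/-- A linear map between lifts over the same ring is bijective if its reduction is. -/
lemma bijective_of_π {W : Type u} [AddCommGroup W] [Module Λ W] (L : Lift k Λ V R)
    (L' : Lift k Λ W R) (u : L →ₗ[R] L') (f : V → W) (hf : Function.Bijective f) (hf0 : f 0 = 0)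
    (hu : ∀ x, L'.π (u x) = f (L.π x)) : Function.Bijective u := by
  refine bijective_of_mod_maximalIdeal u (fun y => ?_) fun x hx => ?_
  · obtain ⟨v, hv⟩ := hf.2 (L'.π y)
    obtain ⟨x, rfl⟩ := L.π_surjective v
    exact ⟨x, by rw [← π_eq_zero_iff, map_sub, hu, hv, sub_self]⟩
  · have := hu x
    rw [hx, map_zero] at this
    exact (π_eq_zero_iff L).1 (hf.1 (by rw [← this, hf0]))

lemma equivalent_iff_mapsTo (L L' : Lift k Λ V R) : L.Equivalent L' ↔ MapsTo (𝟙 R) L L' := by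
  constructor
  · rintro ⟨f, hf, hφ⟩
    refine ⟨f.toAddEquiv.toAddMonoidHom, fun r x => map_smul f r x, hf, fun x => ?_⟩
    exact hφ (x ⊗ₜ 1)
  · rintro ⟨u, h1, h2, h3⟩
    let ul : L →ₗ[R] L' := { u with map_smul' := h1 }
    refine ⟨LinearEquiv.ofBijective ul (bijective_of_π L L' ul id Function.bijective_id rfl h3),
      h2, fun t => ?_⟩
    obtain ⟨x, rfl⟩ := L.exists_tmul t
    exact h3 x

/-- The universal property of `S ⊗[R] M` for maps that are semilinear along `R → S`. -/
lemma exists_baseChange_lift {R S M N : Type*} [CommRing R] [CommRing S] [Algebra R S]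
    [AddCommGroup M] [Module R M] [AddCommGroup N] [Module S N] (u : M →+ N)
    (hu : ∀ (r : R) (x : M), u (r • x) = algebraMap R S r • u x) :
    ∃ g : S ⊗[R] M →ₗ[S] N, ∀ x, g (1 ⊗ₜ x) = u x := by
  let f : S →+ M →+ N :=
    AddMonoidHom.mk' (fun s => (DistribSMul.toAddMonoidHom N s).comp u)
      fun s t => by ext x; exact add_smul s t (u x)
  let g : S ⊗[R] M →+ N := TensorProduct.liftAddHom f fun r s x => by
    change (r • s) • u x = s • u (r • x)
    rw [hu, smul_smul, Algebra.smul_def, mul_comm]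
  refine ⟨{ g with map_smul' := fun r x => ?_ }, fun x => one_smul S (u x)⟩
  change g (r • x) = r • g x
  induction x with
  | zero => rw [smul_zero, map_zero, smul_zero]
  | add x y hx hy => rw [smul_add, map_add, map_add, hx, hy, smul_add]
  | tmul s x => exact mul_smul r s (u x)

lemma span_range_tmul (R S M : Type*) [CommRing R] [CommRing S] [Algebra R S]
    [AddCommGroup M] [Module R M] :
    Submodule.span S (Set.range (TensorProduct.mk R S M 1)) = ⊤ := by
  rw [eq_top_iff]
  rintro x -
  induction x with
  | zero => exact zero_mem _
  | add x y hx hy => exact add_mem hx hy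
  | tmul s x =>
    have : s ⊗ₜ[R] x = s • ((1 : S) ⊗ₜ[R] x) := by
      rw [TensorProduct.smul_tmul', smul_eq_mul, mul_one]
    rw [this]
    exact Submodule.smul_mem _ _ (Submodule.subset_span ⟨x, rfl⟩)

/-- The canonical map from a lift to its base change, and its universal property. -/
lemma exists_toMap (ψ : R ⟶ S) (L : Lift k Λ V R) :
    ∃ w : L →+ L.map ψ, (∀ (r : R) (x : L), w (r • x) = ψ.toAlgHom r • w x) ∧
      (∀ (a : Λ) (x : L), w (a • x) = a • w x) ∧ (∀ x, (L.map ψ).π (w x) = L.π x) ∧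
      Submodule.span S (Set.range w) = ⊤ ∧
      ∀ (N : Type u) [AddCommGroup N] [Module S N] (u : L →+ N),
        (∀ (r : R) (x : L), u (r • x) = ψ.toAlgHom r • u x) →
        ∃ g : L.map ψ →ₗ[S] N, ∀ x, g (w x) = u x := by
  let := CHat.Hom.algebra ψ
  let := baseChangeModule Λ R S L.carrier
  let w : L.carrier →+ S ⊗[R] L.carrier := (TensorProduct.mk R S L.carrier 1).toAddMonoidHom
  refine ⟨w, fun r x => ?_, fun a x => ?_, fun x => ?_, ?_, ?_⟩
  · change (1 : S) ⊗ₜ[R] (r • x) = ψ.toAlgHom r • ((1 : S) ⊗ₜ[R] x)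
    rw [← TensorProduct.smul_tmul, TensorProduct.smul_tmul', Algebra.smul_def, smul_eq_mul]; rfl
  · rfl
  · change L.φ (L.reductionEquiv ψ (((1 : S) ⊗ₜ[R] x) ⊗ₜ[S] 1)) = L.φ (x ⊗ₜ[R] 1)
    congr 1
    have : (CHat.residueEquiv ψ).symm 1 = 1 := by
      have : IsLocalHom (algebraMap R S) := ψ.isLocalHom
      rw [LinearEquiv.symm_apply_eq]
      exact (map_one (algebraMap (IsLocalRing.ResidueField R) (IsLocalRing.ResidueField S))).symm
    simp [reductionEquiv, this]
  · exact span_range_tmul R S L.carrier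
  · intro N _ _ u hu
    exact exists_baseChange_lift u hu

lemma mapsTo_map (ψ : R ⟶ S) (L : Lift k Λ V R) : MapsTo ψ L (L.map ψ) := by
  obtain ⟨w, w1, w2, w3, -⟩ := exists_toMap ψ L
  exact ⟨w, w1, w2, w3⟩

lemma MapsTo.equivalent_map {ψ : R ⟶ S} {L : Lift k Λ V R} {L' : Lift k Λ V S}
    (h : MapsTo ψ L L') : (L.map ψ).Equivalent L' := by
  obtain ⟨u, h1, h2, h3⟩ := h
  obtain ⟨w, w1, w2, w3, w4, w5⟩ := exists_toMap ψ L
  obtain ⟨g, hg⟩ := w5 _ u h1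
  rw [equivalent_iff_mapsTo]
  have hw : ∀ x : L.map ψ, x ∈ Submodule.span S (Set.range w) := fun x => w4 ▸ trivial
  refine ⟨g.toAddMonoidHom, fun r x => map_smul g r x, fun a x => ?_, fun x => ?_⟩
  · change g (a • x) = a • g x
    induction hw x using Submodule.span_induction with
    | mem x hx =>
      obtain ⟨x, rfl⟩ := hx
      rw [← w2, hg, hg, h2]
    | zero => simp
    | add x y _ _ hx hy => simp only [smul_add, map_add, hx, hy]
    | smul r x _ hx => rw [← smul_comm r a x, g.map_smul, hx, g.map_smul, smul_comm]
  · change L'.π (g x) = (L.map ψ).π x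
    -- both sides are semilinear along the augmentation of `S`: it suffices to compare them on `L`
    induction hw x using Submodule.span_induction with
    | mem x hx =>
      obtain ⟨x, rfl⟩ := hx
      rw [w3, hg, h3]
    | zero => simp
    | add x y _ _ hx hy => simp only [map_add, hx, hy]
    | smul r x _ hx =>
      have key : ∀ (M : Lift k Λ V S) (y : M), M.π (r • y) = algebraMap k Λ (S.aug r) • M.π y := by
        intro M y
        have h : M.π ((r - algebraMap k S (S.aug r)) • y) = 0 :=
          M.π_eq_zero_iff.2 (Submodule.smul_mem_smul (S.sub_aug_mem r) trivial)
        rw [sub_smul, map_sub, sub_eq_zero, algebraMap_smul, ← algebraMap_smul',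
          M.π.map_smul] at h
        exact h
      rw [map_smul, key, key, hx]

/-- The relation `MapsTo` says that pushing `L` forward along `ψ` gives the deformation class of
`L'`. -/
lemma map_equivalent_iff (ψ : R ⟶ S) (L : Lift k Λ V R) (L' : Lift k Λ V S) :
    (L.map ψ).Equivalent L' ↔ MapsTo ψ L L' := by
  refine ⟨fun h => ?_, MapsTo.equivalent_map⟩
  have := (mapsTo_map ψ L).comp ((equivalent_iff_mapsTo _ _).1 h)
  rwa [Category.comp_id] at this

end Lift

/-! ### Versality, and the coefficients of a lift -/

namespace Lift

variable {k : Type u} [Field k] {Λ : Type u} [Ring Λ] [Algebra k Λ]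
  {V : Type u} [AddCommGroup V] [Module Λ V] {R S : CHat k}

lemma MapsTo.of_linearMap {L L' : Lift k Λ V R} (u : L →ₗ[R] L')
    (h : ∀ (a : Λ) x, u (a • x) = a • u x) (hπ : ∀ x, L'.π (u x) = L.π x) : MapsTo (𝟙 R) L L' :=
  ⟨u.toAddMonoidHom, fun r x => u.map_smul r x, h, hπ⟩

lemma MapsTo.exists_linearEquiv {L L' : Lift k Λ V R} (h : MapsTo (𝟙 R) L L') :
    ∃ e : L ≃ₗ[R] L', (∀ (a : Λ) x, e (a • x) = a • e x) ∧ ∀ x, L'.π (e x) = L.π x := by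
  obtain ⟨u, h1, h2, h3⟩ := h
  let ul : L →ₗ[R] L' := { u with map_smul' := h1 }
  exact ⟨LinearEquiv.ofBijective ul (bijective_of_π L L' ul id Function.bijective_id rfl h3),
    h2, h3⟩

lemma MapsTo.symm {L L' : Lift k Λ V R} (h : MapsTo (𝟙 R) L L') : MapsTo (𝟙 R) L' L := by
  obtain ⟨e, h2, h3⟩ := h.exists_linearEquiv
  refine MapsTo.of_linearMap e.symm.toLinearMap (fun a x => ?_) fun x => ?_
  · change e.symm (a • x) = a • e.symm x
    rw [LinearEquiv.symm_apply_eq, h2, LinearEquiv.apply_symm_apply]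
  · change L.π (e.symm x) = _
    rw [← h3, LinearEquiv.apply_symm_apply]

lemma MapsTo.trans_right {ψ : R ⟶ S} {L : Lift k Λ V R} {L' L'' : Lift k Λ V S}
    (h : MapsTo ψ L L') (h' : MapsTo (𝟙 S) L' L'') : MapsTo ψ L L'' := by
  have := h.comp h'
  rwa [Category.comp_id] at this

/-- Versality in terms of `MapsTo`, which avoids base changes altogether. -/
lemma isVersal_iff (U : Lift k Λ V R) : U.IsVersal ↔
    (∀ (S : CHat k) (L : Lift k Λ V S), ∃ ψ : R ⟶ S, MapsTo ψ U L) ∧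
    ∀ (L : Lift k Λ V (CHat.dual k)) (ψ χ : R ⟶ CHat.dual k),
      MapsTo ψ U L → MapsTo χ U L → ψ = χ := by
  simp only [IsVersal, map_equivalent_iff]
  refine and_congr_right fun h => ⟨fun h' L ψ χ h1 h2 => (h' L).unique h1 h2, fun h' L => ?_⟩
  obtain ⟨ψ, hψ⟩ := h _ L
  exact ⟨ψ, hψ, fun χ hχ => h' L _ _ hχ hψ⟩

lemma isUniversal_iff (U : Lift k Λ V R) : U.IsUniversal ↔
    (∀ (S : CHat k) (L : Lift k Λ V S), ∃ ψ : R ⟶ S, MapsTo ψ U L) ∧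
    ∀ (S : CHat k) (L : Lift k Λ V S) (ψ χ : R ⟶ S),
      MapsTo ψ U L → MapsTo χ U L → ψ = χ := by
  simp only [IsUniversal, map_equivalent_iff]
  refine ⟨fun h => ⟨fun S L => (h S L).exists, fun S L ψ χ h1 h2 => (h S L).unique h1 h2⟩,
    fun ⟨h, h'⟩ S L => ?_⟩
  obtain ⟨ψ, hψ⟩ := h _ L
  exact ⟨ψ, hψ, fun χ hχ => h' S L _ _ hχ hψ⟩

lemma alg_smul_mem (L : Lift k Λ V R) (a : Λ) {t : ℕ} {x : L}
    (hx : x ∈ R.𝔪 ^ t • (⊤ : Submodule R L)) : a • x ∈ R.𝔪 ^ t • (⊤ : Submodule R L) := by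
  induction hx using Submodule.smul_induction_on' with
  | smul r hr y _ => rw [← smul_comm]; exact Submodule.smul_mem_smul hr trivial
  | add x _ y _ hx hy => rw [smul_add]; exact add_mem hx hy

lemma smul_mem_pow_succ {C : Type*} [AddCommGroup C] [Module R C] {t : ℕ} {r : R} {x : C}
    (hr : r ∈ R.𝔪 ^ t) (hx : x ∈ R.𝔪 • (⊤ : Submodule R C)) :
    r • x ∈ R.𝔪 ^ (t + 1) • (⊤ : Submodule R C) := by
  rw [pow_succ, Submodule.mul_smul]
  exact Submodule.smul_mem_smul hr hx

lemma smul_mem_pow_succ' {C : Type*} [AddCommGroup C] [Module R C] {t : ℕ} {r : R} {x : C}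
    (hr : r ∈ R.𝔪) (hx : x ∈ R.𝔪 ^ t • (⊤ : Submodule R C)) :
    r • x ∈ R.𝔪 ^ (t + 1) • (⊤ : Submodule R C) := by
  rw [pow_succ', Submodule.mul_smul]
  exact Submodule.smul_mem_smul hr hx

variable [Module k V] [IsScalarTower k Λ V]

/-- For a linear form `l` on `R`, the map `l ⊗ π` on `R ⊗ V`, transported to a lift `L` by a basis.
When `l` kills `𝔪 ^ (t + 1)` it is on `𝔪 ^ t L` independent of the basis. -/
noncomputable def coeff (L : Lift k Λ V R) (l : R →ₗ[k] k) : L →ₗ[k] V :=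
  ∑ i, (LinearMap.toSpanSingleton k V (L.π (Module.Free.chooseBasis R L i))) ∘ₗ l ∘ₗ
    ((Module.Free.chooseBasis R L).coord i).restrictScalars k

lemma coeff_apply (L : Lift k Λ V R) (l : R →ₗ[k] k) (x : L) :
    L.coeff l x = ∑ i, l ((Module.Free.chooseBasis R L).repr x i) •
      L.π (Module.Free.chooseBasis R L i) := by
  simp [coeff]

section

variable (L : Lift k Λ V R) {t : ℕ} {l : R →ₗ[k] k}

lemma coeff_smul (hl : ∀ b ∈ R.𝔪 ^ (t + 1), l b = 0) {a : R} (ha : a ∈ R.𝔪 ^ t) (x : L) :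
    L.coeff l (a • x) = l a • L.π x := by
  rw [coeff_apply]
  conv_rhs => rw [← (Module.Free.chooseBasis R L).sum_repr x, map_sum, Finset.smul_sum]
  refine Finset.sum_congr rfl fun i _ => ?_
  rw [π_smul, map_smul, Finsupp.smul_apply, smul_eq_mul, mul_comm, R.smul_functional hl _ ha,
    smul_smul, mul_comm]

lemma coeff_eq_zero (hl : ∀ b ∈ R.𝔪 ^ (t + 1), l b = 0) {x : L}
    (hx : x ∈ R.𝔪 ^ (t + 1) • (⊤ : Submodule R L)) : L.coeff l x = 0 := by
  induction hx using Submodule.smul_induction_on' with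
  | smul r hr y _ =>
    rw [L.coeff_smul hl (Ideal.pow_le_pow_right (Nat.le_succ t) hr), hl _ hr, zero_smul]
  | add x _ y _ hx hy => rw [map_add, hx, hy, add_zero]

lemma coeff_alg_smul (hl : ∀ b ∈ R.𝔪 ^ (t + 1), l b = 0) (a : Λ) {x : L}
    (hx : x ∈ R.𝔪 ^ t • (⊤ : Submodule R L)) :
    L.coeff l (a • x) = a • L.coeff l x := by
  induction hx using Submodule.smul_induction_on' with
  | smul r hr y _ =>
    rw [← smul_comm, L.coeff_smul hl hr, L.coeff_smul hl hr, map_smul,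
      ← _root_.algebraMap_smul Λ (l r), ← _root_.algebraMap_smul Λ (l r), smul_smul, smul_smul,
      Algebra.commutes]
  | add x _ y _ hx hy => rw [smul_add, map_add, map_add, hx, hy, smul_add]

lemma coeff_ring_smul (hl : ∀ b ∈ R.𝔪 ^ (t + 1), l b = 0) (r : R) {x : L}
    (hx : x ∈ R.𝔪 ^ t • (⊤ : Submodule R L)) :
    L.coeff l (r • x) = R.aug r • L.coeff l x := by
  have h : L.coeff l ((r - algebraMap k R (R.aug r)) • x) = 0 :=
    L.coeff_eq_zero hl (smul_mem_pow_succ' (R.sub_aug_mem r) hx)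
  rw [sub_smul, map_sub, sub_eq_zero, algebraMap_smul, (L.coeff l).map_smul] at h
  exact h

end

/-- An element of `𝔪 ^ t L` is determined modulo `𝔪 ^ (t + 1) L` by its coefficients in `V` with
respect to coordinates `a j`, `l j` on `𝔪 ^ t / 𝔪 ^ (t + 1)`. -/
lemma sub_sum_coeff_mem (L : Lift k Λ V R) {σ : V →ₗ[k] L} (hσ : ∀ v, L.π (σ v) = v) {t q : ℕ}
    {a : Fin q → R} {l : Fin q → R →ₗ[k] k} (hl : ∀ j, ∀ b ∈ R.𝔪 ^ (t + 1), l j b = 0)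
    (ha : ∀ j, a j ∈ R.𝔪 ^ t)
    (hal : ∀ b ∈ R.𝔪 ^ t, b - ∑ j, l j b • a j ∈ R.𝔪 ^ (t + 1)) {x : L}
    (hx : x ∈ R.𝔪 ^ t • (⊤ : Submodule R L)) :
    x - ∑ j, a j • σ (L.coeff (l j) x) ∈ R.𝔪 ^ (t + 1) • (⊤ : Submodule R L) := by
  induction hx using Submodule.smul_induction_on' with
  | smul r hr y _ =>
    have h1 : r • y - ∑ j, a j • σ (L.coeff (l j) (r • y)) =
        (r - ∑ j, l j r • a j) • y + ∑ j, (l j r • a j) • (y - σ (L.π y)) := by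
      simp only [L.coeff_smul (hl _) hr, map_smul, sub_smul, smul_sub, Finset.sum_smul,
        Finset.sum_sub_distrib]
      have : ∀ j, a j • l j r • σ (L.π y) = (l j r • a j) • σ (L.π y) := fun j => by
        rw [smul_assoc, ← algebraMap_smul, ← algebraMap_smul, smul_comm]
      simp only [this]
      abel
    rw [h1]
    refine add_mem (Submodule.smul_mem_smul (hal r hr) trivial) (Submodule.sum_mem _ fun j _ => ?_)
    refine smul_mem_pow_succ ?_ (L.sub_section_mem hσ y)
    rw [Algebra.smul_def]
    exact Ideal.mul_mem_left _ _ (ha j)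
  | add x _ y _ hx hy =>
    have := add_mem hx hy
    simp only [map_add, smul_add, Finset.sum_add_distrib]
    rwa [add_sub_add_comm]

end Lift

/-! ### Uniqueness of versal deformation rings -/

namespace CHat

variable {k : Type u} [Field k]

/-- The morphism `r ↦ r̄ + δ(r) ε` to the dual numbers given by a `k`-valued derivation `δ`. -/
noncomputable def ofDerivation {R : CHat k} (δ : R →ₗ[k] k)
    (hδ : ∀ r s, δ (r * s) = R.aug r * δ s + R.aug s * δ r) : R ⟶ dual k :=
  ofAlgHom (S := dual k) <| AlgHom.ofLinearMap (B := DualNumber k)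
    { toFun := fun r => (R.aug r, δ r)
      map_add' := fun r s => by rw [map_add, map_add]; rfl
      map_smul' := fun c r => by rw [map_smul, map_smul]; rfl }
    (by
      have h := hδ 1 1
      simp only [mul_one, map_one, one_mul] at h
      exact TrivSqZeroExt.ext (map_one R.aug) (by change δ 1 = 0; simpa using h))
    fun r s => TrivSqZeroExt.ext (map_mul R.aug r s) (by
      rw [TrivSqZeroExt.snd_mul]
      change δ (r * s) = R.aug r • δ s + MulOpposite.op (R.aug s) • δ r
      rw [hδ, op_smul_eq_smul, smul_eq_mul, smul_eq_mul])

/-- A linear form on `R` which kills `𝔪 ^ 2` gives a derivation. -/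
lemma derivation_of_functional {R : CHat k} {l : R →ₗ[k] k} (hl : ∀ b ∈ R.𝔪 ^ 2, l b = 0)
    (r s : R) : l (r * s - algebraMap k R (R.aug (r * s))) =
      R.aug r * l (s - algebraMap k R (R.aug s)) + R.aug s * l (r - algebraMap k R (R.aug r)) := by
  have h : (r - algebraMap k R (R.aug r)) * (s - algebraMap k R (R.aug s)) ∈ R.𝔪 ^ 2 := by
    rw [pow_two]; exact Ideal.mul_mem_mul (R.sub_aug_mem r) (R.sub_aug_mem s)
  have e : r * s - algebraMap k R (R.aug (r * s)) =
      R.aug r • (s - algebraMap k R (R.aug s)) + R.aug s • (r - algebraMap k R (R.aug r)) +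
      (r - algebraMap k R (R.aug r)) * (s - algebraMap k R (R.aug s)) := by
    simp only [Algebra.smul_def, map_mul]
    ring
  rw [e, map_add, map_add, map_smul, map_smul, hl _ h, add_zero, smul_eq_mul, smul_eq_mul]

/-- An endomorphism which is the identity on the cotangent space `𝔪 / 𝔪 ^ 2` is bijective. -/
lemma bijective_of_sub_mem {R : CHat k} (χ : R ⟶ R)
    (h : ∀ x ∈ R.𝔪, χ.toAlgHom x - x ∈ R.𝔪 ^ 2) : Function.Bijective χ.toAlgHom := by
  have key : ∀ n, ∀ x ∈ R.𝔪 ^ n, χ.toAlgHom x - x ∈ R.𝔪 ^ (n + 1) := by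
    intro n
    induction n with
    | zero =>
      intro x _
      have h1 := h _ (R.sub_aug_mem x)
      rw [map_sub, AlgHom.commutes, sub_sub_sub_cancel_right] at h1
      exact Ideal.pow_le_pow_right (by omega) h1
    | succ n ih =>
      intro x hx
      rw [pow_succ] at hx
      induction hx using Submodule.mul_induction_on' with
      | mem_mul_mem a ha b hb =>
        have e : χ.toAlgHom (a * b) - a * b =
            χ.toAlgHom a * (χ.toAlgHom b - b) + (χ.toAlgHom a - a) * b := by
          rw [map_mul]; ring
        rw [e]
        refine add_mem ?_ ?_
        · have := Ideal.mul_mem_mul (map_mem_pow χ ha) (h b hb)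
          rwa [← pow_add] at this
        · rw [pow_succ _ (n + 1)]
          exact Ideal.mul_mem_mul (ih a ha) hb
      | add x _ y _ hx hy =>
        rw [map_add, add_sub_add_comm]; exact add_mem hx hy
  constructor
  · rw [injective_iff_map_eq_zero]
    intro x hx
    refine R.eq_zero_of_mem_pow fun n => ?_
    induction n with
    | zero => simp
    | succ n ih =>
      have := key n x ih
      rwa [hx, zero_sub, neg_mem_iff] at this
  · intro y
    let f : ℕ → R := fun n => Nat.rec 0 (fun _ x => x + (y - χ.toAlgHom x)) n
    have hf : ∀ n, y - χ.toAlgHom (f n) ∈ R.𝔪 ^ n := by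
      intro n
      induction n with
      | zero => simp
      | succ n ih =>
        have h1 := key n _ ih
        have : y - χ.toAlgHom (f (n + 1)) = -(χ.toAlgHom (y - χ.toAlgHom (f n)) -
            (y - χ.toAlgHom (f n))) := by
          have : f (n + 1) = f n + (y - χ.toAlgHom (f n)) := rfl
          rw [this, map_add, map_sub]; ring
        rw [this]; exact neg_mem h1
    obtain ⟨x, hx⟩ := R.exists_limit R f fun t => by
      rw [smul_eq_mul, Ideal.mul_top]
      have : f (t + 1) - f t = y - χ.toAlgHom (f t) := add_sub_cancel_left _ _
      rw [this]; exact hf t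
    refine ⟨x, ?_⟩
    rw [← sub_eq_zero]
    refine R.eq_zero_of_mem_pow fun n => ?_
    have h1 := hx n
    rw [smul_eq_mul, Ideal.mul_top] at h1
    have h2 := sub_mem (map_mem_pow χ h1) (hf n)
    rw [map_sub] at h2
    convert h2 using 1; ring

lemma nonempty_iso_of_bijective {R S : CHat k} (ψ : R ⟶ S) (h : Function.Bijective ψ.toAlgHom) :
    Nonempty (R ≅ S) := by
  let e := AlgEquiv.ofBijective ψ.toAlgHom h
  exact ⟨{ hom := ψ
           inv := ofAlgHom e.symm.toAlgHom
           hom_inv_id := hom_ext fun r => e.symm_apply_apply r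
           inv_hom_id := hom_ext fun r => e.apply_symm_apply r }⟩

end CHat

namespace Lift

variable {k : Type u} [Field k] {Λ : Type u} [Ring Λ] [Algebra k Λ]
  {V : Type u} [AddCommGroup V] [Module Λ V] {R S : CHat k}

/-- An endomorphism of a versal ring which fixes the versal deformation induces the identity on the
cotangent space, by the uniqueness over the dual numbers. -/
lemma IsVersal.bijective {U : Lift k Λ V R} (hU : U.IsVersal) (χ : R ⟶ R) (hχ : MapsTo χ U U) :
    Function.Bijective χ.toAlgHom := by
  rw [isVersal_iff] at hU
  refine CHat.bijective_of_sub_mem χ fun x hx => ?_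
  obtain ⟨q, a, l, ha, hl, hal⟩ := R.exists_graded_coordinates 1
  have hχx : χ.toAlgHom x - x ∈ R.𝔪 ^ 1 := by
    rw [pow_one]; exact sub_mem (CHat.map_mem χ hx) hx
  have h := hal _ hχx
  have h0 : ∀ j, l j (χ.toAlgHom x - x) = 0 := fun j => by
    let f := CHat.ofDerivation
      (l j ∘ₗ (LinearMap.id - (Algebra.linearMap k R) ∘ₗ R.aug.toLinearMap))
      (CHat.derivation_of_functional (hl j))
    have h1 := hU.2 (U.map f) (χ ≫ f) f (hχ.comp (mapsTo_map f U)) (mapsTo_map f U)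
    have h2 : f.toAlgHom (χ.toAlgHom x) = f.toAlgHom x :=
      congrArg (fun g : R ⟶ CHat.dual k => g.toAlgHom x) h1
    have h3 : l j (χ.toAlgHom x - algebraMap k R (R.aug (χ.toAlgHom x))) =
        l j (x - algebraMap k R (R.aug x)) := congrArg TrivSqZeroExt.snd h2
    rw [CHat.aug_map] at h3
    rw [← sub_eq_zero, ← map_sub, sub_sub_sub_cancel_right] at h3
    exact h3
  simpa [h0] using h

/-- Versal deformation rings are unique up to isomorphism. -/
lemma nonempty_iso_of_isVersal {U : Lift k Λ V R} {U' : Lift k Λ V S} (hU : U.IsVersal)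
    (hU' : U'.IsVersal) : Nonempty (R ≅ S) := by
  obtain ⟨ψ, hψ⟩ := ((isVersal_iff U).1 hU).1 S U'
  obtain ⟨χ, hχ⟩ := ((isVersal_iff U').1 hU').1 R U
  have h1 : Function.Bijective (χ.toAlgHom ∘ ψ.toAlgHom) := hU.bijective (ψ ≫ χ) (hψ.comp hχ)
  have h2 : Function.Bijective (ψ.toAlgHom ∘ χ.toAlgHom) := hU'.bijective (χ ≫ ψ) (hχ.comp hψ)
  exact CHat.nonempty_iso_of_bijective ψ ⟨h1.1.of_comp, h2.2.of_comp⟩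

end Lift

/-! ### Power series rings -/

section PowerSeries

variable (k : Type u) [Field k] (n : ℕ)

lemma mem_span_X_of_constantCoeff {f : MvPowerSeries (Fin n) k}
    (hf : MvPowerSeries.constantCoeff f = 0) :
    f ∈ (Ideal.span (Set.range MvPowerSeries.X) : Ideal (MvPowerSeries (Fin n) k)) := by
  let e := MvPowerSeries.toAdicCompletionAlgEquiv (Fin n) k
  have h1 : Ideal.map e.toRingEquiv (Ideal.span (Set.range MvPowerSeries.X)) =
      (MvPolynomial.idealOfVars (Fin n) k).map (algebraMap _ _) := by
    simp_rw [Ideal.map_span, ← Set.range_comp]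
    congr 2; ext1
    simp [e, AdicCompletion.algebraMap_apply, ← MvPolynomial.coe_X,
      MvPowerSeries.toAdicCompletion_coe]
  have h2 : e f ∈ (MvPolynomial.idealOfVars (Fin n) k).map (algebraMap _ (AdicCompletion
      (MvPolynomial.idealOfVars (Fin n) k) (MvPolynomial (Fin n) k))) := by
    rw [← AdicCompletion.ker_evalOneₐ_eq_map _ (MvPolynomial.idealOfVars_fg _ _)]
    have h3 : AdicCompletion.evalₐ (MvPolynomial.idealOfVars (Fin n) k) 1 (e f) = 0 := by
      have : AdicCompletion.evalₐ (MvPolynomial.idealOfVars (Fin n) k) 1 (e f) =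
          MvPowerSeries.truncTotalAlgHom (Fin n) k 1 f := by
        change AdicCompletion.evalₐ _ 1 (MvPowerSeries.toAdicCompletion (Fin n) k f) = _
        rw [MvPowerSeries.toAdicCompletion, AdicCompletion.evalₐ_liftAlgHom]
        exact fun h => AlgHom.ext fun p => by
          simpa [Ideal.Quotient.mk_eq_mk_iff_sub_mem] using
            MvPowerSeries.truncTotal_sub_truncTotal_mem_pow_idealOfVars h le_rfl p
      rw [this, MvPowerSeries.truncTotalAlgHom_apply, Ideal.Quotient.eq_zero_iff_mem,
        MvPolynomial.mem_pow_idealOfVars_iff']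
      intro x hx
      rw [MvPowerSeries.coeff_truncTotal _ hx]
      have : x = 0 := (Finsupp.degree_eq_zero_iff x).1 (by simpa using hx)
      rw [this]; exact hf
    rw [RingHom.mem_ker]
    exact (AdicCompletion.factorₐ_evalₐ_one _ (e f)).symm.trans (by rw [h3, map_zero])
  rw [← h1] at h2
  obtain ⟨g, hg, hge⟩ := (Ideal.mem_map_of_equiv e.toRingEquiv _).1 h2
  rwa [← e.injective hge]

lemma maximalIdeal_mvPowerSeries : IsLocalRing.maximalIdeal (MvPowerSeries (Fin n) k) =
    Ideal.span (Set.range MvPowerSeries.X) := by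
  refine le_antisymm (fun f hf => mem_span_X_of_constantCoeff k n ?_) ?_
  · by_contra h
    exact hf (MvPowerSeries.isUnit_iff_constantCoeff.2 (isUnit_iff_ne_zero.2 h))
  · rw [Ideal.span_le]
    rintro _ ⟨i, rfl⟩ hu
    have := MvPowerSeries.isUnit_constantCoeff _ hu
    simp at this

variable {k n}

lemma residue_bijective_of_exists {R : Type u} [CommRing R] [Algebra k R] [IsLocalRing R]
    (h : ∀ r : R, ∃ c : k, r - algebraMap k R c ∈ IsLocalRing.maximalIdeal R) :
    Function.Bijective (algebraMap k (IsLocalRing.ResidueField R)) := by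
  refine ⟨(algebraMap k (IsLocalRing.ResidueField R)).injective, fun y => ?_⟩
  obtain ⟨r, rfl⟩ := IsLocalRing.residue_surjective y
  obtain ⟨c, hc⟩ := h r
  refine ⟨c, ?_⟩
  rw [← IsLocalRing.residue_eq_zero_iff, map_sub, sub_eq_zero] at hc
  rw [hc]; rfl

variable (k n) in
/-- The object `k[[X₁, …, Xₙ]]` of `Ĉ`. -/
noncomputable def CHat.powerSeries : CHat k where
  carrier := MvPowerSeries (Fin n) k
  isAdicComplete := by rw [maximalIdeal_mvPowerSeries]; infer_instance
  residue_bijective := residue_bijective_of_exists fun f =>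
    ⟨MvPowerSeries.constantCoeff f, by
      rw [maximalIdeal_mvPowerSeries]
      apply mem_span_X_of_constantCoeff
      rw [map_sub, sub_eq_zero]
      exact (MvPowerSeries.constantCoeff_C _).symm⟩

lemma maximalIdeal_quotient {A : Type u} [CommRing A] [IsLocalRing A] (I : Ideal A)
    [IsLocalRing (A ⧸ I)] : IsLocalRing.maximalIdeal (A ⧸ I) =
      (IsLocalRing.maximalIdeal A).map (Ideal.Quotient.mk I) := by
  have hI : I ≤ IsLocalRing.maximalIdeal A :=
    IsLocalRing.le_maximalIdeal (Ideal.Quotient.nontrivial_iff.1 inferInstance)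
  refine le_antisymm (fun x hx => ?_) (Ideal.map_le_iff_le_comap.2 fun a ha hu => ?_)
  · obtain ⟨a, rfl⟩ := Ideal.Quotient.mk_surjective x
    exact Ideal.mem_map_of_mem _ fun hu => hx (hu.map _)
  · obtain ⟨b, hb⟩ := hu.exists_right_inv
    obtain ⟨b, rfl⟩ := Ideal.Quotient.mk_surjective b
    rw [← map_mul, ← map_one (Ideal.Quotient.mk I), Ideal.Quotient.eq] at hb
    have h1 := sub_mem (Ideal.mul_mem_right b _ ha) (hI hb)
    rw [sub_sub_cancel] at h1
    exact (Ideal.ne_top_iff_one _).1 (IsLocalRing.maximalIdeal.isMaximal A).ne_top h1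

/-- The object `k[[X₁, …, Xₙ]] / J` of `Ĉ`. -/
noncomputable def CHat.powerSeriesQuotient (J : Ideal (MvPowerSeries (Fin n) k)) (hJ : J ≠ ⊤) :
    CHat k :=
  haveI : Nontrivial (MvPowerSeries (Fin n) k ⧸ J) := Ideal.Quotient.nontrivial_iff.2 hJ
  haveI hl : IsLocalRing (MvPowerSeries (Fin n) k ⧸ J) :=
    .of_surjective' (Ideal.Quotient.mk J) Ideal.Quotient.mk_surjective
  { carrier := MvPowerSeries (Fin n) k ⧸ J
    isAdicComplete := by
      have h1 : IsPrecomplete (IsLocalRing.maximalIdeal (MvPowerSeries (Fin n) k))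
          (MvPowerSeries (Fin n) k ⧸ J) := by
        have : IsAdicComplete (IsLocalRing.maximalIdeal (MvPowerSeries (Fin n) k))
            (MvPowerSeries (Fin n) k) := by
          rw [maximalIdeal_mvPowerSeries]; infer_instance
        exact isPrecomplete_of_finite _ _
      rw [← IsPrecomplete.map_algebraMap_iff (S := MvPowerSeries (Fin n) k ⧸ J),
        Ideal.Quotient.algebraMap_eq, ← maximalIdeal_quotient] at h1
      exact { (inferInstance : IsHausdorff (IsLocalRing.maximalIdeal (MvPowerSeries (Fin n) k ⧸ J))
        (MvPowerSeries (Fin n) k ⧸ J)), h1 with }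
    residue_bijective := residue_bijective_of_exists fun r => by
      obtain ⟨f, rfl⟩ := Ideal.Quotient.mk_surjective r
      refine ⟨(CHat.powerSeries k n).aug f, ?_⟩
      rw [maximalIdeal_quotient]
      exact Ideal.mem_map_of_mem _ ((CHat.powerSeries k n).sub_aug_mem f) }

variable {J : Ideal (MvPowerSeries (Fin n) k)} {hJ : J ≠ ⊤}

/-- The class of the `i`-th variable. -/
noncomputable def CHat.powerSeriesVar (J : Ideal (MvPowerSeries (Fin n) k)) (hJ : J ≠ ⊤)
    (i : Fin n) : CHat.powerSeriesQuotient J hJ :=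
  Ideal.Quotient.mk J (MvPowerSeries.X i)

/-- Evaluation of power series at elements of the maximal ideal. -/
lemma exists_eval (S : CHat k) (x : Fin n → S) (hx : ∀ i, x i ∈ S.𝔪) :
    ∃ f : MvPowerSeries (Fin n) k →ₐ[k] S, ∀ p : MvPolynomial (Fin n) k,
      f p = MvPolynomial.aeval x p := by
  have hle : ∀ m, ∀ p ∈ MvPolynomial.idealOfVars (Fin n) k ^ m,
      MvPolynomial.aeval x p ∈ S.𝔪 ^ m := by
    intro m p hp
    have h1 : (MvPolynomial.idealOfVars (Fin n) k).map (MvPolynomial.aeval x).toRingHom ≤ S.𝔪 := by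
      rw [Ideal.map_le_iff_le_comap, MvPolynomial.idealOfVars, Ideal.span_le]
      rintro _ ⟨i, rfl⟩
      simpa using hx i
    have h2 := Ideal.pow_right_mono h1 m
    rw [← Ideal.map_pow] at h2
    exact h2 (Ideal.mem_map_of_mem _ hp)
  let g : (m : ℕ) → MvPowerSeries (Fin n) k →ₐ[k] S ⧸ S.𝔪 ^ m := fun m =>
    (Ideal.Quotient.liftₐ (MvPolynomial.idealOfVars (Fin n) k ^ m)
      ((Ideal.Quotient.mkₐ k (S.𝔪 ^ m)).comp (MvPolynomial.aeval x)) fun p hp =>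
        Ideal.Quotient.eq_zero_iff_mem.2 (hle m p hp)).comp
      ((MvPowerSeries.truncTotalAlgHom (Fin n) k m).restrictScalars k)
  have hg : ∀ m f, g m f = Ideal.Quotient.mk _ (MvPolynomial.aeval x
      (MvPowerSeries.truncTotal m f)) := fun m f => rfl
  refine ⟨IsAdicComplete.liftAlgHom S.𝔪 g ?_, fun p => ?_⟩
  · intro a b hab
    ext f
    rw [AlgHom.comp_apply, hg, hg]
    change Ideal.Quotient.mk _ _ = Ideal.Quotient.mk _ _
    rw [Ideal.Quotient.eq, ← map_sub]
    exact hle _ _ (MvPowerSeries.truncTotal_sub_truncTotal_mem_pow_idealOfVars hab le_rfl f)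
  · rw [← sub_eq_zero]
    refine S.eq_zero_of_mem_pow fun m => ?_
    rw [← Ideal.Quotient.eq, IsAdicComplete.mk_liftAlgHom, hg, Ideal.Quotient.eq, ← map_sub]
    refine hle _ _ ((MvPolynomial.mem_pow_idealOfVars_iff' ..).mpr fun d hd ↦ ?_)
    simp [MvPowerSeries.coeff_truncTotal _ hd]

lemma CHat.powerSeriesVar_span : Ideal.span (Set.range (CHat.powerSeriesVar J hJ)) =
    (CHat.powerSeriesQuotient J hJ).𝔪 := by
  have h := @maximalIdeal_quotient (MvPowerSeries (Fin n) k) _ _ J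
    (CHat.powerSeriesQuotient J hJ).isLocalRing
  rw [maximalIdeal_mvPowerSeries, Ideal.map_span, ← Set.range_comp] at h
  exact h.symm

/-- The universal property of `k[[X₁, …, Xₙ]] / J` when `J` is generated by polynomials. -/
lemma CHat.exists_powerSeriesQuotient_hom {T : Set (MvPolynomial (Fin n) k)}
    (hJT : J = Ideal.span ((fun p : MvPolynomial (Fin n) k => (p : MvPowerSeries (Fin n) k)) '' T))
    (S : CHat k) (x : Fin n → S) (hx : ∀ i, x i ∈ S.𝔪)
    (hT : ∀ p ∈ T, MvPolynomial.aeval x p = 0) :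
    ∃ ψ : CHat.powerSeriesQuotient J hJ ⟶ S,
      ∀ i, ψ.toAlgHom (CHat.powerSeriesVar J hJ i) = x i := by
  obtain ⟨f, hf⟩ := exists_eval S x hx
  have hle : ∀ a ∈ J, f a = 0 := by
    intro a ha
    have : J ≤ RingHom.ker f := by
      rw [hJT, Ideal.span_le]
      rintro _ ⟨p, hp, rfl⟩
      exact (hf p).trans (hT p hp)
    exact this ha
  refine ⟨CHat.ofAlgHom (Ideal.Quotient.liftₐ J f hle), fun i => ?_⟩
  have := hf (MvPolynomial.X i)
  rw [MvPolynomial.coe_X, MvPolynomial.aeval_X] at this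
  exact this

end PowerSeries

/-! ### Slices transversal to the inner derivations -/

section InnerDerivations

variable (k : Type u) [Field k] {Λ : Type u} [Ring Λ] [Algebra k Λ]
  (A B : Type u) [AddCommGroup A] [Module k A] [Module Λ A] [IsScalarTower k Λ A]
  [AddCommGroup B] [Module k B] [Module Λ B] [IsScalarTower k Λ B]

variable (Λ) in
/-- The inner derivation `a ↦ a Z - Z a` of `Λ` in `Hom_k(A, B)`, depending linearly on `Z`. -/
noncomputable def innerDerivation : (A →ₗ[k] B) →ₗ[k] (Λ →ₗ[k] A →ₗ[k] B) :=
  LinearMap.mk₂ k (fun Z a => (Algebra.lsmul k k B a) ∘ₗ Z - Z ∘ₗ (Algebra.lsmul k k A a))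
    (fun Z Z' a => by ext; simp; abel) (fun c Z a => by ext; simp [smul_sub, smul_comm a c])
    (fun Z a a' => by ext; simp; abel)
    (fun Z c a => by ext; simp [smul_sub])

lemma innerDerivation_apply (Z : A →ₗ[k] B) (a : Λ) (x : A) :
    innerDerivation k Λ A B Z a x = a • Z x - Z (a • x) := rfl

end InnerDerivations

namespace Lift

variable {k : Type u} [Field k] {Λ : Type u} [Ring Λ] [Algebra k Λ] [Module.Finite k Λ]
  {V : Type u} [AddCommGroup V] [Module Λ V] [Module k V] [IsScalarTower k Λ V]
  [Module.Finite k V] {R S : CHat k}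

lemma apply_mem_pow_smul {C D : Type*} [AddCommGroup C] [AddCommGroup D] [Module R C] [Module R D]
    (f : C →ₗ[R] D) {I : Ideal R} {x : C} (hx : x ∈ I • (⊤ : Submodule R C)) :
    f x ∈ I • (⊤ : Submodule R D) := by
  have : f x ∈ (I • (⊤ : Submodule R C)).map f := ⟨x, hx, rfl⟩
  rw [Submodule.map_smul''] at this
  exact (smul_mono_right I le_top : _ ≤ I • (⊤ : Submodule R D)) this

/-- Evaluation at a vector, as a map linear over `R`. -/
noncomputable def evalAt (L : Lift k Λ V R) {A : Type u} [AddCommGroup A] [Module k A] (v : A) :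
    (A →ₗ[k] L) →ₗ[R] L where
  toFun f := f v
  map_add' _ _ := rfl
  map_smul' _ _ := rfl

variable {r : ℕ} (c : Fin r → Λ →ₗ[k] V →ₗ[k] V)

/-- The error made in regarding `σ`, `x` as a presentation of the action of `Λ` on `L` by
the operators `a + ∑ xᵢ cᵢ(a)` on `S ⊗ V`. -/
noncomputable def sliceError (L : Lift k Λ V R) (σ : V →ₗ[k] L) (x : Fin r → R) :
    Λ →ₗ[k] V →ₗ[k] L :=
  LinearMap.mk₂ k (fun a v => a • σ v - σ (a • v) - ∑ i, x i • σ (c i a v))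
    (fun a b v => by
      simp only [add_smul, map_add, LinearMap.add_apply, smul_add, Finset.sum_add_distrib]; abel)
    (fun t a v => by
      simp only [smul_assoc, map_smul, LinearMap.smul_apply, smul_sub, Finset.smul_sum,
        smul_comm _ t])
    (fun a v w => by
      simp only [map_add, smul_add, Finset.sum_add_distrib]; abel)
    (fun t a v => by
      simp only [map_smul, smul_sub, Finset.smul_sum, smul_comm _ t])

/-- If every bilinear map `Λ × V → V` is a combination of the `c i` up to an inner derivation, then
on every lift of `V` the action of `Λ` is given by operators `a + ∑ xᵢ cᵢ(a)` on `S ⊗ V`. -/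
lemma exists_slice (hc : ∀ h : Λ →ₗ[k] V →ₗ[k] V, ∃ (Z : V →ₗ[k] V) (y : Fin r → k),
      h = innerDerivation k Λ V V Z + ∑ i, y i • c i) (L : Lift k Λ V S) :
    ∃ (σ : V →ₗ[k] L) (x : Fin r → S), (∀ v, L.π (σ v) = v) ∧ (∀ i, x i ∈ S.𝔪) ∧
      ∀ a v, a • σ v = σ (a • v) + ∑ i, x i • σ (c i a v) := by
  obtain ⟨σ₀, hσ₀⟩ := L.exists_section
  let Q : ℕ → (V →ₗ[k] L) × (Fin r → S) → Prop := fun t z =>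
    (∀ v, L.π (z.1 v) = v) ∧ (∀ i, z.2 i ∈ S.𝔪) ∧
      ∀ a v, sliceError c L z.1 z.2 a v ∈ S.𝔪 ^ t • (⊤ : Submodule S L)
  have hfst : ∀ {t} {z z' : (V →ₗ[k] L) × (Fin r → S)},
      z' - z ∈ S.𝔪 ^ t • (⊤ : Submodule S ((V →ₗ[k] L) × (Fin r → S))) →
        ∀ v, z'.1 v - z.1 v ∈ S.𝔪 ^ t • (⊤ : Submodule S L) := fun h v =>
    apply_mem_pow_smul (L.evalAt v ∘ₗ LinearMap.fst S _ _) h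
  have hsnd : ∀ {t} {z z' : (V →ₗ[k] L) × (Fin r → S)},
      z' - z ∈ S.𝔪 ^ t • (⊤ : Submodule S ((V →ₗ[k] L) × (Fin r → S))) →
        ∀ i, z'.2 i - z.2 i ∈ S.𝔪 ^ t := fun {t z z'} h i => by
    have := apply_mem_pow_smul (LinearMap.proj i ∘ₗ LinearMap.snd S (V →ₗ[k] L) (Fin r → S)) h
    rwa [smul_eq_mul, Ideal.mul_top] at this
  have hbase : ∀ {t}, 1 ≤ t → ∀ {z z' : (V →ₗ[k] L) × (Fin r → S)},
      z' - z ∈ S.𝔪 ^ t • (⊤ : Submodule S ((V →ₗ[k] L) × (Fin r → S))) →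
      ((∀ v, L.π (z.1 v) = v) ∧ (∀ i, z.2 i ∈ S.𝔪)) →
      ((∀ v, L.π (z'.1 v) = v) ∧ (∀ i, z'.2 i ∈ S.𝔪)) := by
    rintro t ht z z' hz ⟨h1, h2⟩
    have hz' := S.pow_smul_antitone ht hz
    constructor
    · intro v
      have := hfst hz' v
      rw [pow_one, ← π_eq_zero_iff, map_sub, sub_eq_zero, h1] at this
      exact this
    · intro i
      have := add_mem (hsnd hz' i) (by simpa using h2 i)
      rwa [sub_add_cancel, pow_one] at this
  have hex : ∃ z, z - (σ₀, 0) ∈ S.𝔪 • (⊤ : Submodule S ((V →ₗ[k] L) × (Fin r → S))) ∧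
      ∀ t, 1 ≤ t → Q t z := by
    refine S.exists_of_successive Q ?_ (σ₀, 0) ?_ ?_
    · rintro t ht z z' ⟨h1, h2, h3⟩ hzz
      refine ⟨(hbase ht hzz ⟨h1, h2⟩).1, (hbase ht hzz ⟨h1, h2⟩).2, fun a v => ?_⟩
      have e : sliceError c L z'.1 z'.2 a v = sliceError c L z.1 z.2 a v +
          (a • (z'.1 v - z.1 v) - (z'.1 (a • v) - z.1 (a • v)) -
            ∑ i, (z'.2 i • (z'.1 (c i a v) - z.1 (c i a v)) +
              (z'.2 i - z.2 i) • z.1 (c i a v))) := by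
        simp only [sliceError, LinearMap.mk₂_apply, smul_sub, sub_smul, Finset.sum_add_distrib,
          Finset.sum_sub_distrib]
        abel
      rw [e]
      refine add_mem (h3 a v) (sub_mem (sub_mem (L.alg_smul_mem a (hfst hzz v)) (hfst hzz _)) ?_)
      refine Submodule.sum_mem _ fun i _ => add_mem (Submodule.smul_mem _ _ (hfst hzz _)) ?_
      exact Submodule.smul_mem_smul (hsnd hzz i) trivial
    · refine ⟨hσ₀, fun i => zero_mem _, fun a v => ?_⟩
      rw [pow_one, ← π_eq_zero_iff]
      simp [sliceError, hσ₀]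
    · rintro t ht ⟨σ, x⟩ ⟨h1, h2, h3⟩
      obtain ⟨q, a, l, ha, hl, hal⟩ := S.exists_graded_coordinates t
      choose Z y hZy using fun j => hc ((sliceError c L σ x).compr₂ (L.coeff (l j)))
      have hE : ∀ j b v, L.coeff (l j) (sliceError c L σ x b v) =
          (b • Z j v - Z j (b • v)) + ∑ i, y j i • c i b v := fun j b v => by
        have := LinearMap.congr_fun (LinearMap.congr_fun (hZy j) b) v
        simpa [innerDerivation_apply] using this
      let d : (V →ₗ[k] L) × (Fin r → S) :=
        ∑ j, a j • ((-(σ ∘ₗ Z j), fun i => algebraMap k S (y j i)) : (V →ₗ[k] L) × (Fin r → S))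
      have hd : d ∈ S.𝔪 ^ t • (⊤ : Submodule S ((V →ₗ[k] L) × (Fin r → S))) :=
        Submodule.sum_mem _ fun j _ => Submodule.smul_mem_smul (ha j) trivial
      have hd1 : ∀ v, d.1 v = - ∑ j, a j • σ (Z j v) := fun v => by
        simp [d, Prod.fst_sum]
      have hd2 : ∀ i, d.2 i = ∑ j, a j * algebraMap k S (y j i) := fun v => by
        simp [d, Prod.snd_sum]
      have hdd : ((σ, x) + d) - (σ, x) ∈
          S.𝔪 ^ t • (⊤ : Submodule S ((V →ₗ[k] L) × (Fin r → S))) := by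
        rwa [add_sub_cancel_left]
      have hb := hbase ht hdd ⟨h1, h2⟩
      refine ⟨(σ, x) + d, hdd, hb.1, hb.2, fun b v => ?_⟩
      have h4 := L.sub_sum_coeff_mem h1 hl ha hal (h3 b v)
      have e : sliceError c L ((σ, x) + d).1 ((σ, x) + d).2 b v =
          (sliceError c L σ x b v - ∑ j, a j • σ (L.coeff (l j) (sliceError c L σ x b v)))
          - ∑ j, a j • (b • σ (Z j v) - σ (b • Z j v))
          - ∑ i, (x + d.2) i • d.1 (c i b v) := by
        simp only [hE]
        have e3 : ∀ j (w : L), b • a j • w = a j • b • w := fun j w => (smul_comm _ _ _).symm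
        have e2 : ∀ j i, a j • σ (y j i • c i b v) = (a j * algebraMap k S (y j i)) • σ (c i b v) :=
          fun j i => by rw [map_smul, mul_smul, algebraMap_smul]
        simp only [map_add, map_sub, map_sum, smul_add, Finset.smul_sum, e2, Finset.sum_add_distrib,
          smul_sub, Finset.sum_sub_distrib]
        rw [Finset.sum_comm (f := fun j i => (a j * algebraMap k S (y j i)) • σ (c i b v))]
        simp only [← Finset.sum_smul, ← hd2]
        simp only [sliceError, LinearMap.mk₂_apply, Prod.fst_add, Prod.snd_add, LinearMap.add_apply,
          hd1, smul_add, Pi.add_apply, add_smul, Finset.sum_add_distrib, smul_neg, Finset.smul_sum,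
          e3]
        abel
      rw [e]
      refine sub_mem (sub_mem h4 (Submodule.sum_mem _ fun j _ => smul_mem_pow_succ (ha j) ?_))
        (Submodule.sum_mem _ fun i _ => smul_mem_pow_succ' (hb.2 i) ?_)
      · rw [← π_eq_zero_iff, map_sub, map_smul, h1, h1, sub_self]
      · rw [hd1]
        exact neg_mem (Submodule.sum_mem _ fun j _ => Submodule.smul_mem_smul (ha j) trivial)
  obtain ⟨z, -, hz⟩ := hex
  have h1 := hz 1 le_rfl
  refine ⟨z.1, z.2, h1.1, h1.2.1, fun a v => ?_⟩
  rw [← sub_eq_zero, ← sub_sub]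
  refine S.eq_zero_of_mem_pow_smul fun n => ?_
  exact S.pow_smul_antitone (Nat.le_succ n) ((hz (n + 1) (by omega)).2.2 a v)

end Lift

/-! ### Lifts from points of the slice -/

namespace Lift

section Section

variable {k : Type u} [Field k] {Λ : Type u} [Ring Λ] [Algebra k Λ]
  {V : Type u} [AddCommGroup V] [Module Λ V] [Module k V] [IsScalarTower k Λ V]
  {R S : CHat k}

/-- A section of the reduction carries a basis of `V` to a basis of the lift. -/
lemma exists_basis (L : Lift k Λ V R) {σ : V →ₗ[k] L} (hσ : ∀ v, L.π (σ v) = v) {ι : Type*}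
    [Fintype ι] [DecidableEq ι] (b : Module.Basis ι k V) :
    ∃ e : Module.Basis ι R L, ∀ i, e i = σ (b i) := by
  have hπ : ∀ c : ι → R, L.π (Fintype.linearCombination R (fun i => σ (b i)) c) =
      ∑ i, R.aug (c i) • b i := fun c => by
    simp [Fintype.linearCombination_apply, π_smul, hσ]
  have hbij : Function.Bijective (Fintype.linearCombination R (fun i => σ (b i))) := by
    refine bijective_of_mod_maximalIdeal _ (fun y => ?_) fun c hc => ?_
    · refine ⟨fun i => algebraMap k R (b.repr (L.π y) i), ?_⟩
      rw [← π_eq_zero_iff, map_sub, hπ]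
      simp only [CHat.aug_algebraMap]
      rw [b.sum_repr, sub_self]
    · have h := hπ c
      rw [hc, map_zero] at h
      have h0 := Fintype.linearIndependent_iff.1 b.linearIndependent _ h.symm
      rw [pi_eq_sum_univ c]
      exact Submodule.sum_mem _ fun i _ =>
        Submodule.smul_mem_smul (R.aug_eq_zero_iff.1 (h0 i)) trivial
  refine ⟨(Module.Basis.ofEquivFun (LinearEquiv.ofBijective _ hbij).symm), fun i => ?_⟩
  simp

/-- A lift is free over `R` on a section of its reduction: linear maps on `V` extend to
semilinear maps on the lift. -/
lemma exists_semilinear [Module.Finite k V] (L : Lift k Λ V R) {σ : V →ₗ[k] L}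
    (hσ : ∀ v, L.π (σ v) = v) (ψ : R ⟶ S) {N : Type*} [AddCommGroup N] [Module S N] [Module k N]
    [IsScalarTower k S N] (τ : V →ₗ[k] N) :
    ∃ u : L →+ N, (∀ (r : R) (x : L), u (r • x) = ψ.toAlgHom r • u x) ∧ ∀ v, u (σ v) = τ v := by
  let b := Module.finBasis k V
  obtain ⟨e, he⟩ := L.exists_basis hσ b
  let u : L →+ N :=
    { toFun := fun x => ∑ i, ψ.toAlgHom (e.repr x i) • τ (b i)
      map_zero' := by simp
      map_add' := fun x y => by simp [add_smul, Finset.sum_add_distrib] }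
  have hu : ∀ (r : R) (x : L), u (r • x) = ψ.toAlgHom r • u x := fun r x => by
    change ∑ i, ψ.toAlgHom (e.repr (r • x) i) • τ (b i) =
      ψ.toAlgHom r • ∑ i, ψ.toAlgHom (e.repr x i) • τ (b i)
    simp [Finset.smul_sum, mul_smul]
  refine ⟨u, hu, fun v => ?_⟩
  have hc : ∀ (c : k) (x : L), u (c • x) = c • u x := fun c x => by
    rw [← algebraMap_smul, hu, AlgHom.commutes, _root_.algebraMap_smul]
  have hb : ∀ i, u (σ (b i)) = τ (b i) := fun i => by
    change ∑ j, ψ.toAlgHom (e.repr (σ (b i)) j) • τ (b j) = _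
    rw [← he i, e.repr_self, Finset.sum_eq_single i]
    · simp
    · intro j _ hj; simp [Finsupp.single_eq_of_ne hj]
    · simp
  let ul : V →ₗ[k] N := ({ u with map_smul' := hc } : L →ₗ[k] N) ∘ₗ σ
  have : ul = τ := b.ext hb
  exact LinearMap.congr_fun this v

lemma span_range_section (L : Lift k Λ V R) {σ : V →ₗ[k] L}
    (hσ : ∀ v, L.π (σ v) = v) : Submodule.span R (Set.range σ) = ⊤ := by
  refine top_le_iff.1 (Submodule.le_of_le_smul_of_le_jacobson_bot (I := R.𝔪)
    Module.Finite.fg_top (IsLocalRing.maximalIdeal_le_jacobson _) fun y _ => ?_)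
  rw [← add_sub_cancel (σ (L.π y)) y]
  exact Submodule.add_mem_sup (Submodule.subset_span ⟨_, rfl⟩) (L.sub_section_mem hσ y)

/-- To be compatible with the action of `Λ` and with the reductions may be tested on a section. -/
lemma mapsTo_of_section {L : Lift k Λ V R} {L' : Lift k Λ V S} {σ : V →ₗ[k] L}
    (hσ : ∀ v, L.π (σ v) = v) {ψ : R ⟶ S} (u : L →+ L')
    (hu : ∀ (r : R) (x : L), u (r • x) = ψ.toAlgHom r • u x)
    (ha : ∀ (a : Λ) v, u (a • σ v) = a • u (σ v)) (hπ : ∀ v, L'.π (u (σ v)) = v) :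
    MapsTo ψ L L' := by
  have hspan : ∀ x : L, x ∈ Submodule.span R (Set.range σ) := fun x =>
    L.span_range_section hσ ▸ trivial
  refine ⟨u, hu, fun a x => ?_, fun x => ?_⟩
  · induction hspan x using Submodule.span_induction with
    | mem x hx => obtain ⟨v, rfl⟩ := hx; exact ha a v
    | zero => simp
    | add x y _ _ hx hy => simp only [smul_add, map_add, hx, hy]
    | smul r x _ hx => rw [← smul_comm r a x, hu, hx, hu, smul_comm]
  · induction hspan x using Submodule.span_induction with
    | mem x hx => obtain ⟨v, rfl⟩ := hx; rw [hπ, hσ]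
    | zero => simp
    | add x y _ _ hx hy => simp only [map_add, hx, hy]
    | smul r x _ hx => rw [hu, π_smul, π_smul, hx, CHat.aug_map]

end Section

section Slice

variable {k : Type u} [Field k] {Λ : Type u} [Ring Λ] [Algebra k Λ]
  {V : Type u} [AddCommGroup V] [Module Λ V] [Module k V] [IsScalarTower k Λ V]
  {r : ℕ} (c : Fin r → Λ →ₗ[k] V →ₗ[k] V)

/-- The operator `a + ∑ xᵢ cᵢ(a)` on `A ⊗ V`. -/
noncomputable def sliceOp {A : Type u} [CommRing A] [Algebra k A] (x : Fin r → A) :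
    Λ →ₗ[k] Module.End A (A ⊗[k] V) :=
  (LinearMap.baseChangeHom k A V V) ∘ₗ (Algebra.lsmul k k V).toLinearMap +
    ∑ i, x i • ((LinearMap.baseChangeHom k A V V) ∘ₗ c i)

lemma sliceOp_tmul {A : Type u} [CommRing A] [Algebra k A] (x : Fin r → A) (a : Λ) (s : A) (v : V) :
    sliceOp c x a (s ⊗ₜ v) = s ⊗ₜ (a • v) + ∑ i, (x i * s) ⊗ₜ (c i a v) := by
  simp [sliceOp, LinearMap.sum_apply, TensorProduct.smul_tmul']

section Relations

variable {A B : Type u} [CommRing A] [Algebra k A] [CommRing B] [Algebra k B] {d : ℕ}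
  (b : Module.Basis (Fin d) k V)

/-- The coordinates of the defect of multiplicativity of `a ↦ a + ∑ xᵢ cᵢ(a)`. -/
noncomputable def mulDefect (x : Fin r → A) (a a' : Λ) (v : V) (m : Fin d) : A :=
  ∑ i, b.repr (c i (a * a') v - c i a (a' • v) - a • c i a' v) m • x i -
    ∑ i, ∑ j, b.repr (c j a (c i a' v)) m • (x j * x i)

/-- The coordinates of the defect of unitality of `a ↦ a + ∑ xᵢ cᵢ(a)`. -/
noncomputable def oneDefect (x : Fin r → A) (v : V) (m : Fin d) : A :=
  ∑ i, b.repr (c i 1 v) m • x i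

lemma map_mulDefect (f : A →ₐ[k] B) (x : Fin r → A) (a a' : Λ) (v : V) (m : Fin d) :
    f (mulDefect c b x a a' v m) = mulDefect c b (fun i => f (x i)) a a' v m := by
  simp only [mulDefect, map_sub, map_sum, map_smul, map_mul]

lemma map_oneDefect (f : A →ₐ[k] B) (x : Fin r → A) (v : V) (m : Fin d) :
    f (oneDefect c b x v m) = oneDefect c b (fun i => f (x i)) v m := by
  simp only [oneDefect, map_sum, map_smul]

lemma repr_mulDefect (x : Fin r → A) (a a' : Λ) (v : V) (m : Fin d) :
    (b.baseChange A).repr (sliceOp c x (a * a') (1 ⊗ₜ v) - sliceOp c x a (sliceOp c x a' (1 ⊗ₜ v)))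
      m = mulDefect c b x a a' v m := by
  simp only [sliceOp_tmul, map_add, map_sum, map_sub, mulDefect, Finsupp.sub_apply,
    Finsupp.add_apply, Finsupp.finsetSum_apply, Module.Basis.baseChange_repr_tmul, mul_one,
    sub_smul, Finset.sum_sub_distrib, mul_smul, Finset.sum_add_distrib]
  abel

lemma repr_oneDefect (x : Fin r → A) (v : V) (m : Fin d) :
    (b.baseChange A).repr (sliceOp c x 1 (1 ⊗ₜ v) - 1 ⊗ₜ v) m = oneDefect c b x v m := by
  simp [sliceOp_tmul, oneDefect]

/-- The relations saying that `a ↦ a + ∑ xᵢ cᵢ(a)` is a representation. -/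
def IsSlicePoint (x : Fin r → A) : Prop :=
  (∀ a a' v m, mulDefect c b x a a' v m = 0) ∧ ∀ v m, oneDefect c b x v m = 0

variable {b} in
lemma isSlicePoint_iff (x : Fin r → A) : IsSlicePoint c b x ↔
    (∀ a a' v, sliceOp c x (a * a') (1 ⊗ₜ v) = sliceOp c x a (sliceOp c x a' (1 ⊗ₜ v))) ∧
      ∀ v, sliceOp c x 1 (1 ⊗ₜ v) = 1 ⊗ₜ v := by
  refine and_congr (forall₃_congr fun a a' v => ?_) (forall_congr' fun v => ?_)
  · rw [← sub_eq_zero, ← (b.baseChange A).repr.map_eq_zero_iff, Finsupp.ext_iff]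
    simp only [repr_mulDefect, Finsupp.zero_apply]
  · rw [← sub_eq_zero, ← (b.baseChange A).repr.map_eq_zero_iff, Finsupp.ext_iff]
    simp only [repr_oneDefect, Finsupp.zero_apply]

variable {c b} in
/-- The representation of `Λ` on `A ⊗ V` by the operators `a + ∑ xᵢ cᵢ(a)`. -/
noncomputable def IsSlicePoint.toRingHom {x : Fin r → A} (h : IsSlicePoint c b x) :
    Λ →+* Module.End A (A ⊗[k] V) where
  toFun := sliceOp c x
  map_one' := by
    ext v
    exact ((isSlicePoint_iff c x).1 h).2 v
  map_mul' a a' := by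
    ext v
    exact ((isSlicePoint_iff c x).1 h).1 a a' v
  map_zero' := map_zero _
  map_add' := map_add _

end Relations

variable {d : ℕ} {b : Module.Basis (Fin d) k V} {R : CHat k}

variable {c} in
/-- A point of the slice in `R` gives a lift of `V` over `R`. -/
lemma exists_lift_of_isSlicePoint {x : Fin r → R} (h : IsSlicePoint c b x) (hx : ∀ i, x i ∈ R.𝔪) :
    ∃ (L : Lift k Λ V R) (σ : V →ₗ[k] L), (∀ v, L.π (σ v) = v) ∧
      ∀ a v, a • σ v = σ (a • v) + ∑ i, x i • σ (c i a v) := by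
  let _ : Module Λ (R ⊗[k] V) := Module.compHom _ h.toRingHom
  have hact : ∀ (a : Λ) (t : R ⊗[k] V), a • t = sliceOp c x a t := fun _ _ => rfl
  have : SMulCommClass R Λ (R ⊗[k] V) := ⟨fun s a t => by
    rw [hact, hact, map_smul]⟩
  let q : R ⊗[k] V →ₗ[k] V := (TensorProduct.lid k V).toLinearMap ∘ₗ
    LinearMap.rTensor V R.aug.toLinearMap
  have hq : ∀ (s : R) v, q (s ⊗ₜ v) = R.aug s • v := fun s v => by simp [q]
  let p : R ⊗[k] V →ₗ[Λ] V :=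
    { q with
      map_smul' := fun a t => by
        change q (a • t) = a • q t
        induction t with
        | zero => simp
        | add t t' ht ht' => simp only [smul_add, map_add, ht, ht']
        | tmul s v =>
          rw [hact, sliceOp_tmul, map_add, map_sum, hq, hq]
          simp only [hq, map_mul, R.aug_eq_zero_iff.2 (hx _), zero_mul, zero_smul,
            Finset.sum_const_zero, add_zero]
          rw [← _root_.algebraMap_smul Λ (R.aug s), ← _root_.algebraMap_smul Λ (R.aug s),
            smul_smul, smul_smul, Algebra.commutes] }
  have hp : ∀ t, p t = q t := fun _ => rfl
  have : Module.Finite k V := Module.Finite.of_basis b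
  have hqs : ∀ (s : R) t, q (s • t) = R.aug s • q t := fun s t => by
    induction t with
    | zero => simp
    | add t t' ht ht' => simp only [smul_add, map_add, ht, ht']
    | tmul s' v => rw [TensorProduct.smul_tmul', hq, hq, smul_eq_mul, map_mul, mul_smul]
  have hsmul : ∀ (e : k) (t : R ⊗[k] V), algebraMap k R e • t = algebraMap k Λ e • t := by
    intro e t
    have h1 : sliceOp c x (1 : Λ) = 1 := h.toRingHom.map_one
    rw [hact, Algebra.algebraMap_eq_smul_one (A := Λ), map_smul, h1, _root_.algebraMap_smul]
    rfl
  let L : Lift k Λ V R := ofπ (R ⊗[k] V) hsmul p (fun v => ⟨1 ⊗ₜ v, by rw [hp, hq]; simp⟩) (by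
    intro t
    rw [hp]
    constructor
    · intro h0
      have ht := (b.baseChange R).sum_repr t
      rw [← ht] at h0 ⊢
      simp only [map_sum, hqs, Module.Basis.baseChange_apply, hq, map_one, one_smul] at h0
      have := Fintype.linearIndependent_iff.1 b.linearIndependent _ h0
      exact Submodule.sum_mem _ fun i _ =>
        Submodule.smul_mem_smul (R.aug_eq_zero_iff.1 (this i)) trivial
    · intro h0
      induction h0 using Submodule.smul_induction_on' with
      | smul r hr y _ => rw [hqs, R.aug_eq_zero_iff.2 hr, zero_smul]
      | add x _ y _ hx hy => rw [map_add, hx, hy, add_zero])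
  have hL : ∀ t : R ⊗[k] V, L.π t = p t := fun t => ofπ_π _ _ _ _ _ t
  let σ : V →ₗ[k] L :=
    { toFun := fun v => (1 : R) ⊗ₜ[k] v
      map_add' := fun v w => TensorProduct.tmul_add _ _ _
      map_smul' := fun e v => by
        change (1 : R) ⊗ₜ[k] (e • v) = algebraMap k R e • ((1 : R) ⊗ₜ[k] v)
        rw [_root_.algebraMap_smul, TensorProduct.tmul_smul] }
  refine ⟨L, σ, fun v => ?_, fun a v => ?_⟩
  · change L.π ((1 : R) ⊗ₜ[k] v) = v
    rw [hL, hp, hq, map_one, one_smul]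
  · change sliceOp c x a ((1 : R) ⊗ₜ[k] v) =
      (1 : R) ⊗ₜ[k] (a • v) + ∑ i, x i • ((1 : R) ⊗ₜ[k] (c i a v))
    rw [sliceOp_tmul]
    simp only [TensorProduct.smul_tmul', smul_eq_mul]

end Slice

end Lift

/-! ### Existence of versal deformations -/

lemma CHat.dual_maximalIdeal_sq (k : Type u) [Field k] {a : CHat.dual k}
    (h : a ∈ (CHat.dual k).𝔪 ^ 2) : a = 0 := by
  have h2 : (IsLocalRing.maximalIdeal (DualNumber k)) ^ 2 = ⊥ := by
    rw [DualNumber.maximalIdeal_eq_span_singleton_eps, Ideal.span_singleton_pow, pow_two,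
      DualNumber.eps_mul_eps, Ideal.span_singleton_eq_bot]
  have h3 : a ∈ (IsLocalRing.maximalIdeal (DualNumber k)) ^ 2 := h
  rw [h2] at h3
  exact h3

/-- A basis of a complement of `B`: every vector is a combination of the `c i` modulo `B`, and no
nontrivial combination lies in `B`. -/
lemma exists_complement_basis {k W : Type*} [Field k] [AddCommGroup W] [Module k W]
    [Module.Finite k W] (B : Submodule k W) : ∃ (r : ℕ) (c : Fin r → W),
      (∀ h, ∃ b ∈ B, ∃ y : Fin r → k, h = b + ∑ i, y i • c i) ∧
        ∀ b ∈ B, ∀ z : Fin r → k, b = ∑ i, z i • c i → z = 0 := by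
  obtain ⟨C, hC⟩ := B.exists_isCompl
  let bC := Module.finBasis k C
  refine ⟨_, fun i => bC i, fun h => ?_, fun b hb z h => ?_⟩
  · have : h ∈ B ⊔ C := hC.sup_eq_top ▸ trivial
    obtain ⟨b, hb, w, hw, rfl⟩ := Submodule.mem_sup.1 this
    refine ⟨b, hb, bC.repr ⟨w, hw⟩, ?_⟩
    have := congrArg C.subtype (bC.sum_repr ⟨w, hw⟩)
    rw [map_sum] at this
    simp only [map_smul] at this
    rw [add_right_inj]
    exact this.symm
  · have h1 : b ∈ C := h ▸ Submodule.sum_mem _ fun i _ => C.smul_mem _ (bC i).2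
    have h2 : b = 0 := Submodule.disjoint_def.1 hC.disjoint _ hb h1
    have h3 : ∑ i, z i • bC i = 0 := Subtype.ext (by
      rw [← C.subtype_apply, map_sum]; simp only [map_smul]; exact h.symm.trans h2)
    exact funext fun i => Fintype.linearIndependent_iff.1 bC.linearIndependent _ h3 i

namespace Lift

variable {k : Type u} [Field k] {Λ : Type u} [Ring Λ] [Algebra k Λ]
  {V : Type u} [AddCommGroup V] [Module Λ V] [Module k V] [IsScalarTower k Λ V]
  {r : ℕ} {c : Fin r → Λ →ₗ[k] V →ₗ[k] V} {d : ℕ} {b : Module.Basis (Fin d) k V} {R S : CHat k}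

/-- The lift `R ⊗ V` with the undeformed action. -/
lemma exists_trivial [Module.Finite k V] : Nonempty (Lift k Λ V R) := by
  obtain ⟨L, -⟩ := exists_lift_of_isSlicePoint (c := (fun i => i.elim0 : Fin 0 → Λ →ₗ[k] V →ₗ[k] V))
    (b := Module.finBasis k V) (x := fun i => i.elim0) (R := R)
    ⟨by simp [mulDefect], by simp [oneDefect]⟩ (fun i => i.elim0)
  exact ⟨L⟩

/-- If the action of `Λ` on a lift is given by the operators `a + ∑ xᵢ cᵢ(a)`, then these operators
form a representation. -/
lemma isSlicePoint_of_slice (L : Lift k Λ V S) {σ : V →ₗ[k] L} (hσ : ∀ v, L.π (σ v) = v)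
    {x : Fin r → S} (h : ∀ a v, a • σ v = σ (a • v) + ∑ i, x i • σ (c i a v)) :
    IsSlicePoint c b x := by
  obtain ⟨e, he⟩ := L.exists_basis hσ b
  let τ : S ⊗[k] V ≃ₗ[S] L := (b.baseChange S).equiv e (Equiv.refl _)
  have hτ : ∀ v, τ (1 ⊗ₜ v) = σ v := by
    let τ' : V →ₗ[k] L :=
      { toFun := fun v => τ (1 ⊗ₜ v)
        map_add' := fun v w => by rw [TensorProduct.tmul_add, map_add]
        map_smul' := fun t v => by
          rw [TensorProduct.tmul_smul, ← _root_.algebraMap_smul S t, map_smul]; rfl }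
    have : τ' = σ := b.ext fun i => by
      change τ (1 ⊗ₜ b i) = _
      rw [← Module.Basis.baseChange_apply, Module.Basis.equiv_apply, Equiv.refl_apply, he]
    exact fun v => LinearMap.congr_fun this v
  have hop : ∀ a t, τ (sliceOp c x a t) = a • τ t := by
    intro a t
    induction t with
    | zero => simp
    | add t t' ht ht' => simp only [map_add, smul_add, ht, ht']
    | tmul s v =>
      have h1 : ∀ (s : S) (v : V), s ⊗ₜ[k] v = s • ((1 : S) ⊗ₜ[k] v) := fun s v => by
        rw [TensorProduct.smul_tmul', smul_eq_mul, mul_one]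
      rw [h1, map_smul, sliceOp_tmul, map_smul, map_smul, map_add, map_sum, hτ, ← smul_comm s a, hτ,
        h]
      simp only [mul_one]
      congr 2
      exact Finset.sum_congr rfl fun i _ => by rw [h1, map_smul, hτ]
  refine (isSlicePoint_iff c x).2 ⟨fun a a' v => τ.injective ?_, fun v => τ.injective ?_⟩
  · rw [hop, hop, hop, mul_smul]
  · rw [hop, one_smul]

/-- Modulo `𝔪 ^ 2` the coordinates of a lift in the slice are unique. -/
lemma slice_unique (L : Lift k Λ V S) {σ τ : V →ₗ[k] L} (hσ : ∀ v, L.π (σ v) = v)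
    (hτ : ∀ v, L.π (τ v) = v) {x y : Fin r → S} (hx : ∀ i, x i ∈ S.𝔪) (hy : ∀ i, y i ∈ S.𝔪)
    (h : ∀ a v, a • σ v = σ (a • v) + ∑ i, x i • σ (c i a v))
    (h' : ∀ a v, a • τ v = τ (a • v) + ∑ i, y i • τ (c i a v))
    (hc : ∀ (Z : V →ₗ[k] V) (z : Fin r → k),
      innerDerivation k Λ V V Z = ∑ i, z i • c i → z = 0) (i : Fin r) :
    x i - y i ∈ S.𝔪 ^ 2 := by
  obtain ⟨q, a, l, ha, hl, hal⟩ := S.exists_graded_coordinates 1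
  have hxy : x i - y i ∈ S.𝔪 ^ 1 := by rw [pow_one]; exact sub_mem (hx i) (hy i)
  have hst : ∀ v, σ v - τ v ∈ S.𝔪 ^ 1 • (⊤ : Submodule S L) := fun v => by
    rw [pow_one, ← π_eq_zero_iff, map_sub, hσ, hτ, sub_self]
  have hx1 : ∀ i, x i ∈ S.𝔪 ^ 1 := fun i => by rw [pow_one]; exact hx i
  have hy1 : ∀ i, y i ∈ S.𝔪 ^ 1 := fun i => by rw [pow_one]; exact hy i
  have h0 : ∀ j, l j (x i - y i) = 0 := fun j => by
    have := hc (L.coeff (l j) ∘ₗ (σ - τ)) (fun i => l j (x i - y i)) (by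
      ext a v
      rw [innerDerivation_apply]
      simp only [LinearMap.comp_apply, LinearMap.sub_apply, LinearMap.sum_apply,
        LinearMap.smul_apply]
      rw [← L.coeff_alg_smul (hl j) a (hst v), smul_sub, h, h', ← map_sub]
      have e : σ (a • v) + ∑ i, x i • σ (c i a v) - (τ (a • v) + ∑ i, y i • τ (c i a v)) -
          (σ (a • v) - τ (a • v)) = ∑ i, (x i • σ (c i a v) - y i • τ (c i a v)) := by
        rw [Finset.sum_sub_distrib]; abel
      rw [e, map_sum]
      refine Finset.sum_congr rfl fun i _ => ?_
      rw [map_sub, L.coeff_smul (hl j) (hx1 i), L.coeff_smul (hl j) (hy1 i), hσ, hτ, map_sub,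
        sub_smul])
    exact congrFun this i
  have := hal _ hxy
  simpa [h0] using this

variable [Module.Finite k Λ]

variable (k Λ V) in
/-- Every finite-dimensional module has a versal deformation: by successive approximation each lift
can be moved into a slice transversal to the orbits of the group of base changes. -/
theorem exists_isVersal [Module.Finite k V] : ∃ (R : CHat k) (U : Lift k Λ V R), U.IsVersal := by
  obtain ⟨r, c, hc1', hc2'⟩ :=
    exists_complement_basis (LinearMap.range (innerDerivation k Λ V V))
  have hc1 : ∀ h : Λ →ₗ[k] V →ₗ[k] V, ∃ (Z : V →ₗ[k] V) (y : Fin r → k),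
      h = innerDerivation k Λ V V Z + ∑ i, y i • c i := by
    intro h
    obtain ⟨_, ⟨Z, rfl⟩, y, hy⟩ := hc1' h
    exact ⟨Z, y, hy⟩
  have hc2 : ∀ (Z : V →ₗ[k] V) (z : Fin r → k),
      innerDerivation k Λ V V Z = ∑ i, z i • c i → z = 0 :=
    fun Z z h => hc2' _ ⟨Z, rfl⟩ z h
  let b := Module.finBasis k V
  let X : Fin r → MvPolynomial (Fin r) k := MvPolynomial.X
  let T : Set (MvPolynomial (Fin r) k) :=
    {p | (∃ a a' v m, p = mulDefect c b X a a' v m) ∨ ∃ v m, p = oneDefect c b X v m}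
  have hT : ∀ {A : Type u} [CommRing A] [Algebra k A] (f : MvPolynomial (Fin r) k →ₐ[k] A),
      (∀ p ∈ T, f p = 0) ↔ IsSlicePoint c b (fun i => f (X i)) := by
    intro A _ _ f
    constructor
    · intro h
      exact ⟨fun a a' v m => by rw [← map_mulDefect]; exact h _ (Or.inl ⟨a, a', v, m, rfl⟩),
        fun v m => by rw [← map_oneDefect]; exact h _ (Or.inr ⟨v, m, rfl⟩)⟩
    · rintro ⟨h1, h2⟩ p (⟨a, a', v, m, rfl⟩ | ⟨v, m, rfl⟩)
      · rw [map_mulDefect, h1]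
      · rw [map_oneDefect, h2]
  let coe : MvPolynomial (Fin r) k →ₐ[k] MvPowerSeries (Fin r) k :=
    MvPolynomial.coeToMvPowerSeries.algHom k
  have hcoe : ∀ p, coe p = (p : MvPowerSeries (Fin r) k) := fun p => by simp [coe]
  let J : Ideal (MvPowerSeries (Fin r) k) :=
    Ideal.span ((fun p : MvPolynomial (Fin r) k => (p : MvPowerSeries (Fin r) k)) '' T)
  have hJ : J ≠ ⊤ := by
    let g : MvPowerSeries (Fin r) k →ₐ[k] k := (CHat.powerSeries k r).aug
    have hg : ∀ i, g (coe (X i)) = 0 := fun i => (CHat.powerSeries k r).aug_eq_zero_iff.2 (by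
      change coe (X i) ∈ IsLocalRing.maximalIdeal (MvPowerSeries (Fin r) k)
      rw [maximalIdeal_mvPowerSeries]
      exact Ideal.subset_span ⟨i, by rw [hcoe, MvPolynomial.coe_X]⟩)
    have h0 := (hT (g.comp coe)).2 (by
      simp only [AlgHom.comp_apply, hg]
      exact ⟨by simp [mulDefect], by simp [oneDefect]⟩)
    have hle : J ≤ RingHom.ker g := by
      rw [Ideal.span_le]
      rintro _ ⟨p, hp, rfl⟩
      have := h0 p hp
      rwa [AlgHom.comp_apply, hcoe] at this
    exact fun h => RingHom.ker_ne_top g (top_le_iff.1 (h ▸ hle))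
  let R := CHat.powerSeriesQuotient J hJ
  let x : Fin r → R := CHat.powerSeriesVar J hJ
  have hxm : ∀ i, x i ∈ R.𝔪 := fun i => by
    rw [← CHat.powerSeriesVar_span]; exact Ideal.subset_span ⟨i, rfl⟩
  have hx : IsSlicePoint c b x := by
    let f : MvPolynomial (Fin r) k →ₐ[k] MvPowerSeries (Fin r) k ⧸ J :=
      (Ideal.Quotient.mkₐ k J).comp coe
    have h1 := (hT f).1 fun p hp => by
      refine Ideal.Quotient.eq_zero_iff_mem.2 (Ideal.subset_span ⟨p, hp, ?_⟩)
      exact (hcoe p).symm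
    have h2 : ∀ i, f (X i) = x i := fun i => by
      change Ideal.Quotient.mk J (coe (X i)) = Ideal.Quotient.mk J (MvPowerSeries.X i)
      rw [hcoe, MvPolynomial.coe_X]
    have h3 : (fun i => f (X i)) = x := funext h2
    rw [h3] at h1
    exact h1
  obtain ⟨U, σ, hσ, hU⟩ := exists_lift_of_isSlicePoint hx hxm
  refine ⟨R, U, (isVersal_iff U).2 ⟨fun S L => ?_, fun L ψ χ hψ hχ => ?_⟩⟩
  · obtain ⟨τ, y, hτ, hy, hL⟩ := exists_slice c hc1 L
    have hpt : IsSlicePoint c b y := L.isSlicePoint_of_slice hτ hL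
    obtain ⟨ψ, hψ⟩ := CHat.exists_powerSeriesQuotient_hom (hJ := hJ) rfl S y hy ((hT _).2 (by
      simpa [X] using hpt))
    obtain ⟨u, hu, huσ⟩ := U.exists_semilinear hσ ψ τ
    refine ⟨ψ, mapsTo_of_section hσ u hu (fun a v => ?_) fun v => by rw [huσ, hτ]⟩
    rw [hU, map_add, map_sum, huσ, huσ, hL]
    congr 1
    exact Finset.sum_congr rfl fun i _ => by rw [hu, huσ, hψ]
  · have key : ∀ ψ : R ⟶ CHat.dual k, MapsTo ψ U L → ∃ τ : V →ₗ[k] L, (∀ v, L.π (τ v) = v) ∧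
        ∀ a v, a • τ v = τ (a • v) + ∑ i, ψ.toAlgHom (x i) • τ (c i a v) := by
      rintro ψ ⟨u, h1, h2, h3⟩
      let τ : V →ₗ[k] L :=
        { toFun := fun v => u (σ v)
          map_add' := fun v w => by rw [map_add, map_add]
          map_smul' := fun t v => by
            rw [map_smul, ← algebraMap_smul, h1, AlgHom.commutes]; rfl }
      refine ⟨τ, fun v => (h3 _).trans (hσ v), fun a v => ?_⟩
      change a • u (σ v) = u (σ (a • v)) + ∑ i, ψ.toAlgHom (x i) • u (σ (c i a v))
      simp only [← h2, hU, map_add, map_sum, h1]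
    obtain ⟨τ, hτ, h1⟩ := key ψ hψ
    obtain ⟨τ', hτ', h1'⟩ := key χ hχ
    refine CHat.hom_ext_of_span x CHat.powerSeriesVar_span.ge (fun i => ?_) hxm
    rw [← sub_eq_zero]
    exact CHat.dual_maximalIdeal_sq k (L.slice_unique hτ hτ' (fun i => CHat.map_mem ψ (hxm i))
      (fun i => CHat.map_mem χ (hxm i)) h1 h1' hc2 i)

end Lift

/-! ### Lifting homomorphisms -/

section Derivations

variable (k : Type u) [Field k] (Λ : Type u) [Ring Λ] [Algebra k Λ]
  (A B : Type u) [AddCommGroup A] [Module k A] [Module Λ A] [IsScalarTower k Λ A]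
  [AddCommGroup B] [Module k B] [Module Λ B] [IsScalarTower k Λ B]

/-- Every derivation of `Λ` in `Hom_k(A, B)` is inner, that is, `Ext¹_Λ(A, B) = 0`. -/
def DerivationsInner : Prop :=
  ∀ D : Λ →ₗ[k] A →ₗ[k] B, (∀ a a' x, D (a * a') x = a • D a' x + D a (a' • x)) →
    ∃ Z, D = innerDerivation k Λ A B Z

end Derivations

namespace Lift

variable {k : Type u} [Field k] {Λ : Type u} [Ring Λ] [Algebra k Λ]
  {A B : Type u} [AddCommGroup A] [Module k A] [Module Λ A] [IsScalarTower k Λ A]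
  [AddCommGroup B] [Module k B] [Module Λ B] [IsScalarTower k Λ B] {S : CHat k}
  [Module.Finite k A]

/-- Linear maps extend to lifts, regardless of the action of `Λ`. -/
lemma exists_linearMap_lift (M : Lift k Λ A S) (N : Lift k Λ B S) (Z : A →ₗ[k] B) :
    ∃ F : M →ₗ[S] N, ∀ x, N.π (F x) = Z (M.π x) := by
  obtain ⟨σ, hσ⟩ := M.exists_section
  obtain ⟨τ, hτ⟩ := N.exists_section
  obtain ⟨u, hu, huσ⟩ := M.exists_semilinear hσ (𝟙 S) (τ ∘ₗ Z)
  let F : M →ₗ[S] N := { u with map_smul' := hu }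
  refine ⟨F, fun x => ?_⟩
  have h1 := apply_mem_pow_smul F (M.sub_section_mem hσ x)
  rw [← π_eq_zero_iff, map_sub, map_sub, sub_eq_zero] at h1
  rw [h1]
  have : F (σ (M.π x)) = τ (Z (M.π x)) := huσ _
  rw [this, hτ]

/-- If `Ext¹(A, B) = 0`, then homomorphisms `A → B` extend to homomorphisms between lifts. -/
theorem exists_hom_lift (hAB : DerivationsInner k Λ A B) (M : Lift k Λ A S) (N : Lift k Λ B S)
    (f : A →ₗ[Λ] B) : ∃ F : M →ₗ[S] N, (∀ (a : Λ) x, F (a • x) = a • F x) ∧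
      ∀ x, N.π (F x) = f (M.π x) := by
  obtain ⟨σ, hσ⟩ := M.exists_section
  obtain ⟨τ, hτ⟩ := N.exists_section
  obtain ⟨F₀, hF₀⟩ := exists_linearMap_lift M N (f.restrictScalars k)
  let Q : ℕ → (M →ₗ[S] N) → Prop := fun t F => (∀ x, N.π (F x) = f (M.π x)) ∧
    ∀ (a : Λ) x, a • F x - F (a • x) ∈ S.𝔪 ^ t • (⊤ : Submodule S N)
  have hev : ∀ {t} {F G : M →ₗ[S] N}, G - F ∈ S.𝔪 ^ t • (⊤ : Submodule S (M →ₗ[S] N)) →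
      ∀ x, G x - F x ∈ S.𝔪 ^ t • (⊤ : Submodule S N) := fun h x =>
    apply_mem_pow_smul (LinearMap.applyₗ x) h
  have hbase : ∀ {t}, 1 ≤ t → ∀ {F G : M →ₗ[S] N},
      G - F ∈ S.𝔪 ^ t • (⊤ : Submodule S (M →ₗ[S] N)) →
      (∀ x, N.π (F x) = f (M.π x)) → ∀ x, N.π (G x) = f (M.π x) := fun ht F G h h1 x => by
    have := S.pow_smul_antitone ht (hev h x)
    rw [pow_one, ← π_eq_zero_iff, map_sub, sub_eq_zero] at this
    rw [this, h1]
  have hex : ∃ F, F - F₀ ∈ S.𝔪 • (⊤ : Submodule S (M →ₗ[S] N)) ∧ ∀ t, 1 ≤ t → Q t F := by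
    refine S.exists_of_successive Q ?_ F₀ ?_ ?_
    · rintro t ht F G ⟨h1, h2⟩ h
      refine ⟨hbase ht h h1, fun a x => ?_⟩
      have e : a • G x - G (a • x) =
          (a • F x - F (a • x)) + (a • (G x - F x) - (G (a • x) - F (a • x))) := by
        rw [smul_sub]; abel
      rw [e]
      exact add_mem (h2 a x) (sub_mem (N.alg_smul_mem a (hev h x)) (hev h _))
    · refine ⟨hF₀, fun a x => ?_⟩
      rw [pow_one, ← π_eq_zero_iff, map_sub, map_smul, hF₀, hF₀, map_smul, sub_eq_zero]
      exact (map_smul f a _).symm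
    · rintro t ht F ⟨h1, h2⟩
      obtain ⟨q, c, l, hc, hl, hcl⟩ := S.exists_graded_coordinates t
      have hFk : ∀ (e : k) (x : M), F (e • x) = e • F x := fun e x => by
        rw [← algebraMap_smul, map_smul]; rfl
      -- the leading coefficients of the error are derivations
      let E : Λ →ₗ[k] A →ₗ[k] N := LinearMap.mk₂ k (fun a v => a • F (σ v) - F (a • σ v))
        (fun a b v => by simp only [add_smul, map_add]; abel)
        (fun e a v => by simp only [smul_assoc, hFk, smul_sub])
        (fun a v w => by simp only [map_add, smul_add]; abel)
        (fun e a v => by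
          simp only [map_smul, hFk, smul_sub, smul_comm a e])
      have hEx : ∀ j a (x : M),
          N.coeff (l j) (a • F x - F (a • x)) = N.coeff (l j) (E a (M.π x)) := by
        intro j a x
        rw [← sub_eq_zero, ← map_sub]
        have hD : ∀ y ∈ S.𝔪 • (⊤ : Submodule S M),
            a • F y - F (a • y) ∈ S.𝔪 ^ (t + 1) • (⊤ : Submodule S N) := by
          intro y hy
          induction hy using Submodule.smul_induction_on' with
          | smul s hs y _ =>
            rw [← smul_comm s a y, map_smul, map_smul, ← smul_comm s a, ← smul_sub]
            exact smul_mem_pow_succ' hs (h2 a y)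
          | add y _ z _ hy hz =>
            have := add_mem hy hz
            rw [smul_add, map_add, map_add, smul_add]
            rwa [add_sub_add_comm]
        have e : a • F x - F (a • x) - E a (M.π x) =
            a • F (x - σ (M.π x)) - F (a • (x - σ (M.π x))) := by
          simp only [E, LinearMap.mk₂_apply, map_sub, smul_sub]; abel
        rw [e]
        exact N.coeff_eq_zero (hl j) (hD _ (M.sub_section_mem hσ x))
      choose Z hZ using fun j => hAB (E.compr₂ (N.coeff (l j))) (fun a b v => by
        simp only [LinearMap.compr₂_apply]
        have h3 := hEx j a (b • σ v)
        rw [M.π.map_smul, hσ] at h3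
        change _ = a • N.coeff (l j) (b • F (σ v) - F (b • σ v)) + N.coeff (l j) (E a (b • v))
        rw [← h3, ← N.coeff_alg_smul (hl j) a (h2 b (σ v)), ← map_add]
        congr 1
        simp only [E, LinearMap.mk₂_apply, mul_smul, smul_sub]
        abel)
      choose G hG using fun j => exists_linearMap_lift M N (Z j)
      have hm : (∑ j, c j • G j) ∈ S.𝔪 ^ t • (⊤ : Submodule S (M →ₗ[S] N)) :=
        Submodule.sum_mem _ fun j _ => Submodule.smul_mem_smul (hc j) trivial
      have hm' : (F - ∑ j, c j • G j) - F ∈ S.𝔪 ^ t • (⊤ : Submodule S (M →ₗ[S] N)) := by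
        rw [sub_sub_cancel_left]; exact neg_mem hm
      refine ⟨F - ∑ j, c j • G j, hm', hbase ht hm' h1, fun a x => ?_⟩
      have h4 := N.sub_sum_coeff_mem hτ hl hc hcl (h2 a x)
      have e : a • (F - ∑ j, c j • G j) x - (F - ∑ j, c j • G j) (a • x) =
          ((a • F x - F (a • x)) - ∑ j, c j • τ (N.coeff (l j) (a • F x - F (a • x)))) -
            ∑ j, c j • ((a • G j x - G j (a • x)) - τ (N.coeff (l j) (a • F x - F (a • x)))) := by
        have e3 : ∀ j (w : N), a • c j • w = c j • a • w := fun j w => (smul_comm _ _ _).symm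
        simp only [LinearMap.sub_apply, LinearMap.sum_apply, LinearMap.smul_apply, smul_sub,
          Finset.smul_sum, Finset.sum_sub_distrib, e3]
        abel
      rw [e]
      refine sub_mem h4 (Submodule.sum_mem _ fun j _ => smul_mem_pow_succ (hc j) ?_)
      rw [← π_eq_zero_iff, map_sub, hτ, map_sub, map_smul, hG, hG, hEx, map_smul, sub_eq_zero]
      exact (LinearMap.congr_fun (LinearMap.congr_fun (hZ j) a) (M.π x)).symm
  obtain ⟨F, -, hF⟩ := hex
  refine ⟨F, fun a x => ?_, (hF 1 le_rfl).1⟩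
  symm
  rw [← sub_eq_zero]
  exact S.eq_zero_of_mem_pow_smul fun n =>
    S.pow_smul_antitone (Nat.le_succ n) ((hF (n + 1) (by omega)).2 a x)

end Lift

/-! ### Vanishing of Ext for Gorenstein-projective modules -/

section Derivations

variable {k : Type u} [Field k] {Λ : Type u} [Ring Λ] [Algebra k Λ]
  {A A' B : Type u} [AddCommGroup A] [Module k A] [Module Λ A] [IsScalarTower k Λ A]
  [AddCommGroup A'] [Module k A'] [Module Λ A'] [IsScalarTower k Λ A']
  [AddCommGroup B] [Module k B] [Module Λ B] [IsScalarTower k Λ B]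

lemma derivationsInner_iff : DerivationsInner k Λ A B ↔
    ∀ D : Λ →ₗ[k] A →ₗ[k] B, (∀ a a' x, D (a * a') x = a • D a' x + D a (a' • x)) →
      ∃ Z : A →ₗ[k] B, ∀ a x, D a x = a • Z x - Z (a • x) := by
  refine forall₂_congr fun D _ => exists_congr fun Z => ?_
  constructor
  · rintro rfl a x
    rw [innerDerivation_apply]
  · intro h
    ext a x
    rw [h, innerDerivation_apply]

/-- `Ext¹(A, B) = 0` for projective `A`. -/
lemma DerivationsInner.of_projective [Module.Projective Λ A] : DerivationsInner k Λ A B := by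
  rw [derivationsInner_iff]
  intro D hD
  obtain ⟨s, hs⟩ := Module.projective_def'.1 (inferInstance : Module.Projective Λ A)
  let Z₀ : (A →₀ Λ) →ₗ[k] B := Finsupp.lsum k fun x => D.flip x
  have hZ₀ : ∀ (a : Λ) (y : A →₀ Λ),
      Z₀ (a • y) = a • Z₀ y + D a (Finsupp.linearCombination Λ id y) := by
    intro a y
    induction y using Finsupp.induction_linear with
    | zero => simp
    | add y z hy hz => simp only [smul_add, map_add, hy, hz]; abel
    | single x b =>
      have := hD a b x
      simp only [Finsupp.smul_single, smul_eq_mul, Finsupp.linearCombination_single, id_eq]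
      rw [Finsupp.lsum_single, Finsupp.lsum_single]
      exact this
  refine ⟨-(Z₀ ∘ₗ s.restrictScalars k), fun a x => ?_⟩
  have h := hZ₀ a (s x)
  rw [show Finsupp.linearCombination Λ id (s x) = x from LinearMap.congr_fun hs x] at h
  simp only [LinearMap.neg_apply, LinearMap.comp_apply, LinearMap.restrictScalars_apply, map_smul,
    h, smul_neg]
  abel

lemma DerivationsInner.prod (h : DerivationsInner k Λ A B) (h' : DerivationsInner k Λ A' B) :
    DerivationsInner k Λ (A × A') B := by
  rw [derivationsInner_iff] at *
  intro D hD
  obtain ⟨Z, hZ⟩ := h ((LinearMap.lcomp k B (LinearMap.inl k A A')) ∘ₗ D)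
    fun a a' x => by simp [hD]
  obtain ⟨Z', hZ'⟩ := h' ((LinearMap.lcomp k B (LinearMap.inr k A A')) ∘ₗ D)
    fun a a' x => by simp [hD]
  refine ⟨Z.coprod Z', fun a x => ?_⟩
  have h1 := hZ a x.1
  have h2 := hZ' a x.2
  simp only [LinearMap.comp_apply, LinearMap.lcomp_apply, LinearMap.inl_apply,
    LinearMap.inr_apply] at h1 h2
  have e : x = (x.1, 0) + (0, x.2) := by simp
  conv_lhs => rw [e]
  rw [map_add, h1, h2]
  simp only [LinearMap.coprod_apply, smul_add, Prod.smul_fst, Prod.smul_snd]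
  abel

lemma DerivationsInner.of_retract (h : DerivationsInner k Λ A B) (i : A' →ₗ[Λ] A) (r : A →ₗ[Λ] A')
    (hri : ∀ x, r (i x) = x) : DerivationsInner k Λ A' B := by
  rw [derivationsInner_iff] at *
  intro D hD
  obtain ⟨Z, hZ⟩ := h ((LinearMap.lcomp k B (r.restrictScalars k)) ∘ₗ D)
    fun a a' x => by simp [hD]
  refine ⟨Z ∘ₗ i.restrictScalars k, fun a x => ?_⟩
  have := hZ a (i x)
  simpa [hri] using this

/-- If `Ext¹(A, B) = 0`, homomorphisms to `B` extend from the kernel of a surjection `P → A`. -/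
lemma DerivationsInner.exists_extension (h : DerivationsInner k Λ A B) (p : A' →ₗ[Λ] A)
    (hp : Function.Surjective p) (g : LinearMap.ker p →ₗ[Λ] B) :
    ∃ G : A' →ₗ[Λ] B, ∀ x : LinearMap.ker p, G x = g x := by
  rw [derivationsInner_iff] at h
  obtain ⟨σ, hσ'⟩ := LinearMap.exists_rightInverse_of_surjective (p.restrictScalars k)
    (LinearMap.range_eq_top.2 hp)
  have hσ : ∀ v, p (σ v) = v := fun v => LinearMap.congr_fun hσ' v
  have hcomm : ∀ {C : Type u} [AddCommGroup C] [Module k C] [Module Λ C] [IsScalarTower k Λ C]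
      (e : k) (a : Λ) (y : C), a • e • y = e • a • y := fun e a y => by
    rw [← _root_.algebraMap_smul Λ e y, smul_smul, ← Algebra.commutes, ← smul_smul,
      _root_.algebraMap_smul]
  let c : Λ → A → LinearMap.ker p := fun a v => ⟨a • σ v - σ (a • v), by simp [hσ]⟩
  let D : Λ →ₗ[k] A →ₗ[k] B := LinearMap.mk₂ k (fun a v => g (c a v))
    (fun a b v => (congrArg g (Subtype.ext (by
      simp only [c, add_smul, map_add, Submodule.coe_add]; abel))).trans (g.map_add _ _))
    (fun e a v => (congrArg g (Subtype.ext (by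
      simp only [c, smul_assoc, map_smul, smul_sub, Submodule.coe_smul_of_tower]))).trans
        (g.map_smul_of_tower e _))
    (fun a v w => (congrArg g (Subtype.ext (by
      simp only [c, smul_add, map_add, Submodule.coe_add]; abel))).trans (g.map_add _ _))
    (fun e a v => (congrArg g (Subtype.ext (by
      simp only [c, map_smul, smul_sub, Submodule.coe_smul_of_tower, hcomm]))).trans
        (g.map_smul_of_tower e _))
  obtain ⟨Z, hZ⟩ := h D (fun a b v => by
    change g (c (a * b) v) = a • g (c b v) + g (c a (b • v))
    rw [← map_smul, ← map_add]
    refine congrArg g (Subtype.ext ?_)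
    simp only [c, Submodule.coe_add, Submodule.coe_smul, smul_sub, mul_smul]
    abel)
  let G₀ : A' →ₗ[k] B :=
    (g.restrictScalars k) ∘ₗ LinearMap.codRestrict ((LinearMap.ker p).restrictScalars k)
      (LinearMap.id - σ ∘ₗ p.restrictScalars k) (fun x => by simp [hσ]) + Z ∘ₗ p.restrictScalars k
  have hG₀ : ∀ x, G₀ x = g ⟨x - σ (p x), by simp [hσ]⟩ + Z (p x) := fun x => rfl
  refine ⟨{ G₀ with map_smul' := fun a x => ?_ }, fun x => ?_⟩
  · change G₀ (a • x) = a • G₀ x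
    have h1 : g (c a (p x)) = a • Z (p x) - Z (a • p x) := hZ a (p x)
    have h2 : (⟨a • x - σ (p (a • x)), by simp [hσ]⟩ : LinearMap.ker p) =
        a • ⟨x - σ (p x), by simp [hσ]⟩ + c a (p x) := by
      refine Subtype.ext ?_
      simp only [c, Submodule.coe_add, Submodule.coe_smul, smul_sub, map_smul]
      abel
    rw [hG₀, hG₀, h2, map_add, h1, map_smul g, smul_add, map_smul p]
    abel
  · change G₀ x = g x
    rw [hG₀]
    have hx : p x = 0 := x.2
    simp [hx]

end Derivations

section GorensteinProjective

variable {k : Type u} [Field k] {Λ : Type u} [Ring Λ] [Algebra k Λ]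

/-- The restriction of a `Λ`-module to the ground field. -/
abbrev restrictModule (k : Type u) [Field k] (Λ : Type u) [Ring Λ] [Algebra k Λ] (M : Type u)
    [AddCommGroup M] [Module Λ M] : Module k M :=
  Module.compHom M (algebraMap k Λ)

lemma restrictModule_isScalarTower (M : Type u) [AddCommGroup M] [Module Λ M] :
    letI := restrictModule k Λ M
    IsScalarTower k Λ M :=
  letI := restrictModule k Λ M
  ⟨fun c a x => by rw [Algebra.smul_def, mul_smul]; rfl⟩

/-- If `A → B → C` stays exact at `B` under `Hom(-, Λ)`, it does so under `Hom(-, K)` for every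
finitely generated projective `K`. -/
lemma exists_extension_of_finite_projective {A B C : Type u} [AddCommGroup A] [Module Λ A]
    [AddCommGroup B] [Module Λ B] [AddCommGroup C] [Module Λ C] {a : A →ₗ[Λ] B} {b : B →ₗ[Λ] C}
    (hab : ∀ h : B →ₗ[Λ] Λ, h ∘ₗ a = 0 → ∃ h' : C →ₗ[Λ] Λ, h' ∘ₗ b = h)
    {K : Type u} [AddCommGroup K] [Module Λ K] [Module.Finite Λ K] [Module.Projective Λ K]
    (h : B →ₗ[Λ] K) (hh : h ∘ₗ a = 0) : ∃ h' : C →ₗ[Λ] K, h' ∘ₗ b = h := by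
  obtain ⟨n, f, g, -, -, hfg⟩ := Module.Finite.exists_comp_eq_id_of_projective Λ K
  choose c hc using fun j => hab (LinearMap.proj j ∘ₗ g ∘ₗ h) (by
    rw [LinearMap.comp_assoc, LinearMap.comp_assoc, hh, LinearMap.comp_zero, LinearMap.comp_zero])
  refine ⟨f ∘ₗ LinearMap.pi c, ?_⟩
  have : LinearMap.pi c ∘ₗ b = g ∘ₗ h := by
    ext x j
    exact LinearMap.congr_fun (hc j) x
  rw [LinearMap.comp_assoc, this, ← LinearMap.comp_assoc, hfg, LinearMap.id_comp]

/-- The `Ext¹`-vanishing carried by one spot of a complex of projectives `A → B → C` with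
`Hom(-, Λ)` exact at `B`. -/
lemma derivationsInner_of_presentation {A B C V K : Type u} [AddCommGroup A] [Module Λ A]
    [AddCommGroup B] [Module Λ B] [AddCommGroup C] [Module Λ C] [Module.Projective Λ C]
    {a : A →ₗ[Λ] B} {b : B →ₗ[Λ] C} (hba : b ∘ₗ a = 0)
    (hab : ∀ h : B →ₗ[Λ] Λ, h ∘ₗ a = 0 → ∃ h' : C →ₗ[Λ] Λ, h' ∘ₗ b = h)
    [AddCommGroup V] [Module k V] [Module Λ V] [IsScalarTower k Λ V]
    (q : C →ₗ[Λ] V) (hq : Function.Surjective q) (hbq : Function.Exact b q)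
    [AddCommGroup K] [Module k K] [Module Λ K] [IsScalarTower k Λ K]
    [Module.Finite Λ K] [Module.Projective Λ K] : DerivationsInner k Λ V K := by
  let _ := restrictModule k Λ B
  let _ := restrictModule k Λ C
  have := restrictModule_isScalarTower (k := k) (Λ := Λ) B
  have := restrictModule_isScalarTower (k := k) (Λ := Λ) C
  rw [derivationsInner_iff]
  intro D hD
  obtain ⟨Z, hZ⟩ := derivationsInner_iff.1 (DerivationsInner.of_projective (A := C) (B := K))
    ((LinearMap.lcomp k K (q.restrictScalars k)) ∘ₗ D) fun a a' x => by simp [hD]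
  simp only [LinearMap.comp_apply, LinearMap.lcomp_apply, LinearMap.restrictScalars_apply] at hZ
  let h : B →ₗ[Λ] K := { (Z ∘ₗ b.restrictScalars k) with
    map_smul' := fun r x => by
      have := hZ r (b x)
      rw [hbq.apply_apply_eq_zero, map_zero] at this
      change Z (b (r • x)) = r • Z (b x)
      rw [map_smul]
      exact (sub_eq_zero.1 this.symm).symm }
  obtain ⟨h', hh'⟩ := exists_extension_of_finite_projective hab h (by
    ext x
    change Z (b (a x)) = 0
    rw [show b (a x) = 0 from LinearMap.congr_fun hba x, map_zero])
  obtain ⟨σ, hσ'⟩ := LinearMap.exists_rightInverse_of_surjective (q.restrictScalars k)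
    (LinearMap.range_eq_top.2 hq)
  have hσ : ∀ v, q (σ v) = v := fun v => LinearMap.congr_fun hσ' v
  have key : ∀ x, q x = 0 → Z x = h' x := fun x hx => by
    obtain ⟨y, rfl⟩ := (hbq x).1 hx
    exact (LinearMap.congr_fun hh' y).symm
  refine ⟨(Z - h'.restrictScalars k) ∘ₗ σ, fun r v => ?_⟩
  have h1 := hZ r (σ v)
  have h2 := key (r • σ v - σ (r • v)) (by simp [hσ])
  rw [hσ] at h1
  simp only [map_sub, map_smul] at h2
  simp only [LinearMap.comp_apply, LinearMap.sub_apply, LinearMap.restrictScalars_apply, smul_sub]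
  rw [sub_eq_iff_eq_add] at h2
  rw [h1, h2]
  abel

end GorensteinProjective

namespace IsGorensteinProjective

variable {k : Type u} [Field k] {Λ : Type u} [Ring Λ] [Algebra k Λ]

/-- `Ext¹(V, K) = 0` for a Gorenstein-projective `V` and a finitely generated projective `K`. -/
lemma derivationsInner {V K : Type u} [AddCommGroup V] [Module k V] [Module Λ V]
    [IsScalarTower k Λ V] (hV : IsGorensteinProjective Λ V) [AddCommGroup K] [Module k K]
    [Module Λ K] [IsScalarTower k Λ K] [Module.Finite Λ K] [Module.Projective Λ K] :
    DerivationsInner k Λ V K := by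
  obtain ⟨P, f, hP, hf, hf', ⟨e⟩⟩ := hV
  have key : ∀ (j : ℤ) (q : P (j + 1) →ₗ[Λ] V), Function.Surjective q →
      Function.Exact (f j) q → DerivationsInner k Λ V K := by
    intro j q hq hjq
    obtain ⟨i, rfl⟩ : ∃ i, j = i + 1 := ⟨j - 1, by ring⟩
    have := hP (i + 1 + 1)
    exact derivationsInner_of_presentation (hf i).linearMap_comp_eq_zero
      (fun h hh => (hf' i h).1 hh) q hq hjq
  refine key 0 (e.toLinearMap ∘ₗ (LinearMap.range (f 0)).mkQ)
    (e.surjective.comp (Submodule.mkQ_surjective _)) fun x => ?_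
  change e (Submodule.Quotient.mk x) = 0 ↔ _
  rw [LinearEquiv.map_eq_zero_iff, Submodule.Quotient.mk_eq_zero]
  rfl

/-- `Ext²(V, K) = 0` for a Gorenstein-projective `V` and a finitely generated projective `K`. -/
lemma derivationsInner_ker {V K Q : Type u} [AddCommGroup V] [Module Λ V]
    (hV : IsGorensteinProjective Λ V) [AddCommGroup K] [Module k K]
    [Module Λ K] [IsScalarTower k Λ K] [Module.Finite Λ K] [Module.Projective Λ K]
    [AddCommGroup Q] [Module k Q] [Module Λ Q] [IsScalarTower k Λ Q] [Module.Projective Λ Q]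
    (p : Q →ₗ[Λ] V) (hp : Function.Surjective p) :
    DerivationsInner k Λ (LinearMap.ker p) K := by
  obtain ⟨P, f, hP, hf, hf', ⟨e⟩⟩ := hV
  let _ := fun j => restrictModule k Λ (P j)
  have := fun j => restrictModule_isScalarTower (k := k) (Λ := Λ) (P j)
  have key : ∀ j : ℤ, DerivationsInner k Λ (LinearMap.range (f j)) K := by
    intro j
    obtain ⟨i, rfl⟩ : ∃ i, j = i + 1 + 1 := ⟨j - 2, by ring⟩
    have := hP (i + 1 + 1)
    refine derivationsInner_of_presentation (hf i).linearMap_comp_eq_zero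
      (fun h hh => (hf' i h).1 hh) (f (i + 1 + 1)).rangeRestrict
      (f (i + 1 + 1)).surjective_rangeRestrict fun x => ?_
    rw [← hf (i + 1) x, Subtype.ext_iff]
    rfl
  let q := e.toLinearMap ∘ₗ (LinearMap.range (f 0)).mkQ
  have hqs : Function.Surjective q := e.surjective.comp (Submodule.mkQ_surjective _)
  have hq : ∀ x, q x = 0 ↔ x ∈ LinearMap.range (f 0) := fun x => by
    change e (Submodule.Quotient.mk x) = 0 ↔ _
    rw [LinearEquiv.map_eq_zero_iff, Submodule.Quotient.mk_eq_zero]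
  have := hP (0 + 1)
  -- Schanuel's lemma
  obtain ⟨θ, hθ⟩ := Module.projective_lifting_property q p hqs
  obtain ⟨θ', hθ'⟩ := Module.projective_lifting_property p q hp
  have hθ₁ : ∀ x, q (θ x) = p x := fun x => LinearMap.congr_fun hθ x
  have hθ₁' : ∀ x, p (θ' x) = q x := fun x => LinearMap.congr_fun hθ' x
  refine ((key 0).prod (DerivationsInner.of_projective (A := Q))).of_retract
    (LinearMap.prod (LinearMap.codRestrict _ (θ ∘ₗ (LinearMap.ker p).subtype) fun x => ?_)
      (LinearMap.ker p).subtype)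
    (LinearMap.codRestrict _ (LinearMap.coprod (θ' ∘ₗ (LinearMap.range (f 0)).subtype)
      (LinearMap.id - θ' ∘ₗ θ)) fun x => ?_) fun x => Subtype.ext ?_
  · rw [← hq]
    exact (hθ₁ x).trans x.2
  · have := (hq _).2 x.1.2
    simp [hθ₁, hθ₁', this]
  · change θ' (θ x.1) + (x.1 - θ' (θ x.1)) = x.1
    abel

end IsGorensteinProjective

/-! ### Adding a projective summand -/

namespace Lift

section

variable {k : Type u} [Field k] {Λ : Type u} [Ring Λ] [Algebra k Λ]
  {V W : Type u} [AddCommGroup V] [Module Λ V] [AddCommGroup W] [Module Λ W] {R S : CHat k}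

/-- The lift of `W` obtained from a lift of `V` and an isomorphism `V ≃ W`. -/
noncomputable def congr (e : V ≃ₗ[Λ] W) (L : Lift k Λ V R) : Lift k Λ W R where
  carrier := L
  smul_compat := L.smul_compat
  φ := L.φ.trans e

end

section Transfer

variable {k : Type u} [Field k] {Λ Γ : Type u} [Ring Λ] [Algebra k Λ] [Ring Γ] [Algebra k Γ]
  {V W : Type u} [AddCommGroup V] [Module Λ V] [AddCommGroup W] [Module Γ W]

/-- A construction on lifts which is functorial, faithful on deformations and essentially
surjective sends versal lifts to versal lifts over the same ring. -/
theorem IsVersal.transfer (T : ∀ {S : CHat k}, Lift k Λ V S → Lift k Γ W S)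
    (hT : ∀ {R S : CHat k} {ψ : R ⟶ S} {L : Lift k Λ V R} {L' : Lift k Λ V S},
      MapsTo ψ L L' → MapsTo ψ (T L) (T L'))
    (hfaithful : ∀ {R S : CHat k} {ψ : R ⟶ S} {L : Lift k Λ V R} {L' : Lift k Λ V S},
      MapsTo ψ (T L) (T L') → MapsTo ψ L L')
    (hsurj : ∀ {S : CHat k} (N : Lift k Γ W S), ∃ L : Lift k Λ V S, MapsTo (𝟙 S) (T L) N)
    {R : CHat k} {U : Lift k Λ V R} (hU : U.IsVersal) : (T U).IsVersal := by
  rw [isVersal_iff] at *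
  constructor
  · intro S N
    obtain ⟨L, hL⟩ := hsurj N
    obtain ⟨ψ, hψ⟩ := hU.1 S L
    exact ⟨ψ, (hT hψ).trans_right hL⟩
  · intro N ψ χ hψ hχ
    obtain ⟨L, hL⟩ := hsurj N
    exact hU.2 L ψ χ (hfaithful (hψ.trans_right hL.symm)) (hfaithful (hχ.trans_right hL.symm))

end Transfer

variable {k : Type u} [Field k] {Λ : Type u} [Ring Λ] [Algebra k Λ]
  {V P : Type u} [AddCommGroup V] [Module k V] [Module Λ V] [IsScalarTower k Λ V]
  [AddCommGroup P] [Module k P] [Module Λ P] [IsScalarTower k Λ P] {R S : CHat k}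

lemma mem_smul_top_prod {M N : Type*} [AddCommGroup M] [AddCommGroup N] [Module R M] [Module R N]
    (I : Ideal R) (x : M × N) : x ∈ I • (⊤ : Submodule R (M × N)) ↔
      x.1 ∈ I • (⊤ : Submodule R M) ∧ x.2 ∈ I • (⊤ : Submodule R N) := by
  constructor
  · intro h
    have h1 := Submodule.mem_map_of_mem (f := LinearMap.fst R M N) h
    have h2 := Submodule.mem_map_of_mem (f := LinearMap.snd R M N) h
    rw [Submodule.map_smul''] at h1 h2
    exact ⟨Submodule.smul_mono le_rfl le_top h1, Submodule.smul_mono le_rfl le_top h2⟩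
  · rintro ⟨h1, h2⟩
    have h1 := Submodule.mem_map_of_mem (f := LinearMap.inl R M N) h1
    have h2 := Submodule.mem_map_of_mem (f := LinearMap.inr R M N) h2
    rw [Submodule.map_smul''] at h1 h2
    have := add_mem (Submodule.smul_mono le_rfl le_top h1)
      (Submodule.smul_mono le_rfl le_top h2)
    simpa using this

/-- The direct sum of a lift of `V` and a lift of `P`. -/
noncomputable def prod (L : Lift k Λ V R) (K : Lift k Λ P R) : Lift k Λ (V × P) R :=
  ofπ (L × K) (fun c x => Prod.ext (L.smul_compat c x.1) (K.smul_compat c x.2))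
    (L.π.prodMap K.π) (L.π_surjective.prodMap K.π_surjective) fun x => by
      rw [mem_smul_top_prod, ← π_eq_zero_iff, ← π_eq_zero_iff, Prod.ext_iff]
      rfl

lemma prod_π (L : Lift k Λ V R) (K : Lift k Λ P R) (x : L × K) :
    (L.prod K).π x = (L.π x.1, K.π x.2) :=
  ofπ_π ..

lemma MapsTo.prod {ψ : R ⟶ S} {L : Lift k Λ V R} {L' : Lift k Λ V S} {K : Lift k Λ P R}
    {K' : Lift k Λ P S} (h : MapsTo ψ L L') (h' : MapsTo ψ K K') :
    MapsTo ψ (L.prod K) (L'.prod K') := by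
  obtain ⟨u, h1, h2, h3⟩ := h
  obtain ⟨u', h1', h2', h3'⟩ := h'
  exact ⟨u.prodMap u', fun r x => Prod.ext (h1 _ _) (h1' _ _),
    fun r x => Prod.ext (h2 _ _) (h2' _ _), fun x => by
      erw [prod_π, prod_π]
      exact Prod.ext (h3 _) (h3' _)⟩

lemma MapsTo.of_prod {ψ : R ⟶ S} {L : Lift k Λ V R} {L' : Lift k Λ V S} {K : Lift k Λ P R}
    {K' : Lift k Λ P S} (h : MapsTo ψ (L.prod K) (L'.prod K')) : MapsTo ψ L L' := by
  obtain ⟨u, h1, h2, h3⟩ := h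
  refine ⟨(AddMonoidHom.fst L' K').comp (u.comp (AddMonoidHom.inl L K)), fun r x => ?_,
    fun a x => ?_, fun x => ?_⟩
  · have e : ((r • x, 0) : L × K) = r • (x, 0) := by simp
    exact (congrArg (fun y : L × K => (u y : L' × K').1) e).trans (congrArg Prod.fst (h1 r (x, 0)))
  · have e : ((a • x, 0) : L × K) = a • (x, 0) := by simp
    exact (congrArg (fun y : L × K => (u y : L' × K').1) e).trans (congrArg Prod.fst (h2 a (x, 0)))
  · have := congrArg Prod.fst (h3 (x, 0))
    erw [prod_π, prod_π] at this
    exact this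

/-- Modules `P` with `Ext¹(P, P) = 0` are rigid: all their lifts are induced from each other. -/
lemma mapsTo_of_derivationsInner [Module.Finite k P] (h : DerivationsInner k Λ P P) (ψ : R ⟶ S)
    (K : Lift k Λ P R) (K' : Lift k Λ P S) : MapsTo ψ K K' := by
  obtain ⟨F, h1, h2⟩ := exists_hom_lift h (K.map ψ) K' LinearMap.id
  exact (mapsTo_map ψ K).trans_right (MapsTo.of_linearMap F h1 h2)

/-- A lift of `V × P` splits if the inclusion of `P` and the projection onto `P` can be lifted. -/
lemma exists_prod_of_split (N : Lift k Λ (V × P) S) (K : Lift k Λ P S)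
    (s : K →ₗ[S] N) (hs : ∀ (a : Λ) x, s (a • x) = a • s x) (hsπ : ∀ x, N.π (s x) = (0, K.π x))
    (r : N →ₗ[S] K) (hr : ∀ (a : Λ) x, r (a • x) = a • r x) (hrπ : ∀ x, K.π (r x) = (N.π x).2) :
    ∃ L : Lift k Λ V S, MapsTo (𝟙 S) (L.prod K) N := by
  let e : K ≃ₗ[S] K := LinearEquiv.ofBijective (r ∘ₗ s)
    (bijective_of_π K K (r ∘ₗ s) id Function.bijective_id rfl fun x => by simp [hrπ, hsπ])
  have hea : ∀ (a : Λ) x, e.symm (a • x) = a • e.symm x := fun a x => by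
    rw [LinearEquiv.symm_apply_eq]
    change _ = r (s _)
    rw [hs, hr]
    exact congrArg (a • ·) (e.apply_symm_apply x).symm
  have hres : ∀ x, r (s (e.symm x)) = x := e.apply_symm_apply
  let M := LinearMap.ker r
  let pr : N →ₗ[S] M := LinearMap.codRestrict M (LinearMap.id - s ∘ₗ e.symm.toLinearMap ∘ₗ r)
    fun x => by
      rw [LinearMap.mem_ker]
      simp [hres]
  have hpr : ∀ x, (pr x : N) = x - s (e.symm (r x)) := fun x => rfl
  have hprM : ∀ x : M, pr x = x := fun x => Subtype.ext (by
    rw [hpr, LinearMap.mem_ker.1 x.2, map_zero, map_zero, sub_zero])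
  let _ : SMul Λ M := ⟨fun a x => ⟨a • x.1, by
    rw [LinearMap.mem_ker, hr, LinearMap.mem_ker.1 x.2, smul_zero]⟩⟩
  let _ : Module Λ M := Function.Injective.module Λ M.subtype.toAddMonoidHom
    Subtype.val_injective fun _ _ => rfl
  have : SMulCommClass S Λ M := ⟨fun c a x => Subtype.ext (smul_comm c a x.1)⟩
  have : Module.Projective S M := Module.Projective.of_split M.subtype pr (LinearMap.ext hprM)
  have : Module.Free S M := Module.free_of_flat_of_isLocalRing
  let p : M →ₗ[Λ] V :=
    { toFun := fun x => (N.π x.1).1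
      map_add' := fun x y => by simp
      map_smul' := fun a x => by
        change (N.π (a • x.1)).1 = _
        simp }
  have h2 : ∀ x : M, (N.π x.1).2 = 0 := fun x => by
    rw [← hrπ, LinearMap.mem_ker.1 x.2, map_zero]
  let L : Lift k Λ V S := ofπ M (fun c m => Subtype.ext (N.smul_compat c m.1)) p (fun v => by
      obtain ⟨n, hn⟩ := N.π_surjective (v, 0)
      refine ⟨pr n, ?_⟩
      change (N.π (pr n : N)).1 = v
      rw [hpr, map_sub, hsπ, hn]
      simp) fun x => by
    change (N.π x.1).1 = 0 ↔ _
    constructor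
    · intro h
      have h3 : N.π x.1 = 0 := Prod.ext h (h2 x)
      have h4 := Submodule.mem_map_of_mem (f := pr) (N.π_eq_zero_iff.1 h3)
      rw [Submodule.map_smul'', hprM] at h4
      exact Submodule.smul_mono le_rfl le_top h4
    · intro h
      have h4 := Submodule.mem_map_of_mem (f := M.subtype) h
      rw [Submodule.map_smul''] at h4
      have h5 := N.π_eq_zero_iff.2 (Submodule.smul_mono le_rfl le_top h4)
      exact congrArg Prod.fst h5
  refine ⟨L, MapsTo.of_linearMap (M.subtype.coprod s : M × K →ₗ[S] N) (fun a x => ?_) fun x => ?_⟩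
  · change a • x.1.1 + s (a • x.2) = a • (x.1.1 + s x.2)
    rw [hs, smul_add]
  · change N.π (x.1.1 + s x.2) = _
    erw [prod_π]
    rw [map_add, hsπ]
    refine Prod.ext ?_ ?_
    · change (N.π x.1.1).1 + 0 = L.π x.1
      erw [add_zero, ofπ_π]
      rfl
    · change (N.π x.1.1).2 + K.π x.2 = K.π x.2
      exact (congrArg (· + K.π x.2) (h2 x.1)).trans (zero_add _)

/-- Adding a projective summand `P` with `Ext¹(V, P) = 0` does not change deformations. -/
lemma exists_prod [Module.Finite k V] [Module.Finite k P] [Module.Projective Λ P]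
    (hVP : DerivationsInner k Λ V P) (N : Lift k Λ (V × P) S) (K : Lift k Λ P S) :
    ∃ L : Lift k Λ V S, MapsTo (𝟙 S) (L.prod K) N := by
  obtain ⟨s, hs, hsπ⟩ := exists_hom_lift DerivationsInner.of_projective K N (LinearMap.inr Λ V P)
  obtain ⟨r, hr, hrπ⟩ := exists_hom_lift
    (hVP.prod DerivationsInner.of_projective) N K (LinearMap.snd Λ V P)
  exact exists_prod_of_split N K s hs hsπ r hr hrπ

/-- A ring which is versal for `V` is versal for `V × P`, where `P` is projective and
`Ext¹(V, P) = 0`. -/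
theorem exists_isVersal_prod [Module.Finite k V] [Module.Finite k P] [Module.Finite k Λ]
    [Module.Projective Λ P]
    (hVP : DerivationsInner k Λ V P) {U : Lift k Λ V R} (hU : U.IsVersal) :
    ∃ U' : Lift k Λ (V × P) R, U'.IsVersal := by
  let K : ∀ S : CHat k, Lift k Λ P S := fun S => exists_trivial.some
  refine ⟨_, IsVersal.transfer (fun {S} L => L.prod (K S)) (fun h => h.prod
    (mapsTo_of_derivationsInner DerivationsInner.of_projective _ _ _)) (fun h => h.of_prod)
    (fun N => exists_prod hVP N _) hU⟩

end Lift

/-- Isomorphism of all versal deformation rings follows from one ring which is versal for both. -/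
lemma haveIsomorphicVersalDeformationRings_of_transfer {k : Type u} [Field k]
    {Λ Γ : Type u} [Ring Λ] [Algebra k Λ] [Ring Γ] [Algebra k Γ] [Module.Finite k Λ]
    {V W : Type u} [AddCommGroup V] [Module k V] [Module Λ V] [IsScalarTower k Λ V]
    [Module.Finite k V] [AddCommGroup W] [Module k W] [Module Γ W] [IsScalarTower k Γ W]
    (h : ∀ (R : CHat k) (U : Lift k Λ V R), U.IsVersal → ∃ U' : Lift k Γ W R, U'.IsVersal) :
    HaveIsomorphicVersalDeformationRings k Λ V Γ W := by
  obtain ⟨R, U, hU⟩ := Lift.exists_isVersal k Λ V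
  obtain ⟨U', hU'⟩ := h R U hU
  refine ⟨⟨R, U, hU⟩, ⟨R, U', hU'⟩, fun R₁ S₁ ⟨U₁, h₁⟩ ⟨U₂, h₂⟩ => ?_⟩
  obtain ⟨U₁', h₁'⟩ := h R₁ U₁ h₁
  exact Lift.nonempty_iso_of_isVersal h₁' h₂

/-- Adding a finitely generated projective summand to a Gorenstein-projective module does not
change the versal deformation ring. -/
theorem IsGorensteinProjective.haveIsomorphicVersalDeformationRings_prod {k : Type u} [Field k]
    {Λ : Type u} [Ring Λ] [Algebra k Λ] [Module.Finite k Λ]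
    (V : Type u) [AddCommGroup V] [Module k V] [Module Λ V] [IsScalarTower k Λ V]
    [Module.Finite Λ V] (hV : IsGorensteinProjective Λ V)
    (P : Type u) [AddCommGroup P] [Module Λ P] [Module.Finite Λ P] [Module.Projective Λ P] :
    HaveIsomorphicVersalDeformationRings k Λ V Λ (V × P) := by
  let _ := restrictModule k Λ P
  have := restrictModule_isScalarTower (k := k) (Λ := Λ) P
  have : Module.Finite k V := Module.Finite.trans Λ V
  have : Module.Finite k P := Module.Finite.trans Λ P
  exact haveIsomorphicVersalDeformationRings_of_transfer fun R U hU =>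
    Lift.exists_isVersal_prod hV.derivationsInner hU

/-! ### From versal to universal -/

namespace Lift

variable {k : Type u} [Field k] {Λ : Type u} [Ring Λ] [Algebra k Λ]
  {V : Type u} [AddCommGroup V] [Module k V] [Module Λ V] [IsScalarTower k Λ V] {R S : CHat k}

/-- An endomorphism of `V` which is a scalar up to a map factoring through a projective `P` with
`Ext¹(V, P) = 0` extends to every lift. -/
lemma exists_end_lift [Module.Finite k V] {P : Type u} [AddCommGroup P] [Module k P] [Module Λ P]
    [IsScalarTower k Λ P] [Module.Finite k P] [Module.Finite k Λ] [Module.Projective Λ P]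
    (hVP : DerivationsInner k Λ V P)
    (f : V →ₗ[Λ] V) (c : k) (α : V →ₗ[Λ] P) (β : P →ₗ[Λ] V) (hf : ∀ v, f v = c • v + β (α v))
    (L : Lift k Λ V S) : ∃ F : L →ₗ[S] L, (∀ (a : Λ) x, F (a • x) = a • F x) ∧
      ∀ x, L.π (F x) = f (L.π x) := by
  let K : Lift k Λ P S := exists_trivial.some
  obtain ⟨A, hA, hA'⟩ := exists_hom_lift hVP L K α
  obtain ⟨B, hB, hB'⟩ := exists_hom_lift DerivationsInner.of_projective K L β
  refine ⟨algebraMap k S c • LinearMap.id + B ∘ₗ A, fun a x => ?_, fun x => ?_⟩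
  · simp only [LinearMap.add_apply, LinearMap.smul_apply, LinearMap.id_apply,
      LinearMap.comp_apply, hA, hB, smul_add]
    rw [smul_comm]
  · simp only [LinearMap.add_apply, LinearMap.smul_apply, LinearMap.id_apply,
      LinearMap.comp_apply, map_add, algebraMap_smul, π_smul', hA', hB', hf]

section Versal

variable {U : Lift k Λ V R} {L : Lift k Λ V S} {ψ₁ ψ₂ : R ⟶ S} {u₁ u₂ : U →+ L} {n : ℕ}

lemma map_smul_sub_map_smul (g : L →ₗ[S] L)
    (h₁ : ∀ (r : R) (x : U), u₁ (r • x) = ψ₁.toAlgHom r • u₁ x)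
    (h₂ : ∀ (r : R) (x : U), u₂ (r • x) = ψ₂.toAlgHom r • u₂ x) (r : R) (x : U) :
    g (u₁ (r • x)) - u₂ (r • x) = ψ₁.toAlgHom r • (g (u₁ x) - u₂ x) +
      (ψ₁.toAlgHom r - ψ₂.toAlgHom r) • u₂ x := by
  rw [h₁, h₂, map_smul, smul_sub, sub_smul]
  abel

/-- Two maps from `U` to `L` along morphisms which agree modulo `𝔪 ^ n` differ, modulo `𝔪 ^ n`, by
an endomorphism of `L`, if the endomorphisms of `V` extend to `L`. -/
lemma exists_end_of_congruent
    (hL : ∀ f : V →ₗ[Λ] V, ∃ F : L →ₗ[S] L, (∀ (a : Λ) x, F (a • x) = a • F x) ∧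
      ∀ x, L.π (F x) = f (L.π x))
    (h₁ : ∀ (r : R) (x : U), u₁ (r • x) = ψ₁.toAlgHom r • u₁ x)
    (h₂ : ∀ (r : R) (x : U), u₂ (r • x) = ψ₂.toAlgHom r • u₂ x)
    (h₁Λ : ∀ (a : Λ) (x : U), u₁ (a • x) = a • u₁ x)
    (h₂Λ : ∀ (a : Λ) (x : U), u₂ (a • x) = a • u₂ x)
    (h₁π : ∀ x, L.π (u₁ x) = U.π x) (h₂π : ∀ x, L.π (u₂ x) = U.π x)
    (hψ : ∀ r, ψ₁.toAlgHom r - ψ₂.toAlgHom r ∈ S.𝔪 ^ n) (j : ℕ) (hj : 1 ≤ j) (hjn : j ≤ n) :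
    ∃ g : L →ₗ[S] L, (∀ (a : Λ) x, g (a • x) = a • g x) ∧ (∀ x, L.π (g x) = L.π x) ∧
      ∀ x, g (u₁ x) - u₂ x ∈ S.𝔪 ^ j • (⊤ : Submodule S L) := by
  induction j, hj using Nat.le_induction with
  | base =>
    refine ⟨LinearMap.id, fun _ _ => rfl, fun _ => rfl, fun x => ?_⟩
    rw [pow_one, ← π_eq_zero_iff, map_sub, LinearMap.id_apply, h₁π, h₂π, sub_self]
  | succ j hj ih =>
    obtain ⟨g, hgΛ, hgπ, hg⟩ := ih (by omega)
    obtain ⟨q, c, l, hc, hl, hcl⟩ := S.exists_graded_coordinates j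
    obtain ⟨σ, hσ⟩ := U.exists_section
    obtain ⟨τ, hτ⟩ := L.exists_section
    let d : U →+ L := g.toAddMonoidHom.comp u₁ - u₂
    have hd : ∀ x, d x = g (u₁ x) - u₂ x := fun x => rfl
    -- the leading coefficients of the difference are endomorphisms of `V`
    have hd0 : ∀ i, ∀ y ∈ R.𝔪 • (⊤ : Submodule R U), L.coeff (l i) (d y) = 0 := by
      intro i y hy
      refine L.coeff_eq_zero (hl i) ?_
      induction hy using Submodule.smul_induction_on' with
      | smul r hr y _ =>
        rw [hd, map_smul_sub_map_smul g h₁ h₂]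
        refine add_mem (smul_mem_pow_succ' (CHat.map_mem ψ₁ hr) (hg y))
          (Submodule.smul_mem_smul (Ideal.pow_le_pow_right hjn (hψ r)) trivial)
      | add y _ z _ hy hz => rw [map_add]; exact add_mem hy hz
    have hdπ : ∀ i x y, U.π x = U.π y → L.coeff (l i) (d x) = L.coeff (l i) (d y) := by
      intro i x y h
      rw [← sub_eq_zero, ← map_sub, ← map_sub]
      refine hd0 i _ ?_
      rw [← π_eq_zero_iff, map_sub, h, sub_self]
    let f : Fin q → V →ₗ[Λ] V := fun i =>
      { toFun := fun v => L.coeff (l i) (d (σ v))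
        map_add' := fun v w => by simp only [map_add]
        map_smul' := fun a v => by
          have e : d (a • σ v) = a • d (σ v) := by
            rw [hd, hd, h₁Λ, h₂Λ, hgΛ, smul_sub]
          rw [RingHom.id_apply, hdπ i (σ (a • v)) (a • σ v) (by rw [U.π.map_smul, hσ, hσ]), e]
          exact L.coeff_alg_smul (hl i) a (hg (σ v)) }
    have hf : ∀ i x, f i (U.π x) = L.coeff (l i) (d x) := fun i x =>
      hdπ i _ _ (hσ _)
    choose F hFΛ hF using fun i => hL (f i)
    have hsum : ∀ x, ∑ i, c i • F i x ∈ S.𝔪 ^ j • (⊤ : Submodule S L) := fun x =>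
      Submodule.sum_mem _ fun i _ => Submodule.smul_mem_smul (hc i) trivial
    have hg' : ∀ x, (g - ∑ i, c i • F i ∘ₗ LinearMap.id) x = g x - ∑ i, c i • F i x := fun x => by
      simp
    refine ⟨g - ∑ i, c i • F i ∘ₗ LinearMap.id, fun a x => ?_, fun x => ?_, fun x => ?_⟩
    · rw [hg', hg', hgΛ, smul_sub, Finset.smul_sum]
      congr 1
      refine Finset.sum_congr rfl fun i _ => ?_
      rw [hFΛ, smul_comm]
    · rw [hg', map_sub, hgπ, sub_eq_self, π_eq_zero_iff]
      have := S.pow_smul_antitone hj (hsum x)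
      rwa [pow_one] at this
    · have h4 := L.sub_sum_coeff_mem hτ hl hc hcl (hg x)
      have e : (g - ∑ i, c i • F i ∘ₗ LinearMap.id) (u₁ x) - u₂ x =
          (d x - ∑ i, c i • τ (L.coeff (l i) (d x))) -
            ∑ i, c i • (F i (u₁ x) - τ (L.coeff (l i) (d x))) := by
        rw [hg', hd]
        simp only [smul_sub, Finset.sum_sub_distrib]
        abel
      rw [e]
      refine sub_mem h4 (Submodule.sum_mem _ fun i _ => smul_mem_pow_succ (hc i) ?_)
      rw [← π_eq_zero_iff, map_sub, hτ, hF, h₁π, hf, sub_self]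

/-- If two maps from a versal lift along `ψ₁` and `ψ₂` agree modulo `𝔪 ^ n`, then `ψ₁` and `ψ₂`
agree modulo `𝔪 ^ (n + 1)`: each linear form on `𝔪 ^ n / 𝔪 ^ (n + 1)` turns `ψ₁ - ψ₂` into a tangent
vector of `R` along which `U` is trivial. -/
lemma IsVersal.sub_mem_pow_succ (hU : U.IsVersal) (g : L →ₗ[S] L)
    (hg : ∀ (a : Λ) x, g (a • x) = a • g x)
    (h₁ : ∀ (r : R) (x : U), u₁ (r • x) = ψ₁.toAlgHom r • u₁ x)
    (h₂ : ∀ (r : R) (x : U), u₂ (r • x) = ψ₂.toAlgHom r • u₂ x)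
    (h₁Λ : ∀ (a : Λ) (x : U), u₁ (a • x) = a • u₁ x)
    (h₂Λ : ∀ (a : Λ) (x : U), u₂ (a • x) = a • u₂ x)
    (h₂π : ∀ x, L.π (u₂ x) = U.π x)
    (hψ : ∀ r, ψ₁.toAlgHom r - ψ₂.toAlgHom r ∈ S.𝔪 ^ n)
    (hgu : ∀ x, g (u₁ x) - u₂ x ∈ S.𝔪 ^ n • (⊤ : Submodule S L)) (r : R) :
    ψ₁.toAlgHom r - ψ₂.toAlgHom r ∈ S.𝔪 ^ (n + 1) := by
  obtain ⟨q, c, l, hc, hl, hcl⟩ := S.exists_graded_coordinates n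
  have key : ∀ i r, l i (ψ₁.toAlgHom r - ψ₂.toAlgHom r) = 0 := by
    intro i
    let δ : R →ₗ[k] k := l i ∘ₗ (ψ₁.toAlgHom.toLinearMap - ψ₂.toAlgHom.toLinearMap)
    have hδ : ∀ r, δ r = l i (ψ₁.toAlgHom r - ψ₂.toAlgHom r) := fun r => rfl
    have hδ' : ∀ r s, δ (r * s) = R.aug r * δ s + R.aug s * δ r := fun r s => by
      have e : ψ₁.toAlgHom (r * s) - ψ₂.toAlgHom (r * s) =
          ψ₁.toAlgHom r * (ψ₁.toAlgHom s - ψ₂.toAlgHom s) +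
            ψ₂.toAlgHom s * (ψ₁.toAlgHom r - ψ₂.toAlgHom r) := by
        rw [map_mul, map_mul]; ring
      rw [hδ, e, map_add, S.smul_functional (hl i) _ (hψ s), S.smul_functional (hl i) _ (hψ r),
        CHat.aug_map, CHat.aug_map]
      rfl
    let χ : R ⟶ CHat.dual k := CHat.ofDerivation δ hδ'
    let χ₀ : R ⟶ CHat.dual k := CHat.ofDerivation 0 (by simp)
    let ε : CHat.dual k := (DualNumber.eps : DualNumber k)
    have hχ₀ : ∀ r, χ₀.toAlgHom r = algebraMap k (CHat.dual k) (R.aug r) := fun r => rfl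
    have hχ : ∀ r, χ.toAlgHom r = algebraMap k (CHat.dual k) (R.aug r) +
        algebraMap k (CHat.dual k) (δ r) * ε := fun r => by
      refine TrivSqZeroExt.ext ?_ ?_
      · change R.aug r = R.aug r + δ r * 0
        simp
      · change δ r = 0 + (δ r • 1 + MulOpposite.op (0 : k) • (0 : k))
        simp
    have hε : ε * ε = 0 := DualNumber.eps_mul_eps
    let T := U.map χ₀
    obtain ⟨w, w1, w2, w3⟩ := mapsTo_map χ₀ U
    have w1' : ∀ (r : R) x, w (r • x) = R.aug r • w x := fun r x => by
      rw [w1, hχ₀, algebraMap_smul]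
    have w0' : ∀ y ∈ R.𝔪 • (⊤ : Submodule R U), w y = 0 := by
      intro y hy
      induction hy using Submodule.smul_induction_on' with
      | smul r hr y _ => rw [w1', R.aug_eq_zero_iff.2 hr, zero_smul]
      | add y _ z _ hy hz => rw [map_add, hy, hz, add_zero]
    have w0 : ∀ x y, U.π x = U.π y → w x = w y := fun x y hxy => by
      rw [← sub_eq_zero, ← map_sub] at hxy ⊢
      exact w0' _ (U.π_eq_zero_iff.1 hxy)
    obtain ⟨σ, hσ⟩ := U.exists_section
    let d : U →+ L := g.toAddMonoidHom.comp u₁ - u₂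
    have hd : ∀ x, d x = g (u₁ x) - u₂ x := fun x => rfl
    let v : U →+ T := w + (DistribSMul.toAddMonoidHom T ε).comp (w.comp
      (σ.toAddMonoidHom.comp ((L.coeff (l i)).toAddMonoidHom.comp d)))
    have hv : ∀ x, v x = w x + ε • w (σ (L.coeff (l i) (d x))) := fun x => rfl
    have hwk : ∀ (c : k) x, w (c • x) = c • w x := fun c x => by
      rw [← algebraMap_smul, w1', CHat.aug_algebraMap]
    have hm : MapsTo χ U T := by
      refine ⟨v, fun r x => ?_, fun a x => ?_, fun x => ?_⟩
      · have hdr : L.coeff (l i) (d (r • x)) =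
            R.aug r • L.coeff (l i) (d x) + δ r • U.π x := by
          rw [hd, map_smul_sub_map_smul g h₁ h₂, map_add, L.coeff_ring_smul (hl i) _ (hgu x),
            L.coeff_smul (hl i) (hψ r), CHat.aug_map, h₂π]
          rfl
        have hsw : w (σ (U.π x)) = w x := w0 _ _ (hσ _)
        rw [hv, hv, hdr, w1', map_add, map_add, σ.map_smul, σ.map_smul, hwk, hwk, hsw, hχ, add_smul,
          smul_add, smul_add, smul_add, mul_smul, mul_smul, smul_smul ε ε, hε, zero_smul,
          smul_zero, add_zero, algebraMap_smul, algebraMap_smul, algebraMap_smul,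
          smul_comm ε (R.aug r), smul_comm ε (δ r), add_assoc]
      · have hda : L.coeff (l i) (d (a • x)) = a • L.coeff (l i) (d x) := by
          rw [hd, h₁Λ, h₂Λ, hg, ← smul_sub, L.coeff_alg_smul (hl i) a (hgu x)]
          rfl
        rw [hv, hv, hda, w2, smul_add, w0 (σ (a • _)) (a • σ (L.coeff (l i) (d x)))
          (by rw [U.π.map_smul, hσ, hσ]), w2, smul_comm ε a]
      · rw [hv, map_add, w3, π_smul, (CHat.dual k).aug_eq_zero_iff.2, zero_smul, add_zero]
        change (DualNumber.eps : DualNumber k) ∈ IsLocalRing.maximalIdeal (DualNumber k)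
        rw [DualNumber.maximalIdeal_eq_span_singleton_eps]
        exact Ideal.mem_span_singleton_self _
    have heq := ((isVersal_iff U).1 hU).2 T χ χ₀ hm ⟨w, w1, w2, w3⟩
    intro r
    exact congrArg (fun f : R ⟶ CHat.dual k => TrivSqZeroExt.snd (f.toAlgHom r : DualNumber k)) heq
  simpa [key] using hcl _ (hψ r)

end Versal

/-- A versal lift is universal if the endomorphisms of `V` extend to all lifts. -/
theorem IsVersal.isUniversal {U : Lift k Λ V R} (hU : U.IsVersal)
    (hlift : ∀ (S : CHat k) (L : Lift k Λ V S) (f : V →ₗ[Λ] V), ∃ F : L →ₗ[S] L,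
      (∀ (a : Λ) x, F (a • x) = a • F x) ∧ ∀ x, L.π (F x) = f (L.π x)) : U.IsUniversal := by
  refine (isUniversal_iff U).2 ⟨((isVersal_iff U).1 hU).1, ?_⟩
  rintro S L ψ₁ ψ₂ ⟨u₁, h₁, h₁Λ, h₁π⟩ ⟨u₂, h₂, h₂Λ, h₂π⟩
  have key : ∀ n, ∀ r, ψ₁.toAlgHom r - ψ₂.toAlgHom r ∈ S.𝔪 ^ n := by
    intro n
    induction n with
    | zero => simp
    | succ n ih =>
      intro r
      rcases Nat.eq_zero_or_pos n with rfl | hn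
      · rw [zero_add, pow_one, ← CHat.aug_eq_zero_iff, map_sub, CHat.aug_map, CHat.aug_map,
          sub_self]
      · obtain ⟨g, hg, -, hgu⟩ :=
          exists_end_of_congruent (hlift S L) h₁ h₂ h₁Λ h₂Λ h₁π h₂π ih n hn le_rfl
        exact hU.sub_mem_pow_succ g hg h₁ h₂ h₁Λ h₂Λ h₂π ih hgu r
  exact CHat.hom_ext fun r => sub_eq_zero.1 (S.eq_zero_of_mem_pow fun n => key n r)

end Lift

/-! ### Projective covers, syzygies and stable endomorphisms -/

section ProjectiveCover

/-- A finitely generated module over a finite-dimensional algebra has a projective cover: a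
surjection from a projective module of minimal dimension. -/
lemma exists_isProjectiveCover (k : Type u) [Field k] {Λ : Type u} [Ring Λ] [Algebra k Λ]
    [Module.Finite k Λ]
    (V : Type u) [AddCommGroup V] [Module Λ V] [Module.Finite Λ V] :
    ∃ (P : ModuleCat.{u} Λ) (p : P →ₗ[Λ] V), IsProjectiveCover Λ p := by
  let Q : ℕ → Prop := fun d => ∃ (P : Type u) (_ : AddCommGroup P) (_ : Module Λ P)
    (p : P →ₗ[Λ] V), Module.Finite Λ P ∧ Module.Projective Λ P ∧ Function.Surjective p ∧
      @Module.finrank k P _ _ (restrictModule k Λ P) = d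
  have hQ : ∃ d, Q d := by
    obtain ⟨n, p, hp⟩ := Module.Finite.exists_fin' Λ V
    exact ⟨_, Fin n → Λ, _, _, p, inferInstance, inferInstance, hp, rfl⟩
  classical
  obtain ⟨P, _, _, p, hfin, hproj, hp, hd⟩ := Nat.find_spec hQ
  let _ := restrictModule k Λ P
  have := restrictModule_isScalarTower (k := k) (Λ := Λ) P
  have : Module.Finite k P := Module.Finite.trans Λ P
  have : IsNoetherian Λ P := isNoetherian_of_tower k inferInstance
  have : IsArtinian Λ P := isArtinian_of_tower k inferInstance
  refine ⟨ModuleCat.of Λ P, p, hproj, hp, fun N hN => ?_⟩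
  have hpN : Function.Surjective (p ∘ₗ N.subtype) := fun v => by
    obtain ⟨x, rfl⟩ := hp v
    obtain ⟨y, hy, z, hz, rfl⟩ := Submodule.mem_sup.1 (hN ▸ Submodule.mem_top : x ∈ N ⊔ _)
    exact ⟨⟨y, hy⟩, by simp [LinearMap.mem_ker.1 hz]⟩
  obtain ⟨θ, hθ⟩ := Module.projective_lifting_property (p ∘ₗ N.subtype) p hpN
  let t : Module.End Λ P := N.subtype ∘ₗ θ
  have ht : ∀ x, p (t x) = p x := fun x => LinearMap.congr_fun hθ x
  have htn : ∀ n x, p ((t ^ n) x) = p x := fun n => by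
    induction n with
    | zero => simp
    | succ n ih => intro x; rw [pow_succ', Module.End.mul_apply, ht, ih]
  -- the stable image of `t` is a summand by Fitting's lemma, so it is everything by minimality
  obtain ⟨m, hm⟩ := Filter.eventually_atTop.1 (LinearMap.eventually_isCompl_ker_pow_range_pow t)
  have hc := hm (m + 1) (Nat.le_succ m)
  let I := LinearMap.range (t ^ (m + 1))
  have hI : Module.Projective Λ I :=
    Module.Projective.of_split I.subtype (I.projectionOnto _ hc.symm)
      (LinearMap.ext fun x => by simp)
  have hmin : Module.finrank k P ≤ Module.finrank k I := by
    rw [hd]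
    refine Nat.find_min' hQ ⟨I, _, _, p ∘ₗ I.subtype, inferInstance, hI, fun v => ?_, rfl⟩
    obtain ⟨x, rfl⟩ := hp v
    exact ⟨⟨_, x, rfl⟩, htn (m + 1) x⟩
  have hI' : I.restrictScalars k = ⊤ :=
    Submodule.eq_top_of_finrank_eq (le_antisymm (Submodule.finrank_le _) hmin)
  rw [eq_top_iff]
  intro x _
  have hx : x ∈ I.restrictScalars k := hI' ▸ Submodule.mem_top
  obtain ⟨y, rfl⟩ := hx
  rw [pow_succ', Module.End.mul_apply]
  exact (θ _).2

lemma exists_isFirstSyzygy (k : Type u) [Field k] {Λ : Type u} [Ring Λ] [Algebra k Λ]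
    [Module.Finite k Λ]
    (V : Type u) [AddCommGroup V] [Module Λ V] [Module.Finite Λ V] :
    ∃ W : ModuleCat.{u} Λ, IsFirstSyzygy Λ V W := by
  obtain ⟨P, p, hp⟩ := exists_isProjectiveCover k (Λ := Λ) V
  exact ⟨ModuleCat.of Λ (LinearMap.ker p), P, p, hp, ⟨LinearEquiv.refl _ _⟩⟩

/-- By minimality, a projective cover is a quotient of any projective module mapping onto `V`. -/
lemma IsProjectiveCover.finite {Λ V : Type u} [Ring Λ] [AddCommGroup V] [Module Λ V]
    [Module.Finite Λ V] {P : Type u} [AddCommGroup P] [Module Λ P] {p : P →ₗ[Λ] V}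
    (hp : IsProjectiveCover Λ p) : Module.Finite Λ P := by
  obtain ⟨n, f, hf⟩ := Module.Finite.exists_fin' Λ V
  obtain ⟨g, hg⟩ := Module.projective_lifting_property p f hp.2.1
  have h : LinearMap.range g = ⊤ := hp.2.2 _ (by
    rw [eq_top_iff]
    intro x _
    obtain ⟨y, hy⟩ := hf (p x)
    have : x = g y + (x - g y) := by abel
    rw [this]
    refine Submodule.add_mem_sup ⟨y, rfl⟩ ?_
    have h1 : p (g y) = f y := LinearMap.congr_fun hg y
    rw [LinearMap.mem_ker, map_sub, h1, hy, sub_self])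
  exact Module.Finite.of_surjective g (LinearMap.range_eq_top.1 h)

end ProjectiveCover

section StableEnd

variable {k : Type u} [Field k] {Λ : Type u} [Ring Λ] [Algebra k Λ]
  {V : Type u} [AddCommGroup V] [Module k V] [Module Λ V] [IsScalarTower k Λ V]

/-- If the stable endomorphism ring is `k`, every endomorphism is a scalar up to a map which
factors through a given surjection from a projective. -/
lemma exists_scalar_add_comp (e : StableEnd Λ V ≃ₐ[k] k) {P : Type u} [AddCommGroup P] [Module Λ P]
    (p : P →ₗ[Λ] V) (hp : Function.Surjective p) (f : V →ₗ[Λ] V) :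
    ∃ (c : k) (α : V →ₗ[Λ] P), ∀ v, f v = c • v + p (α v) := by
  let c := e (Ideal.Quotient.mk _ f)
  have h : Ideal.Quotient.mk (projectiveEnds Λ V) f =
      Ideal.Quotient.mk _ (algebraMap k (Module.End Λ V) c) := by
    apply e.injective
    change c = e (algebraMap k _ c)
    rw [AlgEquiv.commutes]
    rfl
  rw [Ideal.Quotient.eq] at h
  obtain ⟨Q, hQ, g, h', hgh⟩ := h
  obtain ⟨β, hβ⟩ := Module.projective_lifting_property p h' hp
  refine ⟨c, β ∘ₗ g, fun v => ?_⟩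
  have h1 : f v - c • v = h' (g v) := LinearMap.congr_fun hgh v
  have h2 : p (β (g v)) = h' (g v) := LinearMap.congr_fun hβ (g v)
  rw [LinearMap.comp_apply, h2, ← h1]
  abel

/-- If every endomorphism of `V` is a scalar up to a map through a projective `P` with
`Ext¹(V, P) = 0`, then the endomorphisms of `V` extend to all lifts, and versal lifts are
universal. -/
lemma versalDeformationRingIsUniversal_of_ends [Module.Finite k Λ] [Module.Finite k V]
    {P : Type u} [AddCommGroup P] [Module k P] [Module Λ P]
    [IsScalarTower k Λ P] [Module.Finite k P] [Module.Projective Λ P]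
    (hVP : DerivationsInner k Λ V P)
    (hf : ∀ f : V →ₗ[Λ] V, ∃ (c : k) (α : V →ₗ[Λ] P) (β : P →ₗ[Λ] V),
      ∀ v, f v = c • v + β (α v)) : VersalDeformationRingIsUniversal k Λ V := by
  refine ⟨Lift.exists_isVersal k Λ V, fun R U hU => hU.isUniversal fun S L f => ?_⟩
  obtain ⟨c, α, β, h⟩ := hf f
  exact Lift.exists_end_lift hVP f c α β h L

variable [Module.Finite k Λ] [Module.Finite Λ V]

theorem IsGorensteinProjective.versalDeformationRingIsUniversal (hV : IsGorensteinProjective Λ V)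
    (e : StableEnd Λ V ≃ₐ[k] k) : VersalDeformationRingIsUniversal k Λ V := by
  obtain ⟨n, p, hp⟩ := Module.Finite.exists_fin' Λ V
  have : Module.Finite k V := Module.Finite.trans Λ V
  refine versalDeformationRingIsUniversal_of_ends (P := Fin n → Λ) hV.derivationsInner fun f => ?_
  obtain ⟨c, α, h⟩ := exists_scalar_add_comp e p hp f
  exact ⟨c, α, p, h⟩

/-- The syzygy also has stable endomorphism ring `k`: since `Ext¹(V, P) = 0`, its endomorphisms
extend to the projective cover, and so come from endomorphisms of `V` up to maps through `P`. -/
theorem IsFirstSyzygy.versalDeformationRingIsUniversal (hV : IsGorensteinProjective Λ V)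
    (e : StableEnd Λ V ≃ₐ[k] k) {W : Type u} [AddCommGroup W] [Module Λ W]
    (hW : IsFirstSyzygy Λ V W) : VersalDeformationRingIsUniversal k Λ W := by
  obtain ⟨P, p, hp, ⟨w⟩⟩ := hW
  have := hp.finite
  have := hp.1
  let _ := restrictModule k Λ P
  have := restrictModule_isScalarTower (k := k) (Λ := Λ) P
  let _ := restrictModule k Λ W
  have := restrictModule_isScalarTower (k := k) (Λ := Λ) W
  have : Module.Finite k P := Module.Finite.trans Λ P
  have : Module.Finite k W := Module.Finite.of_injective
    (((LinearMap.ker p).subtype ∘ₗ w.toLinearMap).restrictScalars k)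
    (Subtype.val_injective.comp w.injective)
  refine versalDeformationRingIsUniversal_of_ends (P := P)
    ((hV.derivationsInner_ker p hp.2.1).of_retract w.toLinearMap w.symm.toLinearMap
      w.symm_apply_apply) fun f => ?_
  -- extend `f` to `P`, and correct it by a map `P → P` which induces the same map on `V`
  obtain ⟨F, hF⟩ := (hV.derivationsInner (k := k) (K := P)).exists_extension p hp.2.1
    ((LinearMap.ker p).subtype ∘ₗ w.toLinearMap ∘ₗ f ∘ₗ w.symm.toLinearMap)
  have hFw : ∀ x, F (w x) = w (f x) := fun x => by rw [hF]; simp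
  have hker : ∀ y, p y = 0 → p (F y) = 0 := fun y hy => by
    rw [hF ⟨y, hy⟩]; exact (w (f (w.symm ⟨y, hy⟩))).2
  let g : V →ₗ[Λ] V := ((LinearMap.ker p).liftQ (p ∘ₗ F) hker) ∘ₗ
    (p.quotKerEquivOfSurjective hp.2.1).symm.toLinearMap
  have hg : ∀ y, g (p y) = p (F y) := fun y => by
    have : (p.quotKerEquivOfSurjective hp.2.1).symm (p y) = Submodule.Quotient.mk y := by
      rw [LinearEquiv.symm_apply_eq]; rfl
    change (LinearMap.ker p).liftQ (p ∘ₗ F) hker _ = _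
    rw [LinearEquiv.coe_coe, this]
    rfl
  obtain ⟨c, γ, h⟩ := exists_scalar_add_comp e p hp.2.1 g
  let G : P →ₗ[Λ] LinearMap.ker p := LinearMap.codRestrict _
    (F - algebraMap k (Module.End Λ P) c - γ ∘ₗ p) fun y => by
      have h1 := h (p y)
      have h2 : p (c • y) = c • p y := LinearMap.map_smul_of_tower p c y
      rw [hg] at h1
      simp [h1, h2]
  refine ⟨c, (LinearMap.ker p).subtype ∘ₗ w.toLinearMap, w.symm.toLinearMap ∘ₗ G, fun x => ?_⟩
  have h3 : G (w x) = w (f x - c • x) := Subtype.ext (by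
    change F (w x) - c • (w x : P) - γ (p (w x)) = _
    have h4 : p (w x : P) = 0 := (w x).2
    have h5 : w (c • x) = c • w x := LinearMap.map_smul_of_tower w.toLinearMap c x
    rw [h4, map_zero, sub_zero, hFw, map_sub, h5]
    rfl)
  change f x = c • x + w.symm (G (w x))
  rw [h3, LinearEquiv.symm_apply_apply]
  abel

end StableEnd

/-! ### Balanced tensor products -/

namespace BalancedTensor

variable {k : Type u} [Field k] {A Λ : Type u} [Ring A] [Algebra k A] [Ring Λ] [Algebra k Λ]
  {X : Type u} [AddCommGroup X] [Module k X] [Module A X] [Module Λᵐᵒᵖ X]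
  [IsScalarTower k A X]
  {Y : Type u} [AddCommGroup Y] [Module k Y] [Module Λ Y]

variable (k A Λ) in
/-- The class of `x ⊗ y` in `X ⊗_Λ Y`. -/
def mk (x : X) (y : Y) : BalancedTensor k A Λ X Y := Submodule.Quotient.mk (x ⊗ₜ[k] y)

lemma mk_op_smul (x : X) (a : Λ) (y : Y) :
    mk k A Λ (MulOpposite.op a • x) y = mk k A Λ x (a • y) :=
  (Submodule.Quotient.eq _).2 (Submodule.subset_span ⟨x, a, y, rfl⟩)

lemma smul_mk (a : A) (x : X) (y : Y) : a • mk k A Λ x y = mk k A Λ (a • x) y := rfl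

lemma smul_mk' (c : k) (x : X) (y : Y) : c • mk k A Λ x y = mk k A Λ (c • x) y := rfl

lemma mk_smul' (c : k) (x : X) (y : Y) : mk k A Λ x (c • y) = c • mk k A Λ x y := by
  rw [smul_mk', mk, mk, TensorProduct.smul_tmul]

lemma mk_add (x : X) (y y' : Y) : mk k A Λ x (y + y') = mk k A Λ x y + mk k A Λ x y' := by
  rw [mk, TensorProduct.tmul_add]; rfl

lemma add_mk (x x' : X) (y : Y) : mk k A Λ (x + x') y = mk k A Λ x y + mk k A Λ x' y := by
  rw [mk, TensorProduct.add_tmul]; rfl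

@[elab_as_elim]
lemma induction_on {motive : BalancedTensor k A Λ X Y → Prop} (z : BalancedTensor k A Λ X Y)
    (mk : ∀ x y, motive (mk k A Λ x y)) (add : ∀ z w, motive z → motive w → motive (z + w)) :
    motive z := by
  obtain ⟨t, rfl⟩ := Submodule.Quotient.mk_surjective _ z
  induction t with
  | zero => simpa [BalancedTensor.mk] using mk 0 0
  | tmul x y => exact mk x y
  | add t t' h h' => exact add _ _ h h'

instance : IsScalarTower k A (BalancedTensor k A Λ X Y) :=
  ⟨fun c a z => by
    obtain ⟨t, rfl⟩ := Submodule.Quotient.mk_surjective _ z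
    exact congrArg Submodule.Quotient.mk (smul_assoc c a t)⟩

instance [Module.Finite k X] [Module.Finite k Y] : Module.Finite k (BalancedTensor k A Λ X Y) :=
  Module.Finite.of_surjective
    ({ toFun := Submodule.Quotient.mk
       map_add' := fun _ _ => rfl
       map_smul' := fun _ _ => rfl } : X ⊗[k] Y →ₗ[k] BalancedTensor k A Λ X Y)
    (Submodule.Quotient.mk_surjective _)

section Lift

variable [SMulCommClass A Λᵐᵒᵖ X] {N : Type*} [AddCommGroup N] [Module k N]

/-- The map out of `X ⊗_Λ Y` given by a balanced bilinear map. -/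
def lift (f : X →ₗ[k] Y →ₗ[k] N) (hf : ∀ x (a : Λ) y, f (MulOpposite.op a • x) y = f x (a • y)) :
    BalancedTensor k A Λ X Y →ₗ[k] N :=
  ((balancedRel k A Λ X Y).restrictScalars k).liftQ (TensorProduct.lift f) fun t ht => by
    have key : ∀ a : A, TensorProduct.lift f (a • t) = 0 := by
      have ht' : t ∈ balancedRel k A Λ X Y := ht
      clear ht
      induction ht' using Submodule.span_induction with
      | mem t h =>
        obtain ⟨x, b, y, rfl⟩ := h
        intro a
        rw [smul_sub, TensorProduct.smul_tmul', TensorProduct.smul_tmul', map_sub,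
          TensorProduct.lift.tmul, TensorProduct.lift.tmul, smul_comm, hf, sub_self]
      | zero => simp
      | add t t' _ _ h h' => intro a; rw [smul_add, map_add, h, h', add_zero]
      | smul b t _ h => intro a; rw [smul_smul, h]
    simpa using key 1

@[simp]
lemma lift_mk (f : X →ₗ[k] Y →ₗ[k] N) (hf) (x : X) (y : Y) :
    lift (A := A) (Λ := Λ) f hf (mk k A Λ x y) = f x y :=
  TensorProduct.lift.tmul _ _

end Lift

section Map

variable [SMulCommClass A Λᵐᵒᵖ X] [IsScalarTower k Λ Y]
  {X' : Type u} [AddCommGroup X'] [Module k X'] [Module A X'] [Module Λᵐᵒᵖ X']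
  [IsScalarTower k A X'] [SMulCommClass A Λᵐᵒᵖ X']
  {Y' : Type u} [AddCommGroup Y'] [Module k Y'] [Module Λ Y'] [IsScalarTower k Λ Y']
  {Y'' : Type u} [AddCommGroup Y''] [Module k Y''] [Module Λ Y''] [IsScalarTower k Λ Y'']

variable (A) in
/-- A map of right `Λ`-modules induces a map on tensor products. -/
def mapLeft (f : X →ₗ[k] X') (hf : ∀ (a : Λ) x, f (MulOpposite.op a • x) = MulOpposite.op a • f x) :
    BalancedTensor k A Λ X Y →ₗ[k] BalancedTensor k A Λ X' Y :=
  lift (LinearMap.mk₂ k (fun x y => mk k A Λ (f x) y) (fun x x' y => by rw [map_add, add_mk])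
    (fun c x y => by rw [map_smul, smul_mk']) (fun x y y' => by rw [mk_add])
    fun c x y => by rw [mk_smul']) fun x a y => by
      simp only [LinearMap.mk₂_apply, hf, mk_op_smul]

@[simp]
lemma mapLeft_mk (f : X →ₗ[k] X') (hf) (x : X) (y : Y) :
    mapLeft A f hf (mk k A Λ x y) = mk k A Λ (f x) y :=
  lift_mk ..

variable (k A X) in
/-- The functor `X ⊗_Λ -` on morphisms. -/
def map (g : Y →ₗ[Λ] Y') : BalancedTensor k A Λ X Y →ₗ[A] BalancedTensor k A Λ X Y' :=
  Submodule.mapQ _ _ (TensorProduct.AlgebraTensorModule.lTensor A X (g.restrictScalars k)) (by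
    rw [balancedRel, Submodule.span_le]
    rintro _ ⟨x, a, y, rfl⟩
    exact Submodule.subset_span ⟨x, a, g y, by simp⟩)

@[simp]
lemma map_mk (g : Y →ₗ[Λ] Y') (x : X) (y : Y) :
    map k A X g (mk k A Λ x y) = mk k A Λ x (g y) := rfl

lemma map_id (z : BalancedTensor k A Λ X Y) : map k A X (LinearMap.id : Y →ₗ[Λ] Y) z = z := by
  induction z using induction_on with
  | mk x y => rfl
  | add z w hz hw => rw [map_add, hz, hw]

lemma map_comp (g : Y →ₗ[Λ] Y') (g' : Y' →ₗ[Λ] Y'') (z : BalancedTensor k A Λ X Y) :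
    map k A X (g' ∘ₗ g) z = map k A X g' (map k A X g z) := by
  induction z using induction_on with
  | mk x y => rfl
  | add z w hz hw => simp only [map_add, hz, hw]

lemma map_add_left (g g' : Y →ₗ[Λ] Y') (z : BalancedTensor k A Λ X Y) :
    map k A X (g + g') z = map k A X g z + map k A X g' z := by
  induction z using induction_on with
  | mk x y => simp [mk_add]
  | add z w hz hw => simp only [map_add, hz, hw]; abel

lemma map_zero_left (z : BalancedTensor k A Λ X Y) :
    map k A X (0 : Y →ₗ[Λ] Y') z = 0 := by
  have := map_add_left (A := A) (X := X) (0 : Y →ₗ[Λ] Y') 0 z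
  rw [add_zero] at this
  simpa using this

variable (k A X Y) in
/-- The functor `X ⊗_Λ -` on endomorphisms of `Y`. -/
def mapEnd : Module.End Λ Y →+* Module.End A (BalancedTensor k A Λ X Y) where
  toFun := map k A X
  map_one' := LinearMap.ext map_id
  map_mul' g g' := LinearMap.ext (map_comp g' g)
  map_zero' := LinearMap.ext map_zero_left
  map_add' g g' := LinearMap.ext (map_add_left g g')

variable (k A Λ X Y) in
/-- An action of `S` on `Y` by endomorphisms induces one on `X ⊗_Λ Y`. -/
abbrev moduleRight (S : Type*) [Ring S] [Module S Y] [SMulCommClass S Λ Y] :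
    Module S (BalancedTensor k A Λ X Y) :=
  haveI : SMulCommClass Λ S Y := SMulCommClass.symm S Λ Y
  Module.compHom _ ((mapEnd k A X Y).comp (Module.toModuleEnd Λ (S := S) Y))

lemma rightMul_mk {B : Type u} [Ring B] [Algebra k B] [Module Bᵐᵒᵖ Y]
    [IsScalarTower k Bᵐᵒᵖ Y] [SMulCommClass Λ Bᵐᵒᵖ Y] (b : B) (x : X) (y : Y) :
    rightMul k A Λ X Y B b (mk k A Λ x y) = mk k A Λ x (MulOpposite.op b • y) := rfl

/-- A linear form on the right `Λ`-module `X` gives a natural map `X ⊗_Λ Y → Y`. -/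
def contract [IsScalarTower k Λᵐᵒᵖ X] (ξ : X →ₗ[Λᵐᵒᵖ] Λ) : BalancedTensor k A Λ X Y →ₗ[k] Y :=
  lift (LinearMap.mk₂ k (fun x y => ξ x • y) (fun x x' y => by rw [map_add, add_smul])
    (fun c x y => by rw [LinearMap.map_smul_of_tower, smul_assoc])
    (fun x y y' => by rw [smul_add])
    fun c x y => by
      rw [← algebraMap_smul Λ c y, smul_smul, ← Algebra.commutes, ← smul_smul, algebraMap_smul])
    fun x a y => by
      simp only [LinearMap.mk₂_apply, map_smul, MulOpposite.smul_eq_mul_unop, MulOpposite.unop_op,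
        mul_smul]

@[simp]
lemma contract_mk [IsScalarTower k Λᵐᵒᵖ X] (ξ : X →ₗ[Λᵐᵒᵖ] Λ) (x : X) (y : Y) :
    contract ξ (mk k A Λ x y) = ξ x • y :=
  lift_mk ..

lemma contract_map [IsScalarTower k Λᵐᵒᵖ X] (ξ : X →ₗ[Λᵐᵒᵖ] Λ) (g : Y →ₗ[Λ] Y')
    (z : BalancedTensor k A Λ X Y) : contract ξ (map k A X g z) = g (contract ξ z) := by
  induction z using induction_on with
  | mk x y => simp
  | add z w hz hw => simp only [map_add, hz, hw]

end Map

/-- A finitely generated projective right module has a finite dual basis. -/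
lemma exists_dualBasis (Λ X : Type*) [Ring Λ] [AddCommGroup X] [Module Λᵐᵒᵖ X]
    [Module.Finite Λᵐᵒᵖ X] [Module.Projective Λᵐᵒᵖ X] :
    ∃ (n : ℕ) (b : Fin n → X) (ξ : Fin n → X →ₗ[Λᵐᵒᵖ] Λ),
      ∀ x, ∑ j, MulOpposite.op (ξ j x) • b j = x := by
  obtain ⟨n, f, g, -, -, hfg⟩ := Module.Finite.exists_comp_eq_id_of_projective Λᵐᵒᵖ X
  refine ⟨n, fun j => f (Pi.single j 1), fun j =>
    { toFun := fun x => (g x j).unop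
      map_add' := fun x y => by simp
      map_smul' := fun a x => by simp [MulOpposite.smul_eq_mul_unop] }, fun x => ?_⟩
  have h : f (g x) = x := LinearMap.congr_fun hfg x
  conv_rhs => rw [← h, ← Finset.univ_sum_single (g x), map_sum]
  refine Finset.sum_congr rfl fun j _ => ?_
  rw [LinearMap.coe_mk, AddHom.coe_mk, MulOpposite.op_unop, ← map_smul, ← Pi.single_smul,
    smul_eq_mul, mul_one]

lemma sum_mk_contract [SMulCommClass A Λᵐᵒᵖ X] [IsScalarTower k Λ Y] [IsScalarTower k Λᵐᵒᵖ X]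
    {n : ℕ} {b : Fin n → X} {ξ : Fin n → X →ₗ[Λᵐᵒᵖ] Λ}
    (hb : ∀ x, ∑ j, MulOpposite.op (ξ j x) • b j = x) (z : BalancedTensor k A Λ X Y) :
    ∑ j, mk k A Λ (b j) (contract (ξ j) z) = z := by
  induction z using induction_on with
  | mk x y =>
    conv_rhs => rw [← hb x]
    simp only [contract_mk, ← mk_op_smul]
    exact (map_sum (AddMonoidHom.mk' (fun x => mk k A Λ x y) fun x x' => add_mk x x' y) _ _).symm
  | add z w hz hw =>
    simp only [map_add, mk_add, Finset.sum_add_distrib, hz, hw]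

end BalancedTensor

/-! ### Tensoring lifts with a bimodule -/

section

variable {k : Type u} [Field k] {A Λ : Type u} [Ring A] [Algebra k A] [Ring Λ] [Algebra k Λ]
  {X : Type u} [AddCommGroup X] [Module k X] [Module A X] [Module Λᵐᵒᵖ X]
  [IsScalarTower k A X] [IsScalarTower k Λᵐᵒᵖ X] [SMulCommClass A Λᵐᵒᵖ X]

namespace BalancedTensor

variable {S : Type u} [CommRing S] {Y : Type u} [AddCommGroup Y] [Module k Y] [Module Λ Y]
  [IsScalarTower k Λ Y] [Module S Y] [SMulCommClass S Λ Y]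

lemma moduleRight_smul (s : S) (g : Y →ₗ[Λ] Y) (hg : ∀ y, g y = s • y)
    (z : BalancedTensor k A Λ X Y) :
    letI := moduleRight k A Λ X Y S
    s • z = map k A X g z := by
  have : SMulCommClass Λ S Y := SMulCommClass.symm S Λ Y
  have e : g = Module.toModuleEnd Λ (S := S) Y s := LinearMap.ext hg
  rw [e]
  rfl

lemma moduleRight_smul_mk (s : S) (x : X) (y : Y) :
    letI := moduleRight k A Λ X Y S
    s • mk k A Λ x y = mk k A Λ x (s • y) := rfl

lemma moduleRight_contract (s : S) (ξ : X →ₗ[Λᵐᵒᵖ] Λ) (z : BalancedTensor k A Λ X Y) :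
    letI := moduleRight k A Λ X Y S
    contract ξ (s • z) = s • contract ξ z := by
  have : SMulCommClass Λ S Y := SMulCommClass.symm S Λ Y
  exact contract_map ξ (Module.toModuleEnd Λ (S := S) Y s) z

lemma moduleRight_smulCommClass :
    letI := moduleRight k A Λ X Y S
    SMulCommClass S A (BalancedTensor k A Λ X Y) :=
  letI := moduleRight k A Λ X Y S
  haveI : SMulCommClass Λ S Y := SMulCommClass.symm S Λ Y
  ⟨fun s a z => (map k A X (Module.toModuleEnd Λ (S := S) Y s)).map_smul a z⟩

/-- If `X` is finitely generated projective on the right, `X ⊗_Λ Y` is a summand of a power of `Y`,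
naturally in `Y`. -/
lemma exists_retract_pi (k A Λ X S Y : Type u) [Field k] [Ring A] [Algebra k A] [Ring Λ]
    [Algebra k Λ] [AddCommGroup X] [Module k X] [Module A X] [Module Λᵐᵒᵖ X]
    [IsScalarTower k A X] [IsScalarTower k Λᵐᵒᵖ X] [SMulCommClass A Λᵐᵒᵖ X] [CommRing S]
    [AddCommGroup Y] [Module k Y] [Module Λ Y]
    [IsScalarTower k Λ Y] [Module S Y] [SMulCommClass S Λ Y]
    [Module.Finite Λᵐᵒᵖ X] [Module.Projective Λᵐᵒᵖ X] :
    letI := moduleRight k A Λ X Y S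
    ∃ (n : ℕ) (b : Fin n → X) (ξ : Fin n → X →ₗ[Λᵐᵒᵖ] Λ)
      (i : BalancedTensor k A Λ X Y →ₗ[S] Fin n → Y)
      (r : (Fin n → Y) →ₗ[S] BalancedTensor k A Λ X Y),
      (∀ z j, i z j = contract (ξ j) z) ∧ (∀ y, r y = ∑ j, mk k A Λ (b j) (y j)) ∧
        r ∘ₗ i = LinearMap.id := by
  let _ := moduleRight k A Λ X Y S
  obtain ⟨n, b, ξ, hb⟩ := exists_dualBasis Λ X
  refine ⟨n, b, ξ, LinearMap.pi fun j =>
    { toFun := contract (ξ j), map_add' := map_add _, map_smul' := fun s z =>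
        moduleRight_contract s (ξ j) z },
    { toFun := fun y => ∑ j, mk k A Λ (b j) (y j)
      map_add' := fun y y' => by simp only [Pi.add_apply, mk_add, Finset.sum_add_distrib]
      map_smul' := fun s y => by
        simp only [Pi.smul_apply, RingHom.id_apply, Finset.smul_sum]
        rfl },
    fun _ _ => rfl, fun _ => rfl, LinearMap.ext fun z => sum_mk_contract hb z⟩

end BalancedTensor

namespace Lift

open BalancedTensor

variable [Module.Finite Λᵐᵒᵖ X] [Module.Projective Λᵐᵒᵖ X]
  {V : Type u} [AddCommGroup V] [Module k V] [Module Λ V] [IsScalarTower k Λ V] {R S : CHat k}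

variable (X)

lemma finite_tensor (L : Lift k Λ V R) :
    letI := moduleRight k A Λ X L R
    Module.Finite R (BalancedTensor k A Λ X L) := by
  let _ := moduleRight k A Λ X L R
  obtain ⟨n, b, ξ, i, r, -, -, h⟩ := exists_retract_pi k A Λ X R L
  exact Module.Finite.of_surjective r fun z => ⟨i z, LinearMap.congr_fun h z⟩

lemma free_tensor (L : Lift k Λ V R) :
    letI := moduleRight k A Λ X L R
    Module.Free R (BalancedTensor k A Λ X L) := by
  let _ := moduleRight k A Λ X L R
  have := finite_tensor (A := A) X L
  obtain ⟨n, b, ξ, i, r, -, -, h⟩ := exists_retract_pi k A Λ X R L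
  have : Module.Projective R (BalancedTensor k A Λ X L) := Module.Projective.of_split i r h
  exact Module.free_of_flat_of_isLocalRing

/-- The lift `X ⊗_Λ L` of `X ⊗_Λ V`. -/
noncomputable def tensor (L : Lift k Λ V R) : Lift k A (BalancedTensor k A Λ X V) R :=
  letI := moduleRight k A Λ X L R
  haveI := moduleRight_smulCommClass (k := k) (A := A) (Λ := Λ) (X := X) (Y := L) (S := R)
  haveI := finite_tensor (A := A) X L
  haveI := free_tensor (A := A) X L
  ofπ (BalancedTensor k A Λ X L)
    (fun c z => by
      induction z using BalancedTensor.induction_on with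
      | mk x y =>
        rw [moduleRight_smul_mk, L.algebraMap_smul, mk_smul', smul_mk', smul_mk,
          _root_.algebraMap_smul]
      | add z w hz hw => rw [smul_add, smul_add, hz, hw])
    (BalancedTensor.map k A X L.π)
    (fun z => by
      induction z using BalancedTensor.induction_on with
      | mk x y =>
        obtain ⟨l, rfl⟩ := L.π_surjective y
        exact ⟨BalancedTensor.mk k A Λ x l, rfl⟩
      | add z w hz hw =>
        obtain ⟨z', rfl⟩ := hz
        obtain ⟨w', rfl⟩ := hw
        exact ⟨z' + w', map_add _ _ _⟩)
    fun z => by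
      obtain ⟨n, b, ξ, i, r, hi, hr, h⟩ := exists_retract_pi k A Λ X R L
      constructor
      · intro hz
        have h1 : ∀ j, i z j ∈ R.𝔪 • (⊤ : Submodule R L) := fun j => by
          rw [← L.π_eq_zero_iff, hi, ← contract_map, hz, map_zero]
        have h2 : i z ∈ R.𝔪 • (⊤ : Submodule R (Fin n → L)) := by
          rw [← Finset.univ_sum_single (i z)]
          refine Submodule.sum_mem _ fun j _ => ?_
          have h3 := Submodule.mem_map_of_mem
            (f := LinearMap.single R (fun _ : Fin n => L) j) (h1 j)
          rw [Submodule.map_smul''] at h3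
          exact Submodule.smul_mono le_rfl le_top h3
        have h3 := Submodule.mem_map_of_mem (f := r) h2
        rw [Submodule.map_smul'', show r (i z) = z from LinearMap.congr_fun h z] at h3
        exact Submodule.smul_mono le_rfl le_top h3
      · intro hz
        induction hz using Submodule.smul_induction_on' with
        | smul s hs z _ =>
          have hcomm : SMulCommClass Λ R L := SMulCommClass.symm R Λ L
          have h0 : L.π ∘ₗ Module.toModuleEnd Λ (S := R) L s = 0 := LinearMap.ext fun x =>
            L.π_eq_zero_iff.2 (Submodule.smul_mem_smul hs trivial)
          rw [moduleRight_smul s (Module.toModuleEnd Λ (S := R) L s) (fun _ => rfl), ← map_comp, h0,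
            map_zero_left]
        | add z _ w _ hz hw => rw [map_add, hz, hw, add_zero]

variable {X}

lemma tensor_π (L : Lift k Λ V R) (z : L.tensor X (A := A)) :
    (L.tensor X).π z = BalancedTensor.map k A X L.π z := by
  let _ := moduleRight k A Λ X L R
  have := moduleRight_smulCommClass (k := k) (A := A) (Λ := Λ) (X := X) (Y := L) (S := R)
  have := finite_tensor (A := A) X L
  have := free_tensor (A := A) X L
  exact ofπ_π (BalancedTensor k A Λ X L) _ _ _ _ z

lemma tensor_smul (L : Lift k Λ V R) (r : R) (g : L →ₗ[Λ] L) (hg : ∀ y, g y = r • y)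
    (z : L.tensor X (A := A)) : r • z = BalancedTensor.map k A X g z :=
  moduleRight_smul r g hg z

/-- Multiplication by an element of `R`, as an endomorphism of the `Λ`-module underlying a lift. -/
def smulEnd (L : Lift k Λ V R) (r : R) : L →ₗ[Λ] L where
  toFun x := r • x
  map_add' := smul_add r
  map_smul' a x := smul_comm r a x

lemma MapsTo.tensor {ψ : R ⟶ S} {L : Lift k Λ V R} {L' : Lift k Λ V S} (h : MapsTo ψ L L') :
    MapsTo ψ (L.tensor X (A := A)) (L'.tensor X) := by
  obtain ⟨u, h1, h2, h3⟩ := h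
  let u' : L →ₗ[Λ] L' := { u with map_smul' := h2 }
  refine ⟨(BalancedTensor.map k A X u').toAddMonoidHom, fun r z => ?_,
    fun a z => (BalancedTensor.map k A X u').map_smul a z, fun z => ?_⟩
  · have e : u' ∘ₗ L.smulEnd r = L'.smulEnd (ψ.toAlgHom r) ∘ₗ u' := LinearMap.ext fun x => h1 r x
    have key : ∀ z : BalancedTensor k A Λ X L,
        BalancedTensor.map k A X u' (BalancedTensor.map k A X (L.smulEnd r) z) =
          BalancedTensor.map k A X (L'.smulEnd (ψ.toAlgHom r)) (BalancedTensor.map k A X u' z) :=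
      fun z => by rw [← map_comp, ← map_comp, e]
    exact (congrArg (BalancedTensor.map k A X u')
      (tensor_smul L r (L.smulEnd r) (fun _ => rfl) z)).trans ((key z).trans
        (tensor_smul L' (ψ.toAlgHom r) (L'.smulEnd (ψ.toAlgHom r)) (fun _ => rfl) _).symm)
  · have key : ∀ z : BalancedTensor k A Λ X L, BalancedTensor.map k A X L'.π
        (BalancedTensor.map k A X u' z) = BalancedTensor.map k A X L.π z := fun z => by
      rw [← map_comp, show L'.π ∘ₗ u' = L.π from LinearMap.ext h3]
    exact (tensor_π L' _).trans ((key z).trans (tensor_π L z).symm)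

end Lift

end

/-! ### Associativity and splittings of tensor products -/

namespace BalancedTensor

variable {k : Type u} [Field k] {Λ Γ : Type u} [Ring Λ] [Algebra k Λ] [Ring Γ] [Algebra k Γ]
  {X : Type u} [AddCommGroup X] [Module k X] [Module Γ X] [Module Λᵐᵒᵖ X]
  [IsScalarTower k Γ X] [IsScalarTower k Λᵐᵒᵖ X] [SMulCommClass Γ Λᵐᵒᵖ X]
  {Y : Type u} [AddCommGroup Y] [Module k Y] [Module Λ Y] [Module Γᵐᵒᵖ Y]
  [IsScalarTower k Λ Y] [IsScalarTower k Γᵐᵒᵖ Y] [SMulCommClass Λ Γᵐᵒᵖ Y]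
  {M : Type u} [AddCommGroup M] [Module k M] [Module Λ M] [IsScalarTower k Λ M]
  {M' : Type u} [AddCommGroup M'] [Module k M'] [Module Λ M'] [IsScalarTower k Λ M']

variable (k Γ Λ X) in
/-- The map `x ↦ x ⊗ m`. -/
def insert (m : M) : X →ₗ[Γ] BalancedTensor k Γ Λ X M where
  toFun x := mk k Γ Λ x m
  map_add' x x' := add_mk x x' m
  map_smul' _ _ := rfl

@[simp]
lemma insert_apply (m : M) (x : X) : insert k Λ Γ X m x = mk k Γ Λ x m := rfl

variable (k Λ Γ Y X M) in
/-- The associativity map `(y ⊗ x, m) ↦ y ⊗ (x ⊗ m)`. -/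
def assoc : M →ₗ[k] BalancedTensor k Λ Γ Y X →ₗ[k]
    BalancedTensor k Λ Γ Y (BalancedTensor k Γ Λ X M) :=
  LinearMap.mk₂ k (fun m w => map k Λ Y (insert k Λ Γ X m) w)
    (fun m m' w => by
      induction w using induction_on with
      | mk y x => simp [mk_add]
      | add z w hz hw => simp only [map_add, hz, hw]; abel)
    (fun c m w => by
      induction w using induction_on with
      | mk y x => simp [mk_smul']
      | add z w hz hw => simp only [map_add, hz, hw, smul_add])
    (fun m w w' => map_add _ _ _)
    (fun c m w => LinearMap.map_smul_of_tower _ c w)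

@[simp]
lemma assoc_mk (m : M) (y : Y) (x : X) :
    assoc k Λ Γ X Y M m (mk k Λ Γ y x) = mk k Λ Γ y (mk k Γ Λ x m) := rfl

lemma assoc_smul (a : Λ) (m : M) (w : BalancedTensor k Λ Γ Y X) :
    assoc k Λ Γ X Y M (a • m) w =
      assoc k Λ Γ X Y M m (rightMul k Λ Γ Y X Λ a w) := by
  induction w using induction_on with
  | mk y x => simp [rightMul_mk, mk_op_smul]
  | add z w hz hw => simp only [map_add, hz, hw]

section

variable {N : Type u} [AddCommGroup N] [Module k N] [Module Λ N]
  (v : BalancedTensor k Λ Γ Y X →ₗ[k] M →ₗ[k] N)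
  (hv : ∀ (a : Λ) w m, v (a • w) m = a • v w m)
  (hv' : ∀ (a : Λ) w m, v w (a • m) = v (rightMul k Λ Γ Y X Λ a w) m)

/-- For `y` in `Y`, the map `x ⊗ m ↦ v (y ⊗ x) m`. -/
def liftAssocAux (y : Y) : BalancedTensor k Γ Λ X M →ₗ[k] N :=
  lift (LinearMap.mk₂ k (fun x m => v (mk k Λ Γ y x) m)
    (fun x x' m => by rw [mk_add, map_add, LinearMap.add_apply])
    (fun c x m => by rw [mk_smul', map_smul, LinearMap.smul_apply])
    (fun x m m' => by rw [map_add])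
    fun c x m => by rw [map_smul])
    fun x a m => by
      simp only [LinearMap.mk₂_apply]
      rw [hv', rightMul_mk]

lemma liftAssocAux_mk (y : Y) (x : X) (m : M) :
    liftAssocAux v hv' y (mk k Γ Λ x m) = v (mk k Λ Γ y x) m :=
  TensorProduct.lift.tmul _ _

/-- The bilinear map `(y, x ⊗ m) ↦ v (y ⊗ x) m`. -/
def liftAssocBilin : Y →ₗ[k] BalancedTensor k Γ Λ X M →ₗ[k] N :=
  LinearMap.mk₂ k (fun y z => liftAssocAux v hv' y z)
    (fun y y' z => by
      induction z using induction_on with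
      | mk x m => simp only [liftAssocAux_mk]; rw [add_mk, map_add, LinearMap.add_apply]
      | add z w hz hw => simp only [map_add, hz, hw]; abel)
    (fun c y z => by
      induction z using induction_on with
      | mk x m => simp only [liftAssocAux_mk]; rw [← smul_mk', map_smul, LinearMap.smul_apply]
      | add z w hz hw => simp only [map_add, hz, hw, smul_add])
    (fun y z z' => map_add _ _ _)
    (fun c y z => map_smul _ _ _)

lemma liftAssocBilin_mk (y : Y) (x : X) (m : M) :
    liftAssocBilin v hv' y (mk k Γ Λ x m) = v (mk k Λ Γ y x) m :=
  TensorProduct.lift.tmul _ _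

lemma liftAssocBilin_balanced (y : Y) (b : Γ) (z : BalancedTensor k Γ Λ X M) :
    liftAssocBilin v hv' (MulOpposite.op b • y) z = liftAssocBilin v hv' y (b • z) := by
  induction z using induction_on with
  | mk x m => rw [smul_mk, liftAssocBilin_mk, liftAssocBilin_mk, mk_op_smul]
  | add z w hz hw => simp only [map_add, smul_add, hz, hw]

/-- The universal property of `Y ⊗_Γ (X ⊗_Λ M) = (Y ⊗_Γ X) ⊗_Λ M`. -/
def liftAssoc : BalancedTensor k Λ Γ Y (BalancedTensor k Γ Λ X M) →ₗ[Λ] N :=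
  { lift (A := Λ) (Λ := Γ) (liftAssocBilin v hv') (liftAssocBilin_balanced v hv') with
    map_smul' := fun a t => by
      change lift (A := Λ) (Λ := Γ) (liftAssocBilin v hv') _ (a • t) =
        a • lift (A := Λ) (Λ := Γ) (liftAssocBilin v hv') _ t
      induction t using induction_on with
      | mk y z =>
        rw [smul_mk, lift_mk, lift_mk]
        induction z using induction_on with
        | mk x m => rw [liftAssocBilin_mk, liftAssocBilin_mk, ← smul_mk, hv]
        | add z w hz hw => simp only [map_add, smul_add, hz, hw]
      | add z w hz hw => simp only [map_add, smul_add, hz, hw] }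

lemma liftAssoc_mk (y : Y) (x : X) (m : M) :
    liftAssoc v hv hv' (mk k Λ Γ y (mk k Γ Λ x m)) = v (mk k Λ Γ y x) m :=
  liftAssocBilin_mk v hv' y x m

end

lemma induction_assoc {motive : BalancedTensor k Λ Γ Y (BalancedTensor k Γ Λ X M) → Prop}
    (z : BalancedTensor k Λ Γ Y (BalancedTensor k Γ Λ X M))
    (mk : ∀ y x m, motive (mk k Λ Γ y (mk k Γ Λ x m)))
    (add : ∀ z w, motive z → motive w → motive (z + w)) : motive z := by
  induction z using induction_on with
  | mk y z =>
    induction z using induction_on with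
    | mk x m => exact mk y x m
    | add z w hz hw => rw [mk_add]; exact add _ _ hz hw
  | add z w hz hw => exact add z w hz hw

lemma liftAssoc_assoc {N : Type u} [AddCommGroup N] [Module k N] [Module Λ N]
    (v : BalancedTensor k Λ Γ Y X →ₗ[k] M →ₗ[k] N) (hv hv') (w : BalancedTensor k Λ Γ Y X) (m : M) :
    liftAssoc v hv hv' (assoc k Λ Γ X Y M m w) = v w m := by
  induction w using induction_on with
  | mk y x => rw [assoc_mk, liftAssoc_mk]
  | add z w hz hw => rw [map_add, map_add, hz, hw, map_add, LinearMap.add_apply]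

section Splitting

variable {P : Type u} [AddCommGroup P] [Module k P] [Module Λ P] [Module Λᵐᵒᵖ P]
  [IsScalarTower k Λ P] [IsScalarTower k Λᵐᵒᵖ P] [SMulCommClass Λ Λᵐᵒᵖ P]
  (e : BalancedTensor k Λ Γ Y X ≃ₗ[Λ] Λ × P)
  (he : ∀ (a : Λ) (t : BalancedTensor k Λ Γ Y X),
    e (rightMul k Λ Γ Y X Λ a t) = MulOpposite.op a • e t)

/-- The bilinear map underlying `splitHom`. -/
def splitBilin : BalancedTensor k Λ Γ Y X →ₗ[k] M →ₗ[k] M × BalancedTensor k Λ Λ P M :=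
  have hek : ∀ (c : k) w, e (c • w) = c • e w := fun c w =>
    LinearMap.map_smul_of_tower e.toLinearMap c w
  LinearMap.mk₂ k (fun w m => ((e w).1 • m, mk k Λ Λ (e w).2 m))
    (fun w w' m => by
      rw [map_add]
      exact Prod.ext (add_smul _ _ _) (add_mk _ _ _))
    (fun c w m => by
      rw [hek]
      exact Prod.ext (smul_assoc _ _ _) rfl)
    (fun w m m' => Prod.ext (smul_add _ _ _) (mk_add _ _ _))
    (fun c w m => by
      refine Prod.ext ?_ (mk_smul' _ _ _)
      change (e w).1 • c • m = c • (e w).1 • m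
      rw [← algebraMap_smul Λ c m, smul_smul, ← Algebra.commutes, ← smul_smul, algebraMap_smul])

lemma splitBilin_apply (w : BalancedTensor k Λ Γ Y X) (m : M) :
    splitBilin e w m = ((e w).1 • m, mk k Λ Λ (e w).2 m) := rfl

/-- An isomorphism of bimodules `Y ⊗_Γ X ≅ Λ ⊕ P` gives `Y ⊗_Γ (X ⊗_Λ M) → M ⊕ P ⊗_Λ M`. -/
def splitHom : BalancedTensor k Λ Γ Y (BalancedTensor k Γ Λ X M) →ₗ[Λ]
    M × BalancedTensor k Λ Λ P M :=
  liftAssoc (splitBilin e)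
    (fun a w m => by
      rw [splitBilin_apply, splitBilin_apply, map_smul]
      exact Prod.ext (mul_smul _ _ _) rfl)
    (fun a w m => by
      rw [splitBilin_apply, splitBilin_apply, he]
      exact Prod.ext (smul_smul _ _ _) (mk_op_smul _ _ _).symm)

lemma splitHom_mk (y : Y) (x : X) (m : M) :
    splitHom e he (mk k Λ Γ y (mk k Γ Λ x m)) =
      ((e (mk k Λ Γ y x)).1 • m, mk k Λ Λ (e (mk k Λ Γ y x)).2 m) :=
  liftAssoc_mk ..

lemma splitHom_assoc (w : BalancedTensor k Λ Γ Y X) (m : M) :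
    splitHom e he (assoc k Λ Γ X Y M m w) = ((e w).1 • m, mk k Λ Λ (e w).2 m) :=
  liftAssoc_assoc ..

lemma splitHom_map (g : M →ₗ[Λ] M') (z : BalancedTensor k Λ Γ Y (BalancedTensor k Γ Λ X M)) :
    splitHom e he (map k Λ Y (map k Γ X g) z) =
      (g (splitHom e he z).1, map k Λ P g (splitHom e he z).2) := by
  induction z using induction_assoc with
  | mk y x m => rw [map_mk, map_mk, splitHom_mk, splitHom_mk, map_smul, map_mk]
  | add z w hz hw => simp only [map_add, hz, hw, Prod.fst_add, Prod.snd_add, Prod.mk_add_mk]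

/-- The isomorphism `Y ⊗_Γ (X ⊗_Λ M) ≅ M ⊕ P ⊗_Λ M`. -/
noncomputable def splitEquiv : BalancedTensor k Λ Γ Y (BalancedTensor k Γ Λ X M) ≃ₗ[Λ]
    M × BalancedTensor k Λ Λ P M := by
  let K : BalancedTensor k Λ Λ P M →ₗ[k] BalancedTensor k Λ Γ Y (BalancedTensor k Γ Λ X M) :=
    lift (LinearMap.mk₂ k (fun p m => assoc k Λ Γ X Y M m (e.symm (0, p)))
      (fun p p' m => by rw [← map_add, ← map_add]; simp)
      (fun c p m => by
        have h : e.symm (c • (0, p)) = c • e.symm (0, p) :=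
          LinearMap.map_smul_of_tower e.symm.toLinearMap c _
        rw [← map_smul, ← h]; simp)
      (fun p m m' => by rw [map_add, LinearMap.add_apply])
      (fun c p m => by rw [map_smul, LinearMap.smul_apply]))
      fun p a m => by
        simp only [LinearMap.mk₂_apply]
        rw [assoc_smul]
        congr 1
        rw [LinearEquiv.symm_apply_eq, he, LinearEquiv.apply_symm_apply]
        simp
  have hK : ∀ p m, K (mk k Λ Λ p m) = assoc k Λ Γ X Y M m (e.symm (0, p)) := fun p m => lift_mk ..
  refine LinearEquiv.ofBijective (splitHom e he) ⟨?_, ?_⟩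
  · refine Function.LeftInverse.injective (g := fun t =>
      assoc k Λ Γ X Y M t.1 (e.symm (1, 0)) + K t.2) fun z => ?_
    induction z using induction_assoc with
    | mk y x m =>
      rw [splitHom_mk]
      simp only [hK]
      rw [assoc_smul, ← map_add, ← assoc_mk]
      congr 1
      apply e.injective
      rw [map_add, he, LinearEquiv.apply_symm_apply, LinearEquiv.apply_symm_apply]
      simp
    | add z w hz hw =>
      conv_rhs => rw [← hz, ← hw]
      simp only [map_add, Prod.fst_add, Prod.snd_add, LinearMap.add_apply]
      abel
  · rintro ⟨m, z⟩
    have h1 : splitHom e he (assoc k Λ Γ X Y M m (e.symm (1, 0))) = (m, 0) := by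
      rw [splitHom_assoc]
      simp only [LinearEquiv.apply_symm_apply, one_smul]
      refine Prod.ext rfl ?_
      simp [mk]
    have h2 : ∃ t, splitHom e he t = ((0 : M), z) := by
      induction z using induction_on with
      | mk p m =>
        refine ⟨assoc k Λ Γ X Y M m (e.symm (0, p)), ?_⟩
        rw [splitHom_assoc]
        simp
      | add z w hz hw =>
        obtain ⟨t, ht⟩ := hz
        obtain ⟨t', ht'⟩ := hw
        exact ⟨t + t', by rw [map_add, ht, ht']; simp⟩
    obtain ⟨t, ht⟩ := h2
    exact ⟨_ + t, by rw [map_add, h1, ht]; simp⟩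

lemma splitEquiv_apply (z : BalancedTensor k Λ Γ Y (BalancedTensor k Γ Λ X M)) :
    splitEquiv e he z = splitHom e he z := rfl

lemma map_splitEquiv_symm (g : M →ₗ[Λ] M') (m : M) :
    map k Λ Y (map k Γ X g) ((splitEquiv e he).symm (m, 0)) =
      (splitEquiv e he).symm (g m, 0) := by
  rw [LinearEquiv.eq_symm_apply, splitEquiv_apply, splitHom_map, ← splitEquiv_apply e he,
    LinearEquiv.apply_symm_apply, map_zero]

end Splitting

end BalancedTensor

/-! ### Versality along a singular equivalence -/

namespace Lift

open BalancedTensor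

variable {k : Type u} [Field k] {Λ Γ : Type u} [Ring Λ] [Algebra k Λ] [Ring Γ] [Algebra k Γ]
  {X : Type u} [AddCommGroup X] [Module k X] [Module Γ X] [Module Λᵐᵒᵖ X]
  [IsScalarTower k Γ X] [IsScalarTower k Λᵐᵒᵖ X] [SMulCommClass Γ Λᵐᵒᵖ X]
  {Y : Type u} [AddCommGroup Y] [Module k Y] [Module Λ Y] [Module Γᵐᵒᵖ Y]
  [IsScalarTower k Λ Y] [IsScalarTower k Γᵐᵒᵖ Y] [SMulCommClass Λ Γᵐᵒᵖ Y]
  {V : Type u} [AddCommGroup V] [Module k V] [Module Λ V] [IsScalarTower k Λ V] {R S : CHat k}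
  {P : Type u} [AddCommGroup P] [Module k P] [Module Λ P] [Module Λᵐᵒᵖ P]
  [IsScalarTower k Λ P] [IsScalarTower k Λᵐᵒᵖ P] [SMulCommClass Λ Λᵐᵒᵖ P]
  [Module.Finite Λᵐᵒᵖ X] [Module.Projective Λᵐᵒᵖ X]

/-- If `Λ` is a direct summand of the bimodule `Y ⊗_Γ X`, then `X ⊗_Λ -` is faithful on
deformations: `L` is a natural summand of `Y ⊗_Γ (X ⊗_Λ L)`. -/
lemma MapsTo.of_tensor (e : BalancedTensor k Λ Γ Y X ≃ₗ[Λ] Λ × P)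
    (he : ∀ (a : Λ) (t : BalancedTensor k Λ Γ Y X),
      e (rightMul k Λ Γ Y X Λ a t) = MulOpposite.op a • e t)
    {ψ : R ⟶ S} {L : Lift k Λ V R} {L' : Lift k Λ V S}
    (h : MapsTo ψ (L.tensor X (A := Γ)) (L'.tensor X)) : MapsTo ψ L L' := by
  obtain ⟨u, h1, h2, h3⟩ := h
  let u' : BalancedTensor k Γ Λ X L →ₗ[Γ] BalancedTensor k Γ Λ X L' := { u with map_smul' := h2 }
  have h1' : ∀ r, u' ∘ₗ BalancedTensor.map k Γ X (L.smulEnd r) =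
      BalancedTensor.map k Γ X (L'.smulEnd (ψ.toAlgHom r)) ∘ₗ u' := fun r =>
    LinearMap.ext fun z => (congrArg u (tensor_smul L r (L.smulEnd r) (fun _ => rfl) z).symm).trans
      ((h1 r z).trans (tensor_smul L' (ψ.toAlgHom r) (L'.smulEnd _) (fun _ => rfl) (u z)))
  have h3' : BalancedTensor.map k Γ X L'.π ∘ₗ u' = BalancedTensor.map k Γ X L.π :=
    LinearMap.ext fun z => (tensor_π L' (u z)).symm.trans ((h3 z).trans (tensor_π L z))
  let w : L →ₗ[Λ] L' := LinearMap.fst Λ L' (BalancedTensor k Λ Λ P L') ∘ₗ splitHom e he ∘ₗ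
    BalancedTensor.map k Λ Y u' ∘ₗ (splitEquiv e he).symm.toLinearMap ∘ₗ
      LinearMap.inl Λ L (BalancedTensor k Λ Λ P L)
  have hw : ∀ x, w x =
      (splitHom e he (BalancedTensor.map k Λ Y u' ((splitEquiv e he).symm (x, 0)))).1 :=
    fun x => rfl
  refine ⟨w.toAddMonoidHom, fun r x => ?_, fun a x => w.map_smul a x, fun x => ?_⟩
  · change w (L.smulEnd r x) = L'.smulEnd (ψ.toAlgHom r) (w x)
    rw [hw, hw, ← map_splitEquiv_symm, ← BalancedTensor.map_comp, h1', BalancedTensor.map_comp,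
      splitHom_map]
  · change L'.π (w x) = _
    have : L'.π (w x) = (splitHom e he (BalancedTensor.map k Λ Y (BalancedTensor.map k Γ X L'.π)
        (BalancedTensor.map k Λ Y u' ((splitEquiv e he).symm (x, 0))))).1 := by
      rw [splitHom_map, hw]
    rw [this, ← BalancedTensor.map_comp, h3', map_splitEquiv_symm, ← splitEquiv_apply,
      LinearEquiv.apply_symm_apply]

variable [Module.Finite Γᵐᵒᵖ Y] [Module.Projective Γᵐᵒᵖ Y]

/-- The natural projection `Y ⊗_Γ (X ⊗_Λ L) → L`. -/
lemma exists_tensor_tensor_fst (e : BalancedTensor k Λ Γ Y X ≃ₗ[Λ] Λ × P)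
    (he : ∀ (a : Λ) (t : BalancedTensor k Λ Γ Y X),
      e (rightMul k Λ Γ Y X Λ a t) = MulOpposite.op a • e t) (L : Lift k Λ V S) :
    ∃ w : (L.tensor X (A := Γ)).tensor Y (A := Λ) →ₗ[S] L,
      (∀ (a : Λ) z, w (a • z) = a • w z) ∧
      ∀ z, L.π (w z) = (splitEquiv e he (((L.tensor X (A := Γ)).tensor Y (A := Λ)).π z)).1 := by
  -- the two `k`-module structures on `X ⊗_Λ L`, as a tensor product and as a lift, are equal but
  -- not definitionally so
  let j : L.tensor X (A := Γ) →ₗ[Γ] BalancedTensor k Γ Λ X L :=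
    { toFun := fun z => z, map_add' := fun _ _ => rfl, map_smul' := fun _ _ => rfl }
  let J : (L.tensor X (A := Γ)).tensor Y (A := Λ) →ₗ[Λ]
      BalancedTensor k Λ Γ Y (BalancedTensor k Γ Λ X L) := BalancedTensor.map k Λ Y j
  let w : (L.tensor X (A := Γ)).tensor Y (A := Λ) →ₗ[Λ] L :=
    LinearMap.fst Λ L (BalancedTensor k Λ Λ P L) ∘ₗ splitHom e he ∘ₗ J
  have hw : ∀ z, w z = (splitHom e he (J z)).1 := fun z => rfl
  have hJS : ∀ (s : S) z, J (s • z) =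
      BalancedTensor.map k Λ Y (BalancedTensor.map k Γ X (L.smulEnd s)) (J z) := fun s z => by
    have h : j ∘ₗ (L.tensor X (A := Γ)).smulEnd s =
        BalancedTensor.map k Γ X (L.smulEnd s) ∘ₗ j :=
      LinearMap.ext fun y => tensor_smul L s (L.smulEnd s) (fun _ => rfl) y
    have h' : ∀ z : BalancedTensor k Λ Γ Y (L.tensor X (A := Γ)), BalancedTensor.map k Λ Y j
        (BalancedTensor.map k Λ Y ((L.tensor X (A := Γ)).smulEnd s) z) =
        BalancedTensor.map k Λ Y (BalancedTensor.map k Γ X (L.smulEnd s))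
          (BalancedTensor.map k Λ Y j z) := fun z => by
      rw [← BalancedTensor.map_comp, ← BalancedTensor.map_comp, h]
    exact (congrArg J (tensor_smul (L.tensor X (A := Γ)) s _ (fun _ => rfl) z)).trans (h' z)
  have hJπ : ∀ z, BalancedTensor.map k Λ Y (BalancedTensor.map k Γ X L.π) (J z) =
      ((L.tensor X (A := Γ)).tensor Y (A := Λ)).π z := fun z => by
    have h : BalancedTensor.map k Γ X L.π ∘ₗ j = (L.tensor X (A := Γ)).π :=
      LinearMap.ext fun y => (tensor_π L y).symm
    have h' : ∀ z : BalancedTensor k Λ Γ Y (L.tensor X (A := Γ)),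
        BalancedTensor.map k Λ Y (BalancedTensor.map k Γ X L.π) (BalancedTensor.map k Λ Y j z) =
          BalancedTensor.map k Λ Y (L.tensor X (A := Γ)).π z := fun z => by
      rw [← BalancedTensor.map_comp, h]
    exact (h' z).trans (tensor_π (L.tensor X (A := Γ)) z).symm
  refine ⟨{ toFun := w, map_add' := w.map_add, map_smul' := fun s z => ?_ },
    fun a z => w.map_smul a z, fun z => ?_⟩
  · rw [hw, hJS, splitHom_map, hw]
    rfl
  · change L.π (w z) = _
    rw [hw, ← hJπ, splitEquiv_apply, splitHom_map]

/-- If `W ≅ V ⊕ E₀` and `Ext¹(W, E₀) = 0`, a lift `T` of `W` which maps to a lift `L` of `V`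
compatibly with the projection is isomorphic to the sum of `L` and any lift of `E₀`. -/
lemma mapsTo_congr_prod {W E₀ : Type u} [AddCommGroup W] [Module k W] [Module Λ W]
    [IsScalarTower k Λ W] [AddCommGroup E₀] [Module k E₀] [Module Λ E₀] [IsScalarTower k Λ E₀]
    [Module.Finite k W] (hD : DerivationsInner k Λ W E₀) (E : W ≃ₗ[Λ] V × E₀)
    (T : Lift k Λ W S) (L : Lift k Λ V S) (K : Lift k Λ E₀ S) (w : T →ₗ[S] L)
    (hw : ∀ (a : Λ) z, w (a • z) = a • w z) (hwπ : ∀ z, L.π (w z) = (E (T.π z)).1) :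
    MapsTo (𝟙 S) (T.congr E) (L.prod K) := by
  obtain ⟨F, hF, hFπ⟩ := exists_hom_lift hD T K (LinearMap.snd Λ V E₀ ∘ₗ E.toLinearMap)
  exact ⟨(w.toAddMonoidHom.prod F.toAddMonoidHom : T →+ L × K),
    fun s z => Prod.ext (w.map_smul s z) (F.map_smul s z),
    fun a z => Prod.ext (hw a z) (hF a z),
    fun z => (prod_π L K _).trans (Prod.ext (hwπ z) (hFπ z))⟩

variable {Q : Type u} [AddCommGroup Q] [Module k Q] [Module Γ Q] [Module Γᵐᵒᵖ Q]
  [IsScalarTower k Γ Q] [IsScalarTower k Γᵐᵒᵖ Q] [SMulCommClass Γ Γᵐᵒᵖ Q]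

/-- Every lift `N` of `X ⊗_Λ V` comes from a lift of `V`: the lift `Y ⊗_Γ N` of
`V ⊕ P ⊗_Λ V` splits off a lift `L` of `V`, and then `Y ⊗_Γ (X ⊗_Λ L) ≅ Y ⊗_Γ N`, whence
`X ⊗_Λ L ≅ N` because `Y ⊗_Γ -` is faithful on deformations. -/
lemma exists_mapsTo_tensor (e : BalancedTensor k Λ Γ Y X ≃ₗ[Λ] Λ × P)
    (he : ∀ (a : Λ) (t : BalancedTensor k Λ Γ Y X),
      e (rightMul k Λ Γ Y X Λ a t) = MulOpposite.op a • e t)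
    (e' : BalancedTensor k Γ Λ X Y ≃ₗ[Γ] Γ × Q)
    (he' : ∀ (a : Γ) (t : BalancedTensor k Γ Λ X Y),
      e' (rightMul k Γ Λ X Y Γ a t) = MulOpposite.op a • e' t)
    [Module.Finite k Λ] [Module.Finite k X] [Module.Finite k Y] [Module.Finite k P]
    [Module.Finite k V] [Module.Projective Λ (BalancedTensor k Λ Λ P V)]
    (hD : DerivationsInner k Λ V (BalancedTensor k Λ Λ P V))
    (N : Lift k Γ (BalancedTensor k Γ Λ X V) S) :
    ∃ L : Lift k Λ V S, MapsTo (𝟙 S) (L.tensor X) N := by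
  let K : Lift k Λ (BalancedTensor k Λ Λ P V) S := exists_trivial.some
  let E : BalancedTensor k Λ Γ Y (BalancedTensor k Γ Λ X V) ≃ₗ[Λ]
    V × BalancedTensor k Λ Λ P V := splitEquiv e he
  obtain ⟨L, hL⟩ := exists_prod hD ((N.tensor Y (A := Λ)).congr E) K
  obtain ⟨w, hw, hwπ⟩ := exists_tensor_tensor_fst e he L
  have h := (mapsTo_congr_prod ((hD.prod DerivationsInner.of_projective).of_retract
    E.toLinearMap E.symm.toLinearMap E.symm_apply_apply) E _ L K w hw hwπ).trans_right hL
  refine ⟨L, MapsTo.of_tensor e' he' ?_⟩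
  obtain ⟨u, h1, h2, h3⟩ := h
  exact ⟨u, h1, h2, fun x => E.injective (h3 x)⟩

/-- The functor `X ⊗_Λ -` transports versal lifts. -/
theorem exists_isVersal_tensor (e : BalancedTensor k Λ Γ Y X ≃ₗ[Λ] Λ × P)
    (he : ∀ (a : Λ) (t : BalancedTensor k Λ Γ Y X),
      e (rightMul k Λ Γ Y X Λ a t) = MulOpposite.op a • e t)
    (e' : BalancedTensor k Γ Λ X Y ≃ₗ[Γ] Γ × Q)
    (he' : ∀ (a : Γ) (t : BalancedTensor k Γ Λ X Y),
      e' (rightMul k Γ Λ X Y Γ a t) = MulOpposite.op a • e' t)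
    [Module.Finite k Λ] [Module.Finite k X] [Module.Finite k Y] [Module.Finite k P]
    [Module.Finite k V] [Module.Projective Λ (BalancedTensor k Λ Λ P V)]
    (hD : DerivationsInner k Λ V (BalancedTensor k Λ Λ P V))
    {U : Lift k Λ V R} (hU : U.IsVersal) :
    ∃ U' : Lift k Γ (BalancedTensor k Γ Λ X V) R, U'.IsVersal :=
  ⟨_, IsVersal.transfer (fun L => L.tensor X) MapsTo.tensor (MapsTo.of_tensor e he)
    (exists_mapsTo_tensor e he e' he' hD) hU⟩

end Lift

/-! ### Projectivity and exactness of tensor products -/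

namespace BalancedTensor

section

variable {k : Type u} [Field k] {A Λ : Type u} [Ring A] [Algebra k A] [Ring Λ] [Algebra k Λ]
  {X : Type u} [AddCommGroup X] [Module k X] [Module A X] [Module Λᵐᵒᵖ X]
  [IsScalarTower k A X] [SMulCommClass A Λᵐᵒᵖ X]
  {Y : Type u} [AddCommGroup Y] [Module k Y] [Module Λ Y] [IsScalarTower k Λ Y]

lemma mk_zero (x : X) : mk k A Λ x (0 : Y) = 0 := by
  rw [mk, TensorProduct.tmul_zero, Submodule.Quotient.mk_zero]

lemma zero_mk (y : Y) : mk k A Λ (0 : X) y = 0 := by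
  rw [mk, TensorProduct.zero_tmul, Submodule.Quotient.mk_zero]

/-- If `X` is projective over `A` and `Y` over `Λ`, then `X ⊗_Λ Y` is projective over `A`. -/
lemma projective [IsScalarTower k Λᵐᵒᵖ X] [Module.Projective A X] [Module.Projective Λ Y] :
    Module.Projective A (BalancedTensor k A Λ X Y) := by
  obtain ⟨s, hs⟩ := Module.projective_def'.1 (inferInstance : Module.Projective Λ Y)
  classical
  -- a section of `Λ^(Y) → Y` exhibits `X ⊗_Λ Y` as a direct summand of `X^(Y)`
  let φ : X → Λ →+ X := fun x => AddMonoidHom.mk' (fun a => MulOpposite.op a • x)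
    fun a b => by rw [MulOpposite.op_add, add_smul]
  let f : X →ₗ[k] Y →ₗ[k] (Y →₀ X) := LinearMap.mk₂ k
    (fun x y => Finsupp.mapRange.addMonoidHom (φ x) (s y))
    (fun x x' y => by ext z; simp [φ, smul_add])
    (fun c x y => by ext z; simp [φ, smul_comm _ c x])
    (fun x y y' => by rw [map_add, map_add])
    (fun c x y => by ext z; simp [φ, LinearMap.map_smul_of_tower])
  have hf : ∀ x (a : Λ) y, f (MulOpposite.op a • x) y = f x (a • y) := fun x a y => by
    ext z; simp [f, φ, mul_smul]
  let i₀ : BalancedTensor k A Λ X Y →ₗ[k] (Y →₀ X) := lift f hf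
  let i : BalancedTensor k A Λ X Y →ₗ[A] (Y →₀ X) :=
    { i₀ with
      map_smul' := fun a z => by
        change i₀ (a • z) = a • i₀ z
        induction z using induction_on with
        | mk x y =>
          rw [smul_mk]
          ext z
          simp [i₀, f, φ, smul_comm a]
        | add z w hz hw => simp only [smul_add, map_add, hz, hw] }
  let r : (Y →₀ X) →ₗ[A] BalancedTensor k A Λ X Y := Finsupp.lsum ℕ fun y =>
    { toFun := fun x => mk k A Λ x y
      map_add' := fun x x' => add_mk x x' y
      map_smul' := fun a x => rfl }
  have : Module.Projective A (Y →₀ X) := Module.Projective.of_equiv (finsuppLequivDFinsupp A).symm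
  refine Module.Projective.of_split i r (LinearMap.ext fun z => ?_)
  have hi : ∀ x y, i (mk k A Λ x y) = Finsupp.mapRange.addMonoidHom (φ x) (s y) :=
    fun x y => lift_mk f hf x y
  induction z using induction_on with
  | add z w hz hw => rw [map_add, hz, hw, map_add]
  | mk x y =>
    rw [LinearMap.comp_apply, hi, LinearMap.id_apply]
    have key : ∀ p : Y →₀ Λ, r (Finsupp.mapRange.addMonoidHom (φ x) p) =
        mk k A Λ x (Finsupp.linearCombination Λ id p) := by
      intro p
      induction p using Finsupp.induction_linear with
      | zero => rw [map_zero, map_zero, map_zero, mk_zero]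
      | add p q hp hq => rw [map_add, map_add, hp, hq, map_add, mk_add]
      | single y a =>
        simp only [r, φ, Finsupp.mapRange.addMonoidHom_apply, Finsupp.mapRange_single,
          Finsupp.lsum_single, AddMonoidHom.mk'_apply, Finsupp.linearCombination_single, id_eq]
        exact mk_op_smul x a y
    rw [key]
    exact congrArg _ (LinearMap.congr_fun hs y)

variable {X' : Type u} [AddCommGroup X'] [Module k X'] [Module A X'] [Module Λᵐᵒᵖ X']
  [IsScalarTower k A X'] [SMulCommClass A Λᵐᵒᵖ X']
  {Y' : Type u} [AddCommGroup Y'] [Module k Y'] [Module Λ Y'] [IsScalarTower k Λ Y']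
  {Y'' : Type u} [AddCommGroup Y''] [Module k Y''] [Module Λ Y''] [IsScalarTower k Λ Y'']

lemma map_surjective {g : Y →ₗ[Λ] Y'} (hg : Function.Surjective g) :
    Function.Surjective (map k A X g) := by
  intro z
  induction z using induction_on with
  | mk x y =>
    obtain ⟨y, rfl⟩ := hg y
    exact ⟨mk k A Λ x y, rfl⟩
  | add z w hz hw =>
    obtain ⟨z, rfl⟩ := hz
    obtain ⟨w, rfl⟩ := hw
    exact ⟨z + w, map_add _ _ _⟩

section

variable [IsScalarTower k Λᵐᵒᵖ X] [Module.Finite Λᵐᵒᵖ X] [Module.Projective Λᵐᵒᵖ X]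

/-- `X ⊗_Λ -` is exact if `X` is projective as a right module. -/
lemma map_exact {g : Y →ₗ[Λ] Y'} {g' : Y' →ₗ[Λ] Y''} (h : Function.Exact g g') :
    Function.Exact (map k A X g) (map k A X g') := by
  obtain ⟨n, b, ξ, hb⟩ := exists_dualBasis Λ X
  intro z
  constructor
  · intro hz
    have h1 : ∀ j, ∃ y, g y = contract (ξ j) z := fun j => (h _).1 (by
      rw [← contract_map, hz, map_zero])
    choose y hy using h1
    refine ⟨∑ j, mk k A Λ (b j) (y j), ?_⟩
    simp only [map_sum, map_mk, hy]
    exact sum_mk_contract hb z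
  · rintro ⟨w, rfl⟩
    rw [← map_comp, h.linearMap_comp_eq_zero, map_zero_left]

lemma map_injective {g : Y →ₗ[Λ] Y'} (hg : Function.Injective g) :
    Function.Injective (map k A X g) := by
  obtain ⟨n, b, ξ, hb⟩ := exists_dualBasis Λ X
  rw [injective_iff_map_eq_zero]
  intro z hz
  rw [← sum_mk_contract hb z]
  refine Finset.sum_eq_zero fun j _ => ?_
  have : contract (ξ j) z = 0 := hg (by rw [← contract_map, hz, map_zero, map_zero])
  rw [this, mk_zero]

end

end

end BalancedTensor

/-! ### Gorenstein-projectivity of tensor products -/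

section HomExact

variable {Γ : Type u} [Ring Γ]

/-- Exact sequences stay exact under `Hom(-, N)` for injective `N`. -/
lemma exists_extension_of_injective (N : ModuleCat.{u} Γ) [Injective N]
    {A B C : Type u} [AddCommGroup A] [Module Γ A] [AddCommGroup B] [Module Γ B] [AddCommGroup C]
    [Module Γ C] {a : A →ₗ[Γ] B} {b : B →ₗ[Γ] C} (hab : Function.Exact a b) (h : B →ₗ[Γ] N)
    (hh : h ∘ₗ a = 0) : ∃ h' : C →ₗ[Γ] N, h' ∘ₗ b = h := by
  have hker : LinearMap.ker b ≤ LinearMap.ker h := fun x hx => by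
    obtain ⟨y, rfl⟩ := (hab x).1 hx
    exact LinearMap.congr_fun hh y
  have : Module.Injective Γ N := (Module.injective_iff_injective_object Γ N).2 inferInstance
  obtain ⟨h', hh'⟩ := Module.Injective.out (LinearMap.range b).subtype
    (Submodule.injective_subtype _)
    ((LinearMap.ker b).liftQ h hker ∘ₗ b.quotKerEquivRange.symm.toLinearMap)
  refine ⟨h', LinearMap.ext fun x => ?_⟩
  have := hh' ⟨b x, LinearMap.mem_range_self b x⟩
  rw [Submodule.subtype_apply] at this
  rw [LinearMap.comp_apply, this, LinearMap.comp_apply, LinearEquiv.coe_coe,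
    LinearMap.quotKerEquivRange_symm_apply_image, Submodule.mkQ_apply, Submodule.liftQ_apply]

/-- An acyclic complex of projective modules stays acyclic under `Hom(-, N)` if `N` has finite
injective dimension. -/
lemma exists_extension_of_hasInjectiveDimensionLT {C : ℤ → ModuleCat.{u} Γ}
    {f : ∀ i, C i →ₗ[Γ] C (i + 1)} (hC : ∀ i, Module.Projective Γ (C i))
    (hf : ∀ i, Function.Exact (f i) (f (i + 1))) (n : ℕ) (N : ModuleCat.{u} Γ)
    (hN : HasInjectiveDimensionLT N (n + 1)) (i : ℤ) (h : C (i + 1) →ₗ[Γ] N)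
    (hh : h ∘ₗ f i = 0) : ∃ h' : C (i + 1 + 1) →ₗ[Γ] N, h' ∘ₗ f (i + 1) = h := by
  induction n generalizing N i with
  | zero =>
    have : Injective N := injective_iff_hasInjectiveDimensionLT_one.2 hN
    exact exists_extension_of_injective N (hf i) h hh
  | succ n ih =>
    -- dimension shift along an embedding of `N` in an injective module `I`
    let I := Injective.under N
    let ι : N →ₗ[Γ] I := (Injective.ι N).hom
    have hι : Function.Injective ι := (ModuleCat.mono_iff_injective _).1 inferInstance
    let π : I →ₗ[Γ] (I ⧸ LinearMap.range ι) := (LinearMap.range ι).mkQ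
    have hπ : Function.Surjective π := Submodule.mkQ_surjective _
    have hιπ : Function.Exact ι π := LinearMap.exact_map_mkQ_range ι
    let S := ModuleCat.shortComplexOfCompEqZero ι π hιπ.linearMap_comp_eq_zero
    have hS : S.ShortExact := ModuleCat.shortComplex_shortExact S hιπ hι hπ
    have hN' : HasInjectiveDimensionLT S.X₃ (n + 1) :=
      (hS.hasInjectiveDimensionLT_X₃_iff n (inferInstanceAs (Injective I))).2 hN
    obtain ⟨g, hg⟩ := exists_extension_of_injective I (hf i) (ι ∘ₗ h)
      (by rw [LinearMap.comp_assoc, hh, LinearMap.comp_zero])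
    obtain ⟨u, hu⟩ := ih S.X₃ hN' (i + 1) (π ∘ₗ g) (by
      rw [LinearMap.comp_assoc, hg, ← LinearMap.comp_assoc, hιπ.linearMap_comp_eq_zero,
        LinearMap.zero_comp])
    have := hC (i + 1 + 1 + 1)
    obtain ⟨v, hv⟩ := Module.projective_lifting_property π u hπ
    have hmem : ∀ x, (g - v ∘ₗ f (i + 1 + 1)) x ∈ LinearMap.range ι := fun x => (hιπ _).1 (by
      have h1 := LinearMap.congr_fun hu x
      have h2 := LinearMap.congr_fun hv (f (i + 1 + 1) x)
      simp only [LinearMap.comp_apply] at h1 h2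
      rw [LinearMap.sub_apply, map_sub, LinearMap.comp_apply, h2, h1, sub_self])
    refine ⟨(LinearEquiv.ofInjective ι hι).symm.toLinearMap ∘ₗ
      LinearMap.codRestrict _ (g - v ∘ₗ f (i + 1 + 1)) hmem, LinearMap.ext fun x => hι ?_⟩
    have h3 := LinearMap.congr_fun hg x
    rw [LinearMap.comp_apply, LinearMap.comp_apply, LinearEquiv.coe_coe,
      ← LinearEquiv.ofInjective_apply ι (h := hι), LinearEquiv.apply_symm_apply]
    rw [LinearMap.codRestrict_apply, LinearMap.sub_apply, LinearMap.comp_apply,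
      (hf (i + 1)).apply_apply_eq_zero, map_zero, sub_zero]
    exact h3

end HomExact

namespace BalancedTensor

variable {k : Type u} [Field k] {A Λ : Type u} [Ring A] [Algebra k A] [Ring Λ] [Algebra k Λ]
  {X : Type u} [AddCommGroup X] [Module k X] [Module A X] [Module Λᵐᵒᵖ X]
  [IsScalarTower k A X] [SMulCommClass A Λᵐᵒᵖ X] [IsScalarTower k Λᵐᵒᵖ X]
  [Module.Finite Λᵐᵒᵖ X] [Module.Projective Λᵐᵒᵖ X]

/-- A bimodule which is projective on both sides sends Gorenstein-projective modules to
Gorenstein-projective modules, provided that the target algebra is Gorenstein. -/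
lemma isGorensteinProjective [Module.Projective A X]
    (hA : ∃ n : ℕ, HasInjectiveDimensionLE (ModuleCat.of A A) n)
    {V : Type u} [AddCommGroup V] [Module k V] [Module Λ V] [IsScalarTower k Λ V]
    (hV : IsGorensteinProjective Λ V) :
    IsGorensteinProjective A (BalancedTensor k A Λ X V) := by
  obtain ⟨n, hn⟩ := hA
  obtain ⟨P, f, hP, hf, -, ⟨e⟩⟩ := hV
  let _ := fun j => restrictModule k Λ (P j)
  have := fun j => restrictModule_isScalarTower (k := k) (Λ := Λ) (P j)
  have hP' : ∀ i, Module.Projective A (ModuleCat.of A (BalancedTensor k A Λ X (P i))) :=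
    fun i => projective
  have hf' : ∀ i, Function.Exact (map k A X (f i)) (map k A X (f (i + 1))) :=
    fun i => map_exact (hf i)
  refine ⟨fun i => ModuleCat.of A (BalancedTensor k A Λ X (P i)), fun i => map k A X (f i),
    hP', hf', fun i h => ⟨fun hh => ?_, ?_⟩, ?_⟩
  · exact exists_extension_of_hasInjectiveDimensionLT
      (C := fun i => ModuleCat.of A (BalancedTensor k A Λ X (P i))) hP' hf' n _ hn i h hh
  · rintro ⟨h', rfl⟩
    change (h' ∘ₗ _) ∘ₗ _ = 0
    rw [LinearMap.comp_assoc, (hf' i).linearMap_comp_eq_zero, LinearMap.comp_zero]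
  · let q : P (0 + 1) →ₗ[Λ] V := e.toLinearMap ∘ₗ (LinearMap.range (f 0)).mkQ
    have hq : Function.Surjective q := e.surjective.comp (Submodule.mkQ_surjective _)
    have hfq : Function.Exact (f 0) q := fun x => by
      change e (Submodule.Quotient.mk x) = 0 ↔ _
      rw [LinearEquiv.map_eq_zero_iff, Submodule.Quotient.mk_eq_zero]
      rfl
    have h1 := map_exact (k := k) (A := A) (X := X) hfq
    exact ⟨(Submodule.quotEquivOfEq _ _ h1.linearMap_ker_eq.symm).trans
      ((map k A X q).quotKerEquivOfSurjective (map_surjective hq))⟩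

end BalancedTensor

/-! ### Projective bimodules -/

/-- A form of Schanuel's lemma: if a module has a projective resolution of length one, then every
surjection onto it from a projective module has a projective kernel. -/
lemma projective_of_exact {Λ : Type*} [Ring Λ] {K F N L P : Type*} [AddCommGroup K] [Module Λ K]
    [AddCommGroup F] [Module Λ F] [AddCommGroup N] [Module Λ N] [AddCommGroup L] [Module Λ L]
    [AddCommGroup P] [Module Λ P] [Module.Projective Λ K] [Module.Projective Λ F]
    [Module.Projective Λ P] {ι : K →ₗ[Λ] F} {g : F →ₗ[Λ] N} (hι : Function.Injective ι)
    (hιg : Function.Exact ι g) (hg : Function.Surjective g) {j : L →ₗ[Λ] P} {q : P →ₗ[Λ] N}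
    (hj : Function.Injective j) (hjq : Function.Exact j q) (hq : Function.Surjective q) :
    Module.Projective Λ L := by
  obtain ⟨θ, hθ⟩ := Module.projective_lifting_property g q hg
  obtain ⟨θ', hθ'⟩ := Module.projective_lifting_property q g hq
  have hθ₁ : ∀ x, g (θ x) = q x := fun x => LinearMap.congr_fun hθ x
  have hθ₁' : ∀ x, q (θ' x) = g x := fun x => LinearMap.congr_fun hθ' x
  have h1 : ∀ x, (θ ∘ₗ j) x ∈ LinearMap.range ι := fun x => (hιg _).1 (by
    rw [LinearMap.comp_apply, hθ₁, hjq.apply_apply_eq_zero])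
  have h2 : ∀ x, LinearMap.coprod (θ' ∘ₗ ι) (LinearMap.id - θ' ∘ₗ θ) x ∈ LinearMap.range j :=
    fun x => (hjq _).1 (by simp [hθ₁, hθ₁', hιg.apply_apply_eq_zero])
  refine Module.Projective.of_split (M := K × P)
    (LinearMap.prod ((LinearEquiv.ofInjective ι hι).symm.toLinearMap ∘ₗ
      LinearMap.codRestrict _ _ h1) j)
    ((LinearEquiv.ofInjective j hj).symm.toLinearMap ∘ₗ LinearMap.codRestrict _ _ h2)
    (LinearMap.ext fun x => hj ?_)
  rw [LinearMap.comp_apply, LinearMap.comp_apply, LinearEquiv.coe_coe,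
    ← LinearEquiv.ofInjective_apply j (h := hj), LinearEquiv.apply_symm_apply]
  have h3 : ι ((LinearEquiv.ofInjective ι hι).symm (LinearMap.codRestrict _ _ h1 x)) = θ (j x) := by
    rw [← LinearEquiv.ofInjective_apply ι (h := hι), LinearEquiv.apply_symm_apply]
    rfl
  change θ' (ι ((LinearEquiv.ofInjective ι hι).symm (LinearMap.codRestrict _ _ h1 x))) +
    (j x - θ' (θ (j x))) = j x
  rw [h3]
  abel

/-- A projective `T`-module is projective over `R` if `T` is so, where `R` acts through a ring
homomorphism `φ : R → T`; the `R`-module `T` is replaced by an isomorphic one `N`. -/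
lemma projective_of_ringHom {R T M N : Type*} [Ring R] [Ring T] [AddCommGroup M] [Module T M]
    [Module.Projective T M] [Module R M] (φ : R →+* T) (hφ : ∀ (r : R) (x : M), φ r • x = r • x)
    [AddCommGroup N] [Module R N] [Module.Projective R N] (c : N ≃+ T)
    (hc : ∀ (r : R) (y : N), c (r • y) = φ r * c y) : Module.Projective R M := by
  classical
  obtain ⟨s, hs⟩ := Module.projective_def'.1 (inferInstance : Module.Projective T M)
  let i : M →ₗ[R] (M →₀ N) :=
    { toFun := fun x => Finsupp.mapRange.addMonoidHom c.symm.toAddMonoidHom (s x)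
      map_add' := fun x y => by rw [map_add, map_add]
      map_smul' := fun r x => by
        rw [← hφ, map_smul]
        ext m
        apply c.injective
        simp [hc] }
  let r : (M →₀ N) →ₗ[R] M := Finsupp.lsum ℕ fun m =>
    { toFun := fun y => c y • m
      map_add' := fun y y' => by rw [map_add, add_smul]
      map_smul' := fun a y => by rw [hc, mul_smul, hφ]; rfl }
  have : Module.Projective R (M →₀ N) := Module.Projective.of_equiv (finsuppLequivDFinsupp R).symm
  refine Module.Projective.of_split i r (LinearMap.ext fun x => ?_)
  have key : ∀ p : M →₀ T, r (Finsupp.mapRange.addMonoidHom c.symm.toAddMonoidHom p) =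
      Finsupp.linearCombination T id p := by
    intro p
    induction p using Finsupp.induction_linear with
    | zero => simp
    | add p q hp hq => rw [map_add, map_add, hp, hq, map_add]
    | single m t => simp [r]
  exact (key (s x)).trans (LinearMap.congr_fun hs x)

namespace BalancedTensor

section MapLeft

variable {k : Type u} [Field k] {A Λ : Type u} [Ring A] [Algebra k A] [Ring Λ] [Algebra k Λ]
  {X : Type u} [AddCommGroup X] [Module k X] [Module A X] [Module Λᵐᵒᵖ X]
  [IsScalarTower k A X] [SMulCommClass A Λᵐᵒᵖ X]
  {X' : Type u} [AddCommGroup X'] [Module k X'] [Module A X'] [Module Λᵐᵒᵖ X']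
  [IsScalarTower k A X'] [SMulCommClass A Λᵐᵒᵖ X']
  {Y : Type u} [AddCommGroup Y] [Module k Y] [Module Λ Y] [IsScalarTower k Λ Y]

/-- A map of bimodules induces a map on tensor products. -/
def mapBimodule (f : X →ₗ[k] X')
    (hf : ∀ (a : Λ) x, f (MulOpposite.op a • x) = MulOpposite.op a • f x)
    (hA : ∀ (a : A) x, f (a • x) = a • f x) :
    BalancedTensor k A Λ X Y →ₗ[A] BalancedTensor k A Λ X' Y :=
  { mapLeft A f hf with
    map_smul' := fun a z => by
      change mapLeft A f hf (a • z) = a • mapLeft A f hf z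
      induction z using induction_on with
      | mk x y => rw [smul_mk, mapLeft_mk, hA, mapLeft_mk, smul_mk]
      | add z w hz hw => rw [smul_add, map_add, hz, hw, map_add, smul_add] }

lemma mapBimodule_mk (f : X →ₗ[k] X') (hf) (hA) (x : X) (y : Y) :
    mapBimodule f hf hA (mk k A Λ x y) = mk k A Λ (f x) y :=
  mapLeft_mk f hf x y

end MapLeft

section Enveloping

variable {k : Type u} [Field k] {Λ : Type u} [Ring Λ] [Algebra k Λ]
  {B : Type u} [AddCommGroup B] [Module k B] [Module Λ B] [Module Λᵐᵒᵖ B]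
  [IsScalarTower k Λ B] [IsScalarTower k Λᵐᵒᵖ B] [SMulCommClass Λ Λᵐᵒᵖ B]
  [Module (Λ ⊗[k] Λᵐᵒᵖ) B]

/-- A projective bimodule is projective on the left, because `Λ ⊗[k] Λᵐᵒᵖ` is free over `Λ`. -/
lemma projective_left_of_enveloping (hB : ∀ (a : Λ) (b : Λᵐᵒᵖ) (x : B), (a ⊗ₜ[k] b) • x = a • b • x)
    [Module.Projective (Λ ⊗[k] Λᵐᵒᵖ) B] : Module.Projective Λ B :=
  projective_of_ringHom (N := Λ ⊗[k] Λᵐᵒᵖ)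
    (Algebra.TensorProduct.includeLeft : Λ →ₐ[k] Λ ⊗[k] Λᵐᵒᵖ).toRingHom
    (fun a x => by simpa using hB a 1 x) (AddEquiv.refl _) fun a t => by
      induction t with
      | zero => simp
      | add t t' h h' => simp only [smul_add, map_add, h, h', mul_add]
      | tmul x y => simp [TensorProduct.smul_tmul']

/-- A projective bimodule is projective on the right, because `Λ ⊗[k] Λᵐᵒᵖ` is free over `Λᵐᵒᵖ`. -/
lemma projective_right_of_enveloping
    (hB : ∀ (a : Λ) (b : Λᵐᵒᵖ) (x : B), (a ⊗ₜ[k] b) • x = a • b • x)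
    [Module.Projective (Λ ⊗[k] Λᵐᵒᵖ) B] : Module.Projective Λᵐᵒᵖ B :=
  projective_of_ringHom (N := Λᵐᵒᵖ ⊗[k] Λ)
    (Algebra.TensorProduct.includeRight : Λᵐᵒᵖ →ₐ[k] Λ ⊗[k] Λᵐᵒᵖ).toRingHom
    (fun a x => by simpa using hB 1 a x) (TensorProduct.comm k Λᵐᵒᵖ Λ).toAddEquiv fun a t => by
      induction t with
      | zero => simp
      | add t t' h h' => simp only [smul_add, map_add, h, h', mul_add]
      | tmul x y => simp [TensorProduct.smul_tmul']

variable {W : Type u} [AddCommGroup W] [Module k W] [Module Λ W] [IsScalarTower k Λ W]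

/-- A criterion for `B ⊗_Λ W` to be projective if `B` is a projective bimodule, in terms of a
substitute `G` for `(Λ ⊗[k] Λᵐᵒᵖ) ⊗_Λ W` over which `B ⊗_Λ W` splits. -/
lemma projective_of_enveloping_aux
    (hB : ∀ (a : Λ) (b : Λᵐᵒᵖ) (x : B), (a ⊗ₜ[k] b) • x = a • b • x)
    [Module.Projective (Λ ⊗[k] Λᵐᵒᵖ) B] {G : Type u} [AddCommGroup G] [Module k G] [Module Λ G]
    [Module.Projective Λ G] (γ : W →ₗ[k] (Λ ⊗[k] Λᵐᵒᵖ) →ₗ[k] G)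
    (hγl : ∀ w (a : Λ) t, γ w ((a ⊗ₜ 1) * t) = a • γ w t)
    (hγr : ∀ w (a : Λ) t, γ w ((1 ⊗ₜ MulOpposite.op a) * t) = γ (a • w) t)
    (r₀ : B → G →ₗ[Λ] BalancedTensor k Λ Λ B W)
    (hr₀ : ∀ b w t, r₀ b (γ w t) = mk k Λ Λ (t • b) w) :
    Module.Projective Λ (BalancedTensor k Λ Λ B W) := by
  classical
  obtain ⟨s, hs⟩ := Module.projective_def'.1
    (inferInstance : Module.Projective (Λ ⊗[k] Λᵐᵒᵖ) B)
  have hsl : ∀ (a : Λ) x, s (a • x) = (a ⊗ₜ 1 : Λ ⊗[k] Λᵐᵒᵖ) • s x := fun a x => by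
    rw [← map_smul, hB, one_smul]
  have hsr : ∀ (a : Λ) x, s (MulOpposite.op a • x) =
      (1 ⊗ₜ MulOpposite.op a : Λ ⊗[k] Λᵐᵒᵖ) • s x := fun a x => by
    rw [← map_smul, hB, one_smul]
  have hsk : ∀ (c : k) x, s (c • x) = c • s x := fun c x => by
    rw [← algebraMap_smul Λ c x, hsl]
    ext y
    rw [Finsupp.smul_apply, Finsupp.smul_apply, smul_eq_mul, Algebra.algebraMap_eq_smul_one,
      ← TensorProduct.smul_tmul', smul_mul_assoc, ← Algebra.TensorProduct.one_def, one_mul]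
  let f : B →ₗ[k] W →ₗ[k] (B →₀ G) := LinearMap.mk₂ k
    (fun x w => Finsupp.mapRange.addMonoidHom (γ w).toAddMonoidHom (s x))
    (fun x x' w => by rw [map_add, map_add])
    (fun c x w => by ext z; simp [hsk])
    (fun x w w' => by ext z; simp)
    (fun c x w => by ext z; simp)
  have hf : ∀ x (a : Λ) w, f (MulOpposite.op a • x) w = f x (a • w) := fun x a w => by
    ext z
    simp only [f, LinearMap.mk₂_apply, hsr, Finsupp.mapRange.addMonoidHom_apply,
      Finsupp.mapRange_apply, Finsupp.smul_apply, smul_eq_mul]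
    exact hγr _ _ _
  let i₀ : BalancedTensor k Λ Λ B W →ₗ[k] (B →₀ G) := lift f hf
  let i : BalancedTensor k Λ Λ B W →ₗ[Λ] (B →₀ G) :=
    { i₀ with
      map_smul' := fun a z => by
        change i₀ (a • z) = a • i₀ z
        induction z using induction_on with
        | mk x y =>
          rw [smul_mk]
          ext z
          simp only [i₀, lift_mk, f, LinearMap.mk₂_apply, hsl, Finsupp.mapRange.addMonoidHom_apply,
            Finsupp.mapRange_apply, Finsupp.smul_apply, smul_eq_mul]
          exact hγl _ _ _
        | add z w hz hw => simp only [smul_add, map_add, hz, hw] }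
  let r : (B →₀ G) →ₗ[Λ] BalancedTensor k Λ Λ B W := Finsupp.lsum ℕ r₀
  have : Module.Projective Λ (B →₀ G) := Module.Projective.of_equiv (finsuppLequivDFinsupp Λ).symm
  refine Module.Projective.of_split i r (LinearMap.ext fun z => ?_)
  have hi : ∀ x w, i (mk k Λ Λ x w) = Finsupp.mapRange.addMonoidHom (γ w).toAddMonoidHom (s x) :=
    fun x w => lift_mk f hf x w
  induction z using induction_on with
  | add z w hz hw => rw [map_add, hz, hw, map_add]
  | mk x w =>
    rw [LinearMap.comp_apply, hi, LinearMap.id_apply]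
    have key : ∀ p : B →₀ Λ ⊗[k] Λᵐᵒᵖ,
        r (Finsupp.mapRange.addMonoidHom (γ w).toAddMonoidHom p) =
          mk k Λ Λ (Finsupp.linearCombination (Λ ⊗[k] Λᵐᵒᵖ) id p) w := by
      intro p
      induction p using Finsupp.induction_linear with
      | zero => rw [map_zero, map_zero, map_zero, zero_mk]
      | add p q hp hq => rw [map_add, map_add, hp, hq, map_add, add_mk]
      | single b t =>
        simp only [r, Finsupp.mapRange.addMonoidHom_apply, Finsupp.mapRange_single,
          Finsupp.lsum_single, Finsupp.linearCombination_single, id_eq]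
        exact hr₀ b w t
    rw [key]
    exact congrArg (fun x => mk k Λ Λ x w) (LinearMap.congr_fun hs x)

/-- A projective bimodule `B` sends every module to a projective one: `B ⊗_Λ W` is a direct
summand of a sum of copies of `Λ ⊗[k] W`. -/
lemma projective_of_enveloping (hB : ∀ (a : Λ) (b : Λᵐᵒᵖ) (x : B), (a ⊗ₜ[k] b) • x = a • b • x)
    [Module.Projective (Λ ⊗[k] Λᵐᵒᵖ) B] : Module.Projective Λ (BalancedTensor k Λ Λ B W) := by
  let ρ : W →ₗ[k] Λᵐᵒᵖ →ₗ[k] W := LinearMap.mk₂ k (fun w b => b.unop • w)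
    (fun w w' b => smul_add _ _ _) (fun c w b => smul_comm _ _ _)
    (fun w b b' => by rw [MulOpposite.unop_add, add_smul])
    (fun c w b => by rw [MulOpposite.unop_smul, smul_assoc])
  let r₀ : B → Λ ⊗[k] W →ₗ[Λ] BalancedTensor k Λ Λ B W := fun b =>
    TensorProduct.AlgebraTensorModule.lift
      { toFun := fun a =>
          { toFun := fun w => mk k Λ Λ (a • b) w
            map_add' := fun w w' => mk_add _ w w'
            map_smul' := fun c w => mk_smul' c _ w }
        map_add' := fun a a' => by ext w; simp [add_smul, add_mk]
        map_smul' := fun a a' => by ext w; simp [mul_smul, smul_mk] }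
  refine projective_of_enveloping_aux hB (LinearMap.lTensorHom Λ ∘ₗ ρ) (fun w a t => ?_)
    (fun w a t => ?_) r₀ fun b w t => ?_
  · induction t with
    | zero => simp
    | add t t' h h' => rw [mul_add, map_add, h, h', map_add, smul_add]
    | tmul x y => simp [TensorProduct.smul_tmul']
  · induction t with
    | zero => simp
    | add t t' h h' => rw [mul_add, map_add, h, h', map_add]
    | tmul x y => simp [ρ, mul_smul]
  · induction t with
    | zero =>
      rw [map_zero, map_zero]
      exact ((congrArg (mk k Λ Λ · w) (zero_smul (Λ ⊗[k] Λᵐᵒᵖ) b)).trans (zero_mk w)).symm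
    | add t t' h h' => simp only [map_add, add_smul, add_mk, h, h']
    | tmul a b' =>
      rw [hB, smul_comm]
      exact (mk_op_smul (a • b) b'.unop w).symm

end Enveloping

end BalancedTensor

/-! ### Bimodules of finite projective dimension -/

/-- Short exact sequences with projective quotient split. -/
lemma exists_splitting {R K F B : Type*} [Ring R] [AddCommGroup K] [Module R K] [AddCommGroup F]
    [Module R F] [AddCommGroup B] [Module R B] [Module.Projective R B] {ι : K →ₗ[R] F}
    {p : F →ₗ[R] B} (hι : Function.Injective ι) (hιp : Function.Exact ι p)
    (hp : Function.Surjective p) : ∃ (ρ : F →ₗ[R] K) (σ : B →ₗ[R] F), (∀ x, ρ (ι x) = x) ∧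
      ∀ x, ι (ρ x) + σ (p x) = x := by
  obtain ⟨σ, hσ'⟩ := Module.projective_lifting_property p LinearMap.id hp
  have hσ : ∀ x, p (σ x) = x := fun x => LinearMap.congr_fun hσ' x
  have h1 : ∀ x, (LinearMap.id - σ ∘ₗ p : F →ₗ[R] F) x ∈ LinearMap.range ι := fun x =>
    (hιp _).1 (by simp [hσ])
  have h2 : ∀ x, ι ((LinearEquiv.ofInjective ι hι).symm (LinearMap.codRestrict _ _ h1 x)) =
      x - σ (p x) := fun x => by
    rw [← LinearEquiv.ofInjective_apply ι (h := hι), LinearEquiv.apply_symm_apply]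
    rfl
  refine ⟨(LinearEquiv.ofInjective ι hι).symm.toLinearMap ∘ₗ LinearMap.codRestrict _ _ h1, σ,
    fun x => hι ((h2 (ι x)).trans ?_), fun x => ?_⟩
  · rw [hιp.apply_apply_eq_zero, map_zero, sub_zero]
  · exact (congrArg (· + σ (p x)) (h2 x)).trans (sub_add_cancel _ _)

namespace BalancedTensor

variable {k : Type u} [Field k] {Λ : Type u} [Ring Λ] [Algebra k Λ]
  {B : Type u} [AddCommGroup B] [Module k B] [Module Λ B] [Module Λᵐᵒᵖ B]
  [IsScalarTower k Λ B] [IsScalarTower k Λᵐᵒᵖ B] [SMulCommClass Λ Λᵐᵒᵖ B]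

section Step

variable {F : Type u} [AddCommGroup F] [Module k F] [Module Λ F] [Module Λᵐᵒᵖ F]
  [IsScalarTower k Λ F] [IsScalarTower k Λᵐᵒᵖ F] [SMulCommClass Λ Λᵐᵒᵖ F]
  {K : Type u} [AddCommGroup K] [Module k K] [Module Λ K] [Module Λᵐᵒᵖ K]
  [IsScalarTower k Λ K] [IsScalarTower k Λᵐᵒᵖ K] [SMulCommClass Λ Λᵐᵒᵖ K]

/-- If `0 → K → F → B → 0` is an exact sequence of bimodules which splits on the right, and `K`
and `F` make all cokernels of an acyclic complex of projectives projective, then so does `B`. -/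
lemma projective_coker_of_exact [Module.Projective Λ B] [Module.Projective Λᵐᵒᵖ B]
    [Module.Finite Λᵐᵒᵖ B] {ι : K →ₗ[k] F} {p : F →ₗ[k] B}
    (hιl : ∀ (a : Λ) x, ι (a • x) = a • ι x)
    (hιr : ∀ (a : Λ) x, ι (MulOpposite.op a • x) = MulOpposite.op a • ι x)
    (hpl : ∀ (a : Λ) x, p (a • x) = a • p x)
    (hpr : ∀ (a : Λ) x, p (MulOpposite.op a • x) = MulOpposite.op a • p x)
    (hι : Function.Injective ι) (hιp : Function.Exact ι p) (hp : Function.Surjective p)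
    {C : ℤ → ModuleCat.{u} Λ} [∀ i, Module k (C i)] [∀ i, IsScalarTower k Λ (C i)]
    {f : ∀ i, C i →ₗ[Λ] C (i + 1)} (hC : ∀ i, Module.Projective Λ (C i))
    (hf : ∀ i, Function.Exact (f i) (f (i + 1)))
    (hK : ∀ i, Module.Projective Λ
      (BalancedTensor k Λ Λ K (C (i + 1) ⧸ LinearMap.range (f i))))
    (hF : ∀ i, Module.Projective Λ
      (BalancedTensor k Λ Λ F (C (i + 1) ⧸ LinearMap.range (f i)))) (i : ℤ) :
    Module.Projective Λ (BalancedTensor k Λ Λ B (C (i + 1) ⧸ LinearMap.range (f i))) := by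
  let ιr : K →ₗ[Λᵐᵒᵖ] F := { ι with map_smul' := fun a x => hιr a.unop x }
  let pr : F →ₗ[Λᵐᵒᵖ] B := { p with map_smul' := fun a x => hpr a.unop x }
  obtain ⟨ρ, σ, hρι, hsplit⟩ := exists_splitting (ι := ιr) (p := pr) hι hιp hp
  -- the resolution of length one of `B ⊗ W` coming from that of `B`
  let W := C (i + 1 + 1) ⧸ LinearMap.range (f (i + 1))
  let ι' : BalancedTensor k Λ Λ K W →ₗ[Λ] BalancedTensor k Λ Λ F W := mapBimodule ι hιr hιl
  let p' : BalancedTensor k Λ Λ F W →ₗ[Λ] BalancedTensor k Λ Λ B W := mapBimodule p hpr hpl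
  let ρ' : BalancedTensor k Λ Λ F W →ₗ[k] BalancedTensor k Λ Λ K W :=
    mapLeft Λ (ρ.restrictScalars k) fun a x => ρ.map_smul _ x
  let σ' : BalancedTensor k Λ Λ B W →ₗ[k] BalancedTensor k Λ Λ F W :=
    mapLeft Λ (σ.restrictScalars k) fun a x => σ.map_smul _ x
  have hι'mk : ∀ x w, ι' (mk k Λ Λ x w) = mk k Λ Λ (ι x) w := fun x w => mapBimodule_mk _ _ _ _ _
  have hp'mk : ∀ x w, p' (mk k Λ Λ x w) = mk k Λ Λ (p x) w := fun x w => mapBimodule_mk _ _ _ _ _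
  have hρ'mk : ∀ x w, ρ' (mk k Λ Λ x w) = mk k Λ Λ (ρ x) w := fun x w => mapLeft_mk _ _ _ _
  have hσ'mk : ∀ x w, σ' (mk k Λ Λ x w) = mk k Λ Λ (σ x) w := fun x w => mapLeft_mk _ _ _ _
  have h1 : ∀ z, ρ' (ι' z) = z := fun z => by
    induction z using induction_on with
    | mk x w => rw [hι'mk, hρ'mk]; exact congrArg (fun x => mk k Λ Λ x w) (hρι x)
    | add z w hz hw => rw [map_add, map_add, hz, hw]
  have h2 : ∀ z, ι' (ρ' z) + σ' (p' z) = z := fun z => by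
    induction z using induction_on with
    | mk x w =>
      rw [hρ'mk, hι'mk, hp'mk, hσ'mk, ← add_mk]
      exact congrArg (fun x => mk k Λ Λ x w) (hsplit x)
    | add z w hz hw =>
      rw [map_add, map_add, map_add, map_add, add_add_add_comm, hz, hw]
  have h3 : ∀ z, p' (ι' z) = 0 := fun z => by
    induction z using induction_on with
    | mk x w => rw [hι'mk, hp'mk, hιp.apply_apply_eq_zero, zero_mk]
    | add z w hz hw => rw [map_add, map_add, hz, hw, add_zero]
  have hι' : Function.Injective ι' := Function.LeftInverse.injective h1
  have hιp' : Function.Exact ι' p' := fun z => ⟨fun hz => ⟨ρ' z, by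
    have := h2 z
    rwa [hz, map_zero, add_zero] at this⟩, by rintro ⟨y, rfl⟩; exact h3 y⟩
  have hp' : Function.Surjective p' := fun z => by
    induction z using induction_on with
    | mk x w =>
      obtain ⟨x, rfl⟩ := hp x
      exact ⟨_, hp'mk x w⟩
    | add z w hz hw =>
      obtain ⟨z, rfl⟩ := hz
      obtain ⟨w, rfl⟩ := hw
      exact ⟨z + w, map_add _ _ _⟩
  -- the cokernels of consecutive differentials are linked by a projective module
  have hker : LinearMap.ker (f (i + 1)) = LinearMap.range (f i) := (hf i).linearMap_ker_eq
  let j : (C (i + 1) ⧸ LinearMap.range (f i)) →ₗ[Λ] C (i + 1 + 1) :=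
    (LinearMap.range (f i)).liftQ (f (i + 1)) hker.ge
  have hj : Function.Injective j := by
    rw [← LinearMap.ker_eq_bot]
    exact Submodule.ker_liftQ_eq_bot' _ _ hker.symm
  have hjq : Function.Exact j (LinearMap.range (f (i + 1))).mkQ := by
    rw [LinearMap.exact_iff, Submodule.ker_mkQ, Submodule.range_liftQ]
  have := hK (i + 1)
  have := hF (i + 1)
  have := hC (i + 1 + 1)
  have : Module.Projective Λ (BalancedTensor k Λ Λ B (C (i + 1 + 1))) := projective
  exact projective_of_exact hι' hιp' hp' (map_injective (k := k) (A := Λ) (X := B) hj)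
    (map_exact hjq) (map_surjective (Submodule.mkQ_surjective _))

end Step

variable (k Λ) in
/-- Modules over the enveloping algebra are bimodules. -/
lemma exists_bimodule_structure (M : Type*) [AddCommGroup M] [Module (Λ ⊗[k] Λᵐᵒᵖ) M] :
    ∃ (_ : Module k M) (_ : Module Λ M) (_ : Module Λᵐᵒᵖ M) (_ : IsScalarTower k Λ M)
      (_ : IsScalarTower k Λᵐᵒᵖ M) (_ : SMulCommClass Λ Λᵐᵒᵖ M),
      ∀ (a : Λ) (b : Λᵐᵒᵖ) (x : M), (a ⊗ₜ[k] b) • x = a • b • x := by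
  let i₁ : Module k M := Module.compHom M (algebraMap k (Λ ⊗[k] Λᵐᵒᵖ))
  let i₂ : Module Λ M := Module.compHom M
    (Algebra.TensorProduct.includeLeft : Λ →ₐ[k] Λ ⊗[k] Λᵐᵒᵖ).toRingHom
  let i₃ : Module Λᵐᵒᵖ M := Module.compHom M
    (Algebra.TensorProduct.includeRight : Λᵐᵒᵖ →ₐ[k] Λ ⊗[k] Λᵐᵒᵖ).toRingHom
  have h₁ : ∀ (c : k) (x : M), c • x = algebraMap k (Λ ⊗[k] Λᵐᵒᵖ) c • x := fun _ _ => rfl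
  have h₂ : ∀ (a : Λ) (x : M), a • x = (a ⊗ₜ 1 : Λ ⊗[k] Λᵐᵒᵖ) • x := fun _ _ => rfl
  have h₃ : ∀ (b : Λᵐᵒᵖ) (x : M), b • x = (1 ⊗ₜ b : Λ ⊗[k] Λᵐᵒᵖ) • x := fun _ _ => rfl
  refine ⟨i₁, i₂, i₃, IsScalarTower.of_algebraMap_smul fun c x => ?_,
    IsScalarTower.of_algebraMap_smul fun c x => ?_, ⟨fun a b x => ?_⟩, fun a b x => ?_⟩
  · rw [h₁, h₂, Algebra.TensorProduct.algebraMap_apply]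
  · rw [h₁, h₃, Algebra.TensorProduct.algebraMap_apply']
  · rw [h₂, h₃, h₂, h₃, smul_smul, smul_smul]
    simp
  · rw [h₂, h₃, smul_smul]
    simp

lemma isScalarTower_of_enveloping [Module (Λ ⊗[k] Λᵐᵒᵖ) B]
    (hB : ∀ (a : Λ) (b : Λᵐᵒᵖ) (x : B), (a ⊗ₜ[k] b) • x = a • b • x) :
    IsScalarTower k (Λ ⊗[k] Λᵐᵒᵖ) B :=
  IsScalarTower.of_algebraMap_smul fun c x => by
    have h : algebraMap k (Λ ⊗[k] Λᵐᵒᵖ) c = algebraMap k Λ c ⊗ₜ 1 := rfl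
    rw [h, hB, one_smul, _root_.algebraMap_smul Λ c x]

/-- A bimodule of finite projective dimension, projective on both sides, sends the cokernels of an
acyclic complex of projective modules to projective modules. -/
lemma projective_coker_of_hasProjectiveDimensionLT [Module.Finite k Λ] (n : ℕ)
    {C : ℤ → ModuleCat.{u} Λ} [∀ i, Module k (C i)] [∀ i, IsScalarTower k Λ (C i)]
    {f : ∀ i, C i →ₗ[Λ] C (i + 1)} (hC : ∀ i, Module.Projective Λ (C i))
    (hf : ∀ i, Function.Exact (f i) (f (i + 1))) [Module.Finite k B]
    [Module.Projective Λ B] [Module.Projective Λᵐᵒᵖ B] [Module (Λ ⊗[k] Λᵐᵒᵖ) B]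
    (hB : ∀ (a : Λ) (b : Λᵐᵒᵖ) (x : B), (a ⊗ₜ[k] b) • x = a • b • x)
    (hn : HasProjectiveDimensionLT (ModuleCat.of (Λ ⊗[k] Λᵐᵒᵖ) B) (n + 1)) (i : ℤ) :
    Module.Projective Λ (BalancedTensor k Λ Λ B (C (i + 1) ⧸ LinearMap.range (f i))) := by
  induction n generalizing B i with
  | zero =>
    have : Module.Projective (Λ ⊗[k] Λᵐᵒᵖ) B := (IsProjective.iff_projective _).2
      (projective_iff_hasProjectiveDimensionLT_one.2 hn)
    exact projective_of_enveloping hB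
  | succ n ih =>
    have := isScalarTower_of_enveloping hB
    have : Module.Finite (Λ ⊗[k] Λᵐᵒᵖ) B := Module.Finite.of_restrictScalars_finite k _ _
    have : Module.Finite Λᵐᵒᵖ B := Module.Finite.of_restrictScalars_finite k _ _
    -- `F` is a free bimodule of finite rank mapping onto `B`, and `K` is the kernel
    obtain ⟨F, _, _, _, _, p, hp⟩ : ∃ (F : Type u) (_ : AddCommGroup F)
        (_ : Module (Λ ⊗[k] Λᵐᵒᵖ) F) (_ : Module.Free (Λ ⊗[k] Λᵐᵒᵖ) F)
        (_ : Module.Finite (Λ ⊗[k] Λᵐᵒᵖ) F) (p : F →ₗ[Λ ⊗[k] Λᵐᵒᵖ] B),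
          Function.Surjective p := by
      obtain ⟨m, p, hp⟩ := Module.Finite.exists_fin' (Λ ⊗[k] Λᵐᵒᵖ) B
      exact ⟨Fin m → Λ ⊗[k] Λᵐᵒᵖ, inferInstance, inferInstance, inferInstance, inferInstance, p, hp⟩
    obtain ⟨K, _, _, ι, hι, hιp⟩ : ∃ (K : Type u) (_ : AddCommGroup K)
        (_ : Module (Λ ⊗[k] Λᵐᵒᵖ) K) (ι : K →ₗ[Λ ⊗[k] Λᵐᵒᵖ] F),
          Function.Injective ι ∧ Function.Exact ι p :=
      ⟨LinearMap.ker p, inferInstance, inferInstance, (LinearMap.ker p).subtype,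
        Submodule.injective_subtype _, LinearMap.exact_subtype_ker_map p⟩
    let S := ModuleCat.shortComplexOfCompEqZero ι p hιp.linearMap_comp_eq_zero
    have hS : S.ShortExact := ModuleCat.shortComplex_shortExact S hιp hι hp
    have hK : HasProjectiveDimensionLT S.X₁ (n + 1) := (hS.hasProjectiveDimensionLT_X₃_iff n
      ((IsProjective.iff_projective F).1 inferInstance)).1 hn
    obtain ⟨_, _, _, _, _, _, hFT⟩ := exists_bimodule_structure k Λ F
    obtain ⟨_, _, _, _, _, _, hKT⟩ := exists_bimodule_structure k Λ K
    have := isScalarTower_of_enveloping hFT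
    have := isScalarTower_of_enveloping hKT
    have : Module.Finite k F := Module.Finite.trans (Λ ⊗[k] Λᵐᵒᵖ) F
    have : Module.Finite k K := Module.Finite.of_injective (ι.restrictScalars k) hι
    have hιl : ∀ (a : Λ) x, ι (a • x) = a • ι x := fun a x => by
      simpa [hKT, hFT] using ι.map_smul (a ⊗ₜ[k] (1 : Λᵐᵒᵖ)) x
    have hιr : ∀ (a : Λᵐᵒᵖ) x, ι (a • x) = a • ι x := fun a x => by
      simpa [hKT, hFT] using ι.map_smul ((1 : Λ) ⊗ₜ[k] a) x
    have hpl : ∀ (a : Λ) x, p (a • x) = a • p x := fun a x => by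
      simpa [hB, hFT] using p.map_smul (a ⊗ₜ[k] (1 : Λᵐᵒᵖ)) x
    have hpr : ∀ (a : Λᵐᵒᵖ) x, p (a • x) = a • p x := fun a x => by
      simpa [hB, hFT] using p.map_smul ((1 : Λ) ⊗ₜ[k] a) x
    have := projective_left_of_enveloping hFT
    have := projective_right_of_enveloping hFT
    have : Module.Projective Λ K := by
      let ι' : K →ₗ[Λ] F := { ι with map_smul' := hιl }
      let p' : F →ₗ[Λ] B := { p with map_smul' := hpl }
      obtain ⟨ρ, -, hρ, -⟩ := exists_splitting (ι := ι') (p := p') hι hιp hp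
      exact Module.Projective.of_split ι' ρ (LinearMap.ext hρ)
    have : Module.Projective Λᵐᵒᵖ K := by
      let ι' : K →ₗ[Λᵐᵒᵖ] F := { ι with map_smul' := hιr }
      let p' : F →ₗ[Λᵐᵒᵖ] B := { p with map_smul' := hpr }
      obtain ⟨ρ, -, hρ, -⟩ := exists_splitting (ι := ι') (p := p') hι hιp hp
      exact Module.Projective.of_split ι' ρ (LinearMap.ext hρ)
    exact projective_coker_of_exact (ι := ι.restrictScalars k) (p := p.restrictScalars k)
      hιl (fun a => hιr _) hpl (fun a => hpr _) hι hιp hp hC hf (fun j => ih hKT hK j)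
      (fun j => projective_of_enveloping hFT) i

end BalancedTensor

/-! ### Singular equivalences of Morita type -/

namespace BalancedTensor

variable {k : Type u} [Field k] {Λ Γ : Type u} [Ring Λ] [Algebra k Λ] [Ring Γ] [Algebra k Γ]
  {X : Type u} [AddCommGroup X] [Module k X] [Module Γ X] [Module Λᵐᵒᵖ X]
  [IsScalarTower k Γ X] [IsScalarTower k Λᵐᵒᵖ X] [SMulCommClass Γ Λᵐᵒᵖ X]
  {Y : Type u} [AddCommGroup Y] [Module k Y] [Module Λ Y] [Module Γᵐᵒᵖ Y]
  [IsScalarTower k Λ Y] [IsScalarTower k Γᵐᵒᵖ Y] [SMulCommClass Λ Γᵐᵒᵖ Y]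
  {P : Type u} [AddCommGroup P] [Module k P] [Module Λ P] [Module Λᵐᵒᵖ P]
  [IsScalarTower k Λ P]

lemma contract_rightMul (ξ : Y →ₗ[Γᵐᵒᵖ] Γ) (a : Λ) (z : BalancedTensor k Λ Γ Y X) :
    contract ξ (rightMul k Λ Γ Y X Λ a z) = MulOpposite.op a • contract ξ z := by
  induction z using induction_on with
  | mk y x => rw [rightMul_mk, contract_mk, contract_mk, smul_comm]
  | add z w hz hw => simp only [map_add, hz, hw, smul_add]

/-- The bimodule `Y ⊗_Γ X` is projective as a left module. -/
lemma projective_left_of_splitting [Module.Projective Λ Y] [Module.Projective Γ X]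
    (e : BalancedTensor k Λ Γ Y X ≃ₗ[Λ] Λ × P) : Module.Projective Λ P :=
  have : Module.Projective Λ (BalancedTensor k Λ Γ Y X) := projective
  Module.Projective.of_split (e.symm.toLinearMap ∘ₗ LinearMap.inr Λ Λ P)
    (LinearMap.snd Λ Λ P ∘ₗ e.toLinearMap) (by ext x; simp)

/-- The bimodule `Y ⊗_Γ X` is, as a right module, a direct summand of a power of `X`. -/
lemma projective_right_of_splitting [Module.Projective Γᵐᵒᵖ Y] [Module.Finite Γᵐᵒᵖ Y]
    [Module.Projective Λᵐᵒᵖ X] (e : BalancedTensor k Λ Γ Y X ≃ₗ[Λ] Λ × P)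
    (he : ∀ (a : Λ) (t : BalancedTensor k Λ Γ Y X),
      e (rightMul k Λ Γ Y X Λ a t) = MulOpposite.op a • e t) : Module.Projective Λᵐᵒᵖ P := by
  obtain ⟨n, b, ξ, hb⟩ := exists_dualBasis Γ Y
  have he' : ∀ (a : Λ) (p : P),
      e.symm (0, MulOpposite.op a • p) = rightMul k Λ Γ Y X Λ a (e.symm (0, p)) := fun a p => by
    rw [LinearEquiv.symm_apply_eq, he, LinearEquiv.apply_symm_apply, Prod.smul_mk, smul_zero]
  let i : P →ₗ[Λᵐᵒᵖ] (Fin n → X) :=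
    { toFun := fun p j => contract (ξ j) (e.symm (0, p))
      map_add' := fun p p' => funext fun j => by
        rw [Pi.add_apply, ← map_add, ← map_add, Prod.mk_add_mk, add_zero]
      map_smul' := fun a p => funext fun j => by
        induction a using MulOpposite.rec' with
        | h a =>
        rw [he', contract_rightMul]
        rfl }
  let r : (Fin n → X) →ₗ[Λᵐᵒᵖ] P :=
    { toFun := fun x => (e (∑ j, mk k Λ Γ (b j) (x j))).2
      map_add' := fun x x' => by
        simp only [Pi.add_apply, mk_add, Finset.sum_add_distrib, map_add, Prod.snd_add]
      map_smul' := fun a x => by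
        induction a using MulOpposite.rec' with
        | h a =>
        have h : ∑ j, mk k Λ Γ (b j) ((MulOpposite.op a • x) j) =
            rightMul k Λ Γ Y X Λ a (∑ j, mk k Λ Γ (b j) (x j)) := by
          rw [map_sum]
          rfl
        rw [h, he]
        rfl }
  have : Module.Projective Λᵐᵒᵖ (Fin n → X) := by
    classical
    exact Module.Projective.of_equiv ((finsuppLequivDFinsupp Λᵐᵒᵖ).symm.trans
      (Finsupp.linearEquivFunOnFinite Λᵐᵒᵖ X (Fin n)))
  refine Module.Projective.of_split i r (LinearMap.ext fun p => ?_)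
  change (e (∑ j, mk k Λ Γ (b j) (contract (ξ j) (e.symm (0, p))))).2 = p
  rw [sum_mk_contract hb, LinearEquiv.apply_symm_apply]

/-- A bimodule of finite projective dimension, projective on both sides, sends
Gorenstein-projective modules to projective modules. -/
lemma projective_of_isGorensteinProjective [Module.Finite k Λ] [IsScalarTower k Λᵐᵒᵖ P]
    [SMulCommClass Λ Λᵐᵒᵖ P] [Module.Finite k P]
    [Module.Projective Λ P] [Module.Projective Λᵐᵒᵖ P] [Module (Λ ⊗[k] Λᵐᵒᵖ) P]
    (hP : ∀ (a : Λ) (b : Λᵐᵒᵖ) (x : P), (a ⊗ₜ[k] b) • x = a • b • x)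
    (hn : ∃ n : ℕ, HasProjectiveDimensionLE (ModuleCat.of (Λ ⊗[k] Λᵐᵒᵖ) P) n)
    {V : Type u} [AddCommGroup V] [Module k V] [Module Λ V] [IsScalarTower k Λ V]
    (hV : IsGorensteinProjective Λ V) : Module.Projective Λ (BalancedTensor k Λ Λ P V) := by
  obtain ⟨n, hn⟩ := hn
  obtain ⟨C, f, hC, hf, -, ⟨e⟩⟩ := hV
  let _ := fun j => restrictModule k Λ (C j)
  have := fun j => restrictModule_isScalarTower (k := k) (Λ := Λ) (C j)
  have := projective_coker_of_hasProjectiveDimensionLT n hC hf hP hn 0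
  refine Module.Projective.of_split (map k Λ P e.symm.toLinearMap) (map k Λ P e.toLinearMap)
    (LinearMap.ext fun z => ?_)
  rw [LinearMap.comp_apply, ← map_comp]
  have h : e.toLinearMap ∘ₗ e.symm.toLinearMap = LinearMap.id := by ext x; simp
  rw [h, map_id, LinearMap.id_apply]

end BalancedTensor

/-- A singular equivalence of Morita type between Gorenstein algebras preserves
Gorenstein-projective modules and their versal deformation rings. -/
theorem InduceSingularEquivalenceOfMoritaType.haveIsomorphicVersalDeformationRings
    {k : Type u} [Field k] {Λ Γ : Type u} [Ring Λ] [Algebra k Λ] [Ring Γ] [Algebra k Γ]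
    [Module.Finite k Λ] [Module.Finite k Γ]
    {X : Type u} [AddCommGroup X] [Module k X] [Module Γ X] [Module Λᵐᵒᵖ X]
    [IsScalarTower k Γ X] [IsScalarTower k Λᵐᵒᵖ X] [SMulCommClass Γ Λᵐᵒᵖ X]
    {Y : Type u} [AddCommGroup Y] [Module k Y] [Module Λ Y] [Module Γᵐᵒᵖ Y]
    [IsScalarTower k Λ Y] [IsScalarTower k Γᵐᵒᵖ Y] [SMulCommClass Λ Γᵐᵒᵖ Y]
    (h : InduceSingularEquivalenceOfMoritaType k Λ Γ X Y) (hΓ : IsGorensteinAlgebra Γ)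
    (V : Type u) [AddCommGroup V] [Module k V] [Module Λ V] [IsScalarTower k Λ V]
    [Module.Finite Λ V] (hV : IsGorensteinProjective Λ V) :
    Module.Finite Γ (BalancedTensor k Γ Λ X V) ∧
      IsGorensteinProjective Γ (BalancedTensor k Γ Λ X V) ∧
      HaveIsomorphicVersalDeformationRings k Λ V Γ (BalancedTensor k Γ Λ X V) := by
  obtain ⟨_, _, _, _, _, _, _, _, hXY, P, _, _, _, _, _, _, _, -, hn, e, he⟩ := h
  obtain ⟨Q, _, _, _, _, _, _, _, -, -, e', he'⟩ := hXY
  have : Module.Finite k V := Module.Finite.trans Λ V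
  have : Module.Finite k X := Module.Finite.trans Γ X
  have : Module.Finite k Y := Module.Finite.trans Λ Y
  have : Module.Finite k P := Module.Finite.of_surjective
    ((LinearMap.snd Λ Λ P ∘ₗ e.toLinearMap).restrictScalars k)
    (Prod.snd_surjective.comp e.surjective)
  have := BalancedTensor.projective_left_of_splitting e
  have := BalancedTensor.projective_right_of_splitting e he
  have : Module.Projective Λ (BalancedTensor k Λ Λ P V) :=
    letI : Module (Λ ⊗[k] Λᵐᵒᵖ) P := TensorProduct.Algebra.module
    BalancedTensor.projective_of_isGorensteinProjective (fun _ _ _ => rfl) hn hV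
  have : Module.Finite Λ (BalancedTensor k Λ Λ P V) := Module.Finite.of_restrictScalars_finite k _ _
  exact ⟨Module.Finite.of_restrictScalars_finite k _ _,
    BalancedTensor.isGorensteinProjective hΓ.1 hV,
    haveIsomorphicVersalDeformationRings_of_transfer fun R U hU =>
      Lift.exists_isVersal_tensor e he e' he' hV.derivationsInner hU⟩

end DeformationRings

theorem theorem1p1 {k : Type u} [Field k] {Λ : Type u} [Ring Λ] [Algebra k Λ] [Module.Finite k Λ]
    (V : Type u) [AddCommGroup V] [Module k V] [Module Λ V] [IsScalarTower k Λ V]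
    [Module.Finite Λ V] (hV : IsGorensteinProjective Λ V) :
    -- (i)
    (∀ (P : Type u) [AddCommGroup P] [Module Λ P] [Module.Finite Λ P] [Module.Projective Λ P],
      HaveIsomorphicVersalDeformationRings k Λ V Λ (V × P)) ∧
    -- (ii)
    (Nonempty (StableEnd Λ V ≃ₐ[k] k) →
      VersalDeformationRingIsUniversal k Λ V ∧
      (∃ W : ModuleCat.{u} Λ, IsFirstSyzygy Λ V W) ∧
      ∀ (W : Type u) [AddCommGroup W] [Module Λ W],
        IsFirstSyzygy Λ V W → VersalDeformationRingIsUniversal k Λ W) ∧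
    -- (iii)
    (∀ (Γ : Type u) [Ring Γ] [Algebra k Γ] [Module.Finite k Γ]
      (X : Type u) [AddCommGroup X] [Module k X] [Module Γ X] [Module Λᵐᵒᵖ X]
      [IsScalarTower k Γ X] [IsScalarTower k Λᵐᵒᵖ X] [SMulCommClass Γ Λᵐᵒᵖ X]
      (Y : Type u) [AddCommGroup Y] [Module k Y] [Module Λ Y] [Module Γᵐᵒᵖ Y]
      [IsScalarTower k Λ Y] [IsScalarTower k Γᵐᵒᵖ Y] [SMulCommClass Λ Γᵐᵒᵖ Y],
      IsGorensteinAlgebra Λ → IsGorensteinAlgebra Γ →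
      InduceSingularEquivalenceOfMoritaType k Λ Γ X Y →
        Module.Finite Γ (BalancedTensor k Γ Λ X V) ∧
        IsGorensteinProjective Γ (BalancedTensor k Γ Λ X V) ∧
        HaveIsomorphicVersalDeformationRings k Λ V Γ (BalancedTensor k Γ Λ X V)) := by
  refine ⟨fun P _ _ _ _ => hV.haveIsomorphicVersalDeformationRings_prod V P, fun ⟨e⟩ =>
    ⟨hV.versalDeformationRingIsUniversal e, exists_isFirstSyzygy k V, fun W _ _ hW =>
      hW.versalDeformationRingIsUniversal hV e⟩, ?_⟩
  intro Γ _ _ _ X _ _ _ _ _ _ _ Y _ _ _ _ _ _ _ _ hΓ h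
  exact h.haveIsomorphicVersalDeformationRings hΓ V hV
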